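/- Let $n\ge 2$, let $M$ be a connected $n$-dimensional $C^\infty$ manifold, let $a=a_{ij}(x)\,dx^i\otimes dx^j$ be a smooth Riemannian metric and $\beta=b_i(x)\,dx^i$ a smooth $1$-form on $M$ with $|\beta(y)|<\alpha(y):=\sqrt{a_{ij}(x)y^iy^j}$ for all $0\ne y\in TM$, and let $F=\alpha+\beta$ be the corresponding Randers metric. In standard coordinates $(x^i,y^i)$ of $TM_0=TM\setminus\{0\}$ put $$g_{ij}=\tfrac12\,\partial_{y^i}\partial_{y^j}F^2,\qquad (g^{ij})=(g_{ij})^{-1},\qquad C_{ijk}=\tfrac14\,\partial_{y^i}\partial_{y^j}\partial_{y^k}F^2,$$ $$I_i=g^{kl}C_{kli},\qquad I^k=g^{ki}I_i,\qquad \ell_i=\partial_{y^i}F,$$ $$G^i=\tfrac14 g^{il}\big(y^k\,\partial_{x^k}\partial_{y^l}F^2-\partial_{x^l}F^2\big),\qquad N^i_j=\partial_{y^j}G^i,\qquad \delta_k=\partial_{x^k}-N^r_k\,\partial_{y^r},$$ $$R^i{}_k=2\,\partial_{x^k}G^i-y^j\,\partial_{x^j}\partial_{y^k}G^i+2G^j\,\partial_{y^j}\partial_{y^k}G^i-\partial_{y^j}G^i\,\partial_{y^k}G^j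 .$$ Suppose that $F$ is of scalar flag curvature $\mathbf K$, i.e. $\mathbf K$ is a function on $TM_0$ such that for every $y\in T_xM\setminus\{0\}$ and every $u\in T_xM$ linearly independent of $y$, $$\frac{g_y(u,\mathbf R_y(u))}{g_y(y,y)\,g_y(u,u)-g_y(y,u)^2}=\mathbf K(x,y),\qquad g_y=g_{ij}\,dx^i\otimes dx^j,\quad \mathbf R_y(u)=R^i{}_k u^k\,\partial_{x^i}.$$ Let $$R_h{}^i{}_{jk}=\delta_k\Gamma^i_{hj}-\delta_j\Gamma^i_{hk}+\Gamma^m_{hj}\Gamma^i_{mk}-\Gamma^m_{hk}\Gamma^i_{mj}+g^{il}C_{lhm}\big(\delta_kN^m_j-\delta_jN^m_k\big),$$ $$\Gamma^i_{jk}=\tfrac12 g^{il}\big(\delta_jg_{lk}+\delta_kg_{jl}-\delta_lg_{jk}\big),$$ be the $hh$-curvature of the Cartan connection of $F$, and put $R_{hijk}=g_{ip}R_h{}^p{}_{jk}$, $R_{ijk}=y^hR_{hijk}$, $R_{i0k}=R_{ijk}y^j$, $R_{ij}=R_i{}^r{}_{jr}$, $R_{0j}=R_{ij}y^i$ and $$\mathfrak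 R_{ij}=R_{ij}-\frac1{n+1}\Big(I^kR_{ijk}+I^kR_{kji}+F^{-1}\ell_i\,I^kR_{k0j}+I_iR_{0j}\Big).$$ Suppose finally that $F$ is not Riemannian, i.e. $F$ is not the norm of a smooth Riemannian metric on $M$. Then $\mathbf K=0$ on $TM_0$ if and only if the tensor $\mathfrak R_{ij}$ is symmetric, i.e. $\mathfrak R_{ij}=\mathfrak R_{ji}$ on $TM_0$ for all $i,j$. -/

import Mathlib

open scoped Manifold ContDiff Bundle

/-! ### Local formulas

Throughout this section `L x y` is a Finsler metric written in a chart: `x` are the coordinates of the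
base point, `y` the components of the tangent vector. -/

namespace Finsler

noncomputable section

/-- The coordinate space `ℝⁿ`. -/
abbrev Coord (n : ℕ) := EuclideanSpace ℝ (Fin n)

/-- Functions `f(x, y)` of `2 n` real variables. -/
abbrev LocalFun (n : ℕ) := Coord n → Coord n → ℝ

/-- The partial derivative `∂f/∂xᵏ`. -/
def dX {n : ℕ} (k : Fin n) (f : LocalFun n) : LocalFun n :=
  fun x y => fderiv ℝ (fun x' => f x' y) x (EuclideanSpace.single k 1)

/-- The partial derivative `∂f/∂yᵏ`. -/
def dY {n : ℕ} (k : Fin n) (f : LocalFun n) : LocalFun n :=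
  fun x y => fderiv ℝ (fun y' => f x y') y (EuclideanSpace.single k 1)

/-- The function `F²`. -/
def sqFun {n : ℕ} (L : LocalFun n) : LocalFun n := fun x y => L x y ^ 2

/-- The fundamental tensor `g_{ij} = ½ ∂²F²/∂yⁱ∂yʲ`. -/
def fund {n : ℕ} (L : LocalFun n) (i j : Fin n) : LocalFun n :=
  fun x y => (1 / 2 : ℝ) * dY i (dY j (sqFun L)) x y

/-- The inverse `g^{ij}` of the fundamental tensor. -/
def fundInv {n : ℕ} (L : LocalFun n) (i j : Fin n) : LocalFun n :=
  fun x y => (Matrix.of (fun a b => fund L a b x y))⁻¹ i j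

/-- The Cartan tensor `C_{ijk} = ¼ ∂³F²/∂yⁱ∂yʲ∂yᵏ`. -/
def cartan {n : ℕ} (L : LocalFun n) (i j k : Fin n) : LocalFun n :=
  fun x y => (1 / 4 : ℝ) * dY i (dY j (dY k (sqFun L))) x y

/-- The Cartan tensor with its first index raised, `C^i_{jk} = g^{il} C_{ljk}`. -/
def cartanUp {n : ℕ} (L : LocalFun n) (i j k : Fin n) : LocalFun n :=
  fun x y => ∑ l, fundInv L i l x y * cartan L l j k x y

/-- The mean Cartan tensor `I_i = g^{kl} C_{kli}`. -/
def meanCartan {n : ℕ} (L : LocalFun n) (i : Fin n) : LocalFun n :=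
  fun x y => ∑ k, ∑ l, fundInv L k l x y * cartan L k l i x y

/-- The mean Cartan tensor with its index raised, `I^k = g^{ki} I_i`. -/
def meanCartanUp {n : ℕ} (L : LocalFun n) (k : Fin n) : LocalFun n :=
  fun x y => ∑ i, fundInv L k i x y * meanCartan L i x y

/-- The spray coefficients `Gⁱ = ¼ g^{il} ([F²]_{xᵏyˡ} yᵏ - [F²]_{xˡ})`. -/
def spray {n : ℕ} (L : LocalFun n) (i : Fin n) : LocalFun n :=
  fun x y => (1 / 4 : ℝ) * ∑ l, fundInv L i l x y *
    ((∑ k, dX k (dY l (sqFun L)) x y * y k) - dX l (sqFun L) x y)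

/-- The Riemann curvature
`R^i_k = 2 ∂Gⁱ/∂xᵏ - yʲ ∂²Gⁱ/∂xʲ∂yᵏ + 2 Gʲ ∂²Gⁱ/∂yʲ∂yᵏ - ∂Gⁱ/∂yʲ ∂Gʲ/∂yᵏ`. -/
def riemann {n : ℕ} (L : LocalFun n) (i k : Fin n) : LocalFun n :=
  fun x y => 2 * dX k (spray L i) x y
    - ∑ j, y j * dX j (dY k (spray L i)) x y
    + 2 * ∑ j, spray L j x y * dY j (dY k (spray L i)) x y
    - ∑ j, dY j (spray L i) x y * dY k (spray L j) x y

/-- The inner product `g_y(u, v) = g_{ij}(x, y) uⁱ vʲ`. -/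
def fundForm {n : ℕ} (L : LocalFun n) (x y u v : Coord n) : ℝ :=
  ∑ i, ∑ j, fund L i j x y * u i * v j

/-- The vector `R_y(u)`, with components `R^i_k(x, y) uᵏ`. -/
def riemannVec {n : ℕ} (L : LocalFun n) (x y u : Coord n) : Coord n :=
  WithLp.toLp 2 (fun i => ∑ k, riemann L i k x y * u k)

/-- The flag curvature of the flag `span {y, u}` with flagpole `y`:
`g_y(u, R_y u) / (g_y(y, y) g_y(u, u) - g_y(y, u)²)`. -/
def flagCurvature {n : ℕ} (L : LocalFun n) (x y u : Coord n) : ℝ :=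
  fundForm L x y u (riemannVec L x y u) /
    (fundForm L x y y y * fundForm L x y u u - fundForm L x y y u ^ 2)

/-- The nonlinear connection `N^i_j = ∂Gⁱ/∂yʲ`. -/
def nonlinConn {n : ℕ} (L : LocalFun n) (i j : Fin n) : LocalFun n :=
  dY j (spray L i)

/-- The horizontal derivative `δ_k f = ∂f/∂xᵏ - N^r_k ∂f/∂yʳ`. -/
def hDeriv {n : ℕ} (L : LocalFun n) (k : Fin n) (f : LocalFun n) : LocalFun n :=
  fun x y => dX k f x y - ∑ r, nonlinConn L r k x y * dY r f x y

/-- The horizontal coefficients of the Cartan connection, `∇_{δ_k} ∂_j = Γ^i_{jk} ∂_i` with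
`Γ^i_{jk} = ½ g^{il} (δ_j g_{lk} + δ_k g_{jl} - δ_l g_{jk})`. (Its vertical coefficients are the
`C^i_{jk}`, that is `∇_{∂/∂yᵏ} ∂_j = C^i_{jk} ∂_i`.) -/
def cartanConn {n : ℕ} (L : LocalFun n) (i j k : Fin n) : LocalFun n :=
  fun x y => (1 / 2 : ℝ) * ∑ l, fundInv L i l x y *
    (hDeriv L j (fund L l k) x y + hDeriv L k (fund L j l) x y - hDeriv L l (fund L j k) x y)

/-- The vertical components of the brackets of the horizontal fields:
`[δ_j, δ_k] = (δ_k N^i_j - δ_j N^i_k) ∂/∂yⁱ`. -/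
def connCurv {n : ℕ} (L : LocalFun n) (i j k : Fin n) : LocalFun n :=
  fun x y => hDeriv L k (nonlinConn L i j) x y - hDeriv L j (nonlinConn L i k) x y

/-- The `hh`-curvature `R_h{}^i{}_{jk}` of the Cartan connection, in the order `h i j k`:
`(∇_{δ_k} ∇_{δ_j} - ∇_{δ_j} ∇_{δ_k} - ∇_{[δ_k, δ_j]}) ∂_h = R_h{}^i{}_{jk} ∂_i`, written out. -/
def hhCurv {n : ℕ} (L : LocalFun n) (h i j k : Fin n) : LocalFun n :=
  fun x y => hDeriv L k (cartanConn L i h j) x y - hDeriv L j (cartanConn L i h k) x y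
    + ∑ m, (cartanConn L m h j x y * cartanConn L i m k x y
        - cartanConn L m h k x y * cartanConn L i m j x y)
    + ∑ m, cartanUp L i h m x y * connCurv L m j k x y

/-- The lowered `hh`-curvature `R_{himk} = g_{ip} R_h{}^p{}_{mk}`, in the order `h i m k`. -/
def hhCurvLow {n : ℕ} (L : LocalFun n) (h i m k : Fin n) : LocalFun n :=
  fun x y => ∑ p, fund L i p x y * hhCurv L h p m k x y

/-- The contraction `R_{ijk} = yʰ R_{hijk}`. -/
def curv3 {n : ℕ} (L : LocalFun n) (i j k : Fin n) : LocalFun n :=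
  fun x y => ∑ h, y h * hhCurvLow L h i j k x y

/-- The Ricci tensor `R_{ij} = R_i{}^r{}_{jr}`. -/
def ricci {n : ℕ} (L : LocalFun n) (i j : Fin n) : LocalFun n :=
  fun x y => ∑ r, hhCurv L i r j r x y

/-- The tensor `ℜ_{ij} = R_{ij} - (I^k R_{ijk} + I^k R_{kji} + F⁻¹ ℓ_i I^k R_{k0j} + I_i R_{0j})/(n+1)`
with `ℓ_i = ∂F/∂yⁱ`, `R_{k0j} = R_{kmj} yᵐ` and `R_{0j} = R_{mj} yᵐ`. -/
def frakR {n : ℕ} (L : LocalFun n) (i j : Fin n) : LocalFun n :=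
  fun x y => ricci L i j x y - 1 / ((n : ℝ) + 1) *
    ((∑ k, meanCartanUp L k x y * curv3 L i j k x y)
      + (∑ k, meanCartanUp L k x y * curv3 L k j i x y)
      + (L x y)⁻¹ * dY i L x y *
          (∑ k, meanCartanUp L k x y * ∑ m, curv3 L k m j x y * y m)
      + meanCartan L i x y * ∑ m, ricci L m j x y * y m)

/-! ### Manifolds -/

section Manifold

variable {n : ℕ} {M : Type*} [TopologicalSpace M] [ChartedSpace (Coord n) M]

/-- A function on the tangent bundle written in the chart `e`: the point `x` and the components `y`
stand for the tangent vector `yⁱ ∂/∂xⁱ` at the point with coordinates `x`. -/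
def inChart (Φ : TangentBundle (𝓡 n) M → ℝ) (e : OpenPartialHomeomorph M (Coord n)) :
    LocalFun n :=
  fun x y => Φ ⟨e.symm x, mfderiv (𝓡 n) (𝓡 n) e.symm x y⟩

/-- `F` is of scalar flag curvature `K`: for every nonzero tangent vector `y`, all flags with
flagpole `y` have flag curvature `K(y)`. (The flag curvature is computed in charts; it does not depend
on the chart.) -/
def IsOfScalarFlagCurvature (F K : TangentBundle (𝓡 n) M → ℝ) : Prop :=
  ∀ e ∈ IsManifold.maximalAtlas (𝓡 n) ∞ M, ∀ x ∈ e.target, ∀ y u : Coord n,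
    LinearIndependent ℝ ![y, u] → flagCurvature (inChart F e) x y u = inChart K e x y

/-- The tensor `ℜ` of `F` is symmetric on the slit tangent bundle. -/
def FrakRSymmetric (F : TangentBundle (𝓡 n) M → ℝ) : Prop :=
  ∀ e ∈ IsManifold.maximalAtlas (𝓡 n) ∞ M, ∀ x ∈ e.target, ∀ y : Coord n, y ≠ 0 →
    ∀ i j : Fin n, frakR (inChart F e) i j x y = frakR (inChart F e) j i x y

variable [IsManifold (𝓡 n) ∞ M]

/-- Smooth Riemannian metrics on `M`. -/
abbrev RiemMetric (n : ℕ) (M : Type*) [TopologicalSpace M] [ChartedSpace (Coord n) M]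
    [IsManifold (𝓡 n) ∞ M] :=
  Bundle.ContMDiffRiemannianMetric (𝓡 n) ∞ (Coord n) (fun x : M => TangentSpace (𝓡 n) x)

/-- Smooth `1`-forms on `M`: smooth sections of the cotangent bundle. -/
abbrev OneForm (n : ℕ) (M : Type*) [TopologicalSpace M] [ChartedSpace (Coord n) M]
    [IsManifold (𝓡 n) ∞ M] :=
  ContMDiffSection (𝓡 n) (Coord n →L[ℝ] ℝ) ∞
    (fun x : M => TangentSpace (𝓡 n) x →L[ℝ] Bundle.Trivial M ℝ x)

/-- The Riemannian norm `α(v) = √(a(v, v))`. -/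
def riemNorm (a : RiemMetric n M) (v : TangentBundle (𝓡 n) M) : ℝ :=
  √(a.inner v.proj v.snd v.snd)

/-- The function `F = α + β` on the tangent bundle. -/
def randers (a : RiemMetric n M) (b : OneForm n M) (v : TangentBundle (𝓡 n) M) : ℝ :=
  riemNorm a v + b v.proj v.snd

/-- `F = α + β` is a Randers metric: the norm of `β` with respect to `α` is less than `1` at every
point, that is, `|β(v)| < α(v)` for all nonzero tangent vectors `v`. -/
def IsRanders (a : RiemMetric n M) (b : OneForm n M) : Prop :=
  ∀ v : TangentBundle (𝓡 n) M, v.snd ≠ 0 → |b v.proj v.snd| < riemNorm a v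

/-- `F` is (the norm of) a Riemannian metric. -/
def IsRiemannian (F : TangentBundle (𝓡 n) M → ℝ) : Prop :=
  ∃ a : RiemMetric n M, ∀ v, F v = riemNorm a v

end Manifold

end

end Finsler

/-! ### Finsler tensor calculus as differential algebra -/

namespace Finsler

noncomputable section

/-! If F has scalar flag curvature K, the curvature of its nonlinear connection is determined by the
covector λ_j = ⅓ F² ∂K/∂yʲ + K y_j, where y_j = ½ ∂F²/∂yʲ. Inserting this in ℜ, the factor 1/(n+1)
is exactly what makes ℜ_ij - ℜ_ji = λ_i I_j - λ_j I_i (`frak_antisymm_of_scalar`). If K = 0, then λ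
= 0 and ℜ is symmetric. Conversely, since yⁱλ_i = K F² and yⁱI_i = 0, contracting with yⁱ turns
symmetry of ℜ into K F² I_j = 0 (`kappa_mul_I`).

For a Randers metric, I is a positive multiple of b - (β/α) dα, with dα the fibre derivative
(`mean_cartan_eq`). It vanishes at y only if b is proportional to the covector dual to y. Where β ≠
0 this excludes at most one line in each fibre, so by continuity the Riemann curvature vanishes over
all points with β ≠ 0 (`riemann_eq_zero_of_b_ne_zero`).

The danger is an open set where β = 0: there F is Riemannian and K I = 0 says nothing. Unique
continuation removes it. In vanishing curvature D_X D_X I = 0 for the geodesic spray X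
(`geo_J_of_flat`); the equation is trivial in the interior of {β = 0}, hence holds everywhere by
density. So I solves a linear second order equation along geodesics, and it vanishes along every
geodesic that issues from that interior. At a boundary point touched by a ball from inside, the
geodesics leaving the ball fill an open set of tangent vectors, and I = 0 there forces β = 0 at
nearby points where β ≠ 0 (`mem_zeroInterior_of_mem_closure`). The interior of {β = 0} is therefore
clopen. By connectedness it is everything, so that F = α is Riemannian, or empty, so that the
curvature vanishes on a dense set and K = 0.

The tensor identities are proved in a commutative algebra with derivations, where no
differentiability side conditions arise. `smoothAlgebra` is the concrete model, and `Represents`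
ties its elements to the coordinate formulas. -/

/-- Commuting derivations `∂/∂xᵏ`, `∂/∂yᵏ` on a commutative `ℝ`-algebra, coordinates `yᵏ` and an
invertible element `F`, homogeneous of degree one, with nondegenerate fundamental tensor. -/
structure FinslerAlgebra (n : ℕ) (A : Type*) [CommRing A] [Algebra ℝ A] where
  dx : Fin n → Derivation ℝ A A
  dy : Fin n → Derivation ℝ A A
  y : Fin n → A
  F : A
  Finv : A
  dx_dx : ∀ i j f, dx i (dx j f) = dx j (dx i f)
  dx_dy : ∀ i j f, dx i (dy j f) = dy j (dx i f)
  dy_dy : ∀ i j f, dy i (dy j f) = dy j (dy i f)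
  dx_y : ∀ i j, dx i (y j) = 0
  dy_y : ∀ i j, dy i (y j) = if i = j then 1 else 0
  F_mul_Finv : F * Finv = 1
  euler : ∑ k, y k * dy k F = F
  isUnit_det : IsUnit (Matrix.of fun i j => algebraMap ℝ A (1 / 2) * dy i (dy j (F ^ 2))).det

namespace FinslerAlgebra

variable {n : ℕ} {A : Type*} [CommRing A] [Algebra ℝ A]

variable (A) in
/-- The constant `1 / 2`. -/
def half : A := algebraMap ℝ A (1 / 2)

variable (A) in
lemma two_mul_half : 2 * half A = 1 := by
  have : (2 : A) = algebraMap ℝ A 2 := (map_ofNat _ 2).symm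
  rw [half, this, ← map_mul]; norm_num

lemma D_half_mul (D : Derivation ℝ A A) (f : A) : D (half A * f) = half A * D f := by
  simp [half, Derivation.leibniz]

lemma two_cancel {a b : A} (h : 2 * a = 2 * b) : a = b := by
  linear_combination half A * h - (a - b) * two_mul_half A

lemma D_mul (D : Derivation ℝ A A) (a b : A) : D (a * b) = a * D b + b * D a := by
  simp [Derivation.leibniz]

variable (S : FinslerAlgebra n A)

/-- `F²`. -/
def E : A := S.F ^ 2
/-- `y_i = ½ ∂F²/∂yⁱ`. -/
def p (i : Fin n) : A := half A * S.dy i S.E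
/-- The fundamental tensor. -/
def g (i j : Fin n) : A := half A * S.dy i (S.dy j S.E)
/-- The inverse of the fundamental tensor. -/
def ginv (i j : Fin n) : A := (Matrix.of S.g)⁻¹ i j
/-- The Cartan tensor. -/
def C (i j k : Fin n) : A := half A * half A * S.dy i (S.dy j (S.dy k S.E))
/-- The Cartan tensor with first index raised. -/
def Cup (i j k : Fin n) : A := ∑ l, S.ginv i l * S.C l j k
/-- The mean Cartan tensor. -/
def I (i : Fin n) : A := ∑ k, ∑ l, S.ginv k l * S.C k l i
/-- The mean Cartan tensor with index raised. -/
def Iup (k : Fin n) : A := ∑ i, S.ginv k i * S.I i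
/-- The spray coefficients. -/
def G (i : Fin n) : A :=
  half A * half A * ∑ l, S.ginv i l * ((∑ k, S.dx k (S.dy l S.E) * S.y k) - S.dx l S.E)
/-- The nonlinear connection. -/
def N (i j : Fin n) : A := S.dy j (S.G i)
/-- The horizontal derivative. -/
def hD (k : Fin n) : Derivation ℝ A A := S.dx k - ∑ r, S.N r k • S.dy r
/-- The derivative along the geodesic spray. -/
def geo : Derivation ℝ A A := ∑ k, S.y k • S.dx k - 2 • ∑ m, S.G m • S.dy m
/-- The Riemann curvature. -/
def Riem (i k : Fin n) : A :=
  2 * S.dx k (S.G i) - ∑ j, S.y j * S.dx j (S.dy k (S.G i))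
    + 2 * ∑ j, S.G j * S.dy j (S.dy k (S.G i)) - ∑ j, S.dy j (S.G i) * S.dy k (S.G j)
/-- The curvature of the nonlinear connection. -/
def Rn (i j k : Fin n) : A := S.hD k (S.N i j) - S.hD j (S.N i k)
/-- The horizontal connection coefficients. -/
def Γ (i j k : Fin n) : A :=
  half A * ∑ l, S.ginv i l * (S.hD j (S.g l k) + S.hD k (S.g j l) - S.hD l (S.g j k))
/-- The `hh`-curvature of the Chern connection. -/
def Ch (h i j k : Fin n) : A :=
  S.hD k (S.Γ i h j) - S.hD j (S.Γ i h k)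
    + ∑ m, (S.Γ m h j * S.Γ i m k - S.Γ m h k * S.Γ i m j)
/-- The `hh`-curvature of the Cartan connection. -/
def hh (h i j k : Fin n) : A := S.Ch h i j k + ∑ m, S.Cup i h m * S.Rn m j k
/-- The contraction `R_{ijk}`. -/
def curv3 (i j k : Fin n) : A := ∑ h, S.y h * ∑ q, S.g i q * S.hh h q j k
/-- The Ricci tensor. -/
def Ric (i j : Fin n) : A := ∑ r, S.hh i r j r
/-- The tensor `ℜ`. -/
def frak (i j : Fin n) : A :=
  S.Ric i j - algebraMap ℝ A (1 / ((n : ℝ) + 1)) *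
    ((∑ k, S.Iup k * S.curv3 i j k) + (∑ k, S.Iup k * S.curv3 k j i)
      + S.Finv * S.dy i S.F * (∑ k, S.Iup k * ∑ m, S.curv3 k m j * S.y m)
      + S.I i * ∑ m, S.Ric m j * S.y m)
/-- The logarithmic derivative of `√det g`. -/
def θ (D : Derivation ℝ A A) : A := half A * ∑ k, ∑ l, S.ginv k l * D (S.g k l)
/-- The covariant derivative of the mean Cartan tensor along the geodesic spray. -/
def J (k : Fin n) : A := S.geo (S.I k) - ∑ m, S.N m k * S.I m

lemma sum_derivation_apply {ι : Type*} (s : Finset ι) (D : ι → Derivation ℝ A A) (f : A) :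
    (∑ k ∈ s, D k) f = ∑ k ∈ s, D k f := by
  classical
  induction s using Finset.induction_on with
  | empty => simp
  | insert k s hk ih => rw [Finset.sum_insert hk, Finset.sum_insert hk, Derivation.add_apply, ih]

lemma hD_apply (k : Fin n) (f : A) : S.hD k f = S.dx k f - ∑ r, S.N r k * S.dy r f := by
  rw [hD, Derivation.sub_apply, sum_derivation_apply]
  rfl

lemma geo_apply (f : A) :
    S.geo f = ∑ k, S.y k * S.dx k f - 2 * ∑ m, S.G m * S.dy m f := by
  rw [geo, Derivation.sub_apply, two_smul, Derivation.add_apply]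
  simp only [sum_derivation_apply, Derivation.smul_apply, smul_eq_mul]
  ring

/-! #### The metric -/

lemma g_eq_dy_p (i j : Fin n) : S.g i j = S.dy i (S.p j) := by rw [p, D_half_mul, g]

lemma g_symm (i j : Fin n) : S.g i j = S.g j i := by rw [g, g, S.dy_dy]

lemma C_eq (i j k : Fin n) : S.C i j k = half A * S.dy i (S.g j k) := by
  rw [g, D_half_mul, C]; ring

lemma C_symm_left (i j k : Fin n) : S.C i j k = S.C j i k := by rw [C, C, S.dy_dy]

lemma C_symm_right (i j k : Fin n) : S.C i j k = S.C i k j := by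
  rw [C, C, S.dy_dy j k]

lemma det_g_isUnit : IsUnit (Matrix.of S.g).det := S.isUnit_det

lemma ginv_g (i j : Fin n) : ∑ l, S.ginv i l * S.g l j = if i = j then 1 else 0 := by
  have := congrFun (congrFun (Matrix.nonsing_inv_mul _ S.det_g_isUnit) i) j
  rw [Matrix.mul_apply, Matrix.one_apply] at this
  exact this

lemma g_ginv (i j : Fin n) : ∑ l, S.g i l * S.ginv l j = if i = j then 1 else 0 := by
  have := congrFun (congrFun (Matrix.mul_nonsing_inv _ S.det_g_isUnit) i) j
  rw [Matrix.mul_apply, Matrix.one_apply] at this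
  exact this

lemma ginv_symm (i j : Fin n) : S.ginv i j = S.ginv j i := by
  have h : (Matrix.of S.g).transpose = Matrix.of S.g := by
    ext i j; exact S.g_symm j i
  have := congrFun (congrFun (Matrix.transpose_nonsing_inv (Matrix.of S.g)) j) i
  rw [h] at this
  exact this

lemma ginv_contract (i : Fin n) (a : Fin n → A) :
    ∑ l, S.ginv i l * ∑ m, S.g l m * a m = a i := by
  calc _ = ∑ m, (∑ l, S.ginv i l * S.g l m) * a m := by
        simp only [Finset.mul_sum, Finset.sum_mul, mul_assoc]
        exact Finset.sum_comm
    _ = a i := by simp [S.ginv_g]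

lemma g_contract (i : Fin n) (a : Fin n → A) :
    ∑ l, S.g i l * ∑ m, S.ginv l m * a m = a i := by
  calc _ = ∑ m, (∑ l, S.g i l * S.ginv l m) * a m := by
        simp only [Finset.mul_sum, Finset.sum_mul, mul_assoc]
        exact Finset.sum_comm
    _ = a i := by simp [S.g_ginv]

lemma lower_injective {a b : Fin n → A}
    (h : ∀ l, ∑ m, S.g l m * a m = ∑ m, S.g l m * b m) (i : Fin n) : a i = b i := by
  rw [← S.ginv_contract i a, ← S.ginv_contract i b]
  simp only [h]

/-! #### Homogeneity -/

lemma euler_E : ∑ k, S.y k * S.dy k S.E = 2 * S.E := by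
  have : ∀ k, S.y k * S.dy k S.E = 2 * S.F * (S.y k * S.dy k S.F) := by
    intro k; rw [E, sq, D_mul]; ring
  rw [Finset.sum_congr rfl fun k _ => this k, ← Finset.mul_sum, S.euler, E]; ring

/-- Apply `D` to Euler's relation. The second sum is the only effect of `D` on the coordinates: it
is zero for `dx` and lowers the degree by one for `dy`. -/
lemma D_euler {d : ℕ} (f : A) (hf : ∑ k, S.y k * S.dy k f = d * f) (D : Derivation ℝ A A)
    (hD : ∀ k, D (S.dy k f) = S.dy k (D f)) :
    ∑ k, S.y k * S.dy k (D f) + ∑ k, S.dy k f * D (S.y k) = d * D f := by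
  have := congrArg D hf
  simp only [map_sum, D_mul, hD, Finset.sum_add_distrib, Derivation.map_natCast, mul_zero,
    add_zero] at this
  exact this

lemma euler_dx {d : ℕ} (f : A) (hf : ∑ k, S.y k * S.dy k f = d * f) (i : Fin n) :
    ∑ k, S.y k * S.dy k (S.dx i f) = d * S.dx i f := by
  have := S.D_euler f hf (S.dx i) (fun k => S.dx_dy i k f)
  simpa [S.dx_y] using this

lemma euler_dy {d : ℕ} (f : A) (hf : ∑ k, S.y k * S.dy k f = (d + 1 : ℕ) * f) (i : Fin n) :
    ∑ k, S.y k * S.dy k (S.dy i f) = d * S.dy i f := by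
  have := S.D_euler f hf (S.dy i) (fun k => S.dy_dy i k f)
  simp only [S.dy_y, mul_ite, mul_one, mul_zero, Finset.sum_ite_eq, Finset.mem_univ, if_true,
    Nat.cast_add, Nat.cast_one] at this
  linear_combination this

lemma euler_E' : ∑ k, S.y k * S.dy k S.E = (2 : ℕ) * S.E := by
  rw [S.euler_E]; norm_num

lemma euler_dyE (i : Fin n) : ∑ k, S.y k * S.dy k (S.dy i S.E) = S.dy i S.E := by
  have := S.euler_dy (d := 1) S.E S.euler_E' i
  simpa using this

lemma g_y (i : Fin n) : ∑ k, S.g i k * S.y k = S.p i := by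
  rw [p, ← S.euler_dyE i, Finset.mul_sum]
  refine Finset.sum_congr rfl fun k _ => ?_
  rw [g, S.dy_dy]; ring

lemma y_g (i : Fin n) : ∑ k, S.y k * S.g k i = S.p i := by
  rw [← S.g_y]
  refine Finset.sum_congr rfl fun k _ => ?_
  rw [S.g_symm k i]; ring

lemma y_p : ∑ k, S.y k * S.p k = S.E := by
  have : ∀ k, S.y k * S.p k = half A * (S.y k * S.dy k S.E) := by intro k; rw [p]; ring
  simp only [this, ← Finset.mul_sum, S.euler_E]
  linear_combination S.E * two_mul_half A

lemma ginv_p (i : Fin n) : ∑ k, S.ginv i k * S.p k = S.y i := by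
  rw [← S.ginv_contract i S.y]
  simp only [S.g_y]

lemma euler_g (i j : Fin n) : ∑ k, S.y k * S.dy k (S.g i j) = 0 := by
  have h : ∑ k, S.y k * S.dy k (S.dy j S.E) = ((0 + 1 : ℕ) : A) * S.dy j S.E := by
    rw [S.euler_dyE]; simp
  have := S.euler_dy (d := 0) (S.dy j S.E) h i
  simp only [Nat.cast_zero, zero_mul] at this
  simp only [g, D_half_mul]
  rw [← mul_zero (half A), ← this, Finset.mul_sum]
  exact Finset.sum_congr rfl fun k _ => by ring

lemma y_C (i j : Fin n) : ∑ k, S.y k * S.C k i j = 0 := by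
  have := S.euler_g i j
  simp only [S.C_eq, mul_left_comm (S.y _) (half A), ← Finset.mul_sum, this, mul_zero]

/-! #### The spray -/

lemma lower_G (l : Fin n) : ∑ m, S.g l m * S.G m =
    half A * half A * ((∑ k, S.dx k (S.dy l S.E) * S.y k) - S.dx l S.E) := by
  have := S.g_contract l
    (fun l => half A * half A * ((∑ k, S.dx k (S.dy l S.E) * S.y k) - S.dx l S.E))
  rw [← this]
  refine Finset.sum_congr rfl fun m _ => ?_
  rw [G, Finset.mul_sum]
  congr 1
  exact Finset.sum_congr rfl fun m _ => by ring

/-- The Euler–Lagrange equation for the energy ½F², the defining property of the spray with the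
inverse metric removed. -/
lemma geo_p (l : Fin n) : S.geo (S.p l) = half A * S.dx l S.E := by
  rw [S.geo_apply]
  have h1 : ∑ m, S.G m * S.dy m (S.p l) = ∑ m, S.g l m * S.G m :=
    Finset.sum_congr rfl fun m _ => by rw [← g_eq_dy_p, S.g_symm]; ring
  have h2 : ∑ k, S.y k * S.dx k (S.p l) = half A * ∑ k, S.dx k (S.dy l S.E) * S.y k := by
    rw [Finset.mul_sum]
    exact Finset.sum_congr rfl fun m _ => by rw [p, D_half_mul]; ring
  rw [h1, h2, S.lower_G]
  linear_combination (-half A * (∑ k, S.dx k (S.dy l S.E) * S.y k - S.dx l S.E)) * two_mul_half A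

/-- The spray is homogeneous of degree two. Since g has degree zero, this can be checked after
lowering the index, where the formula contains no inverse matrix. -/
lemma euler_G (i : Fin n) : ∑ k, S.y k * S.dy k (S.G i) = 2 * S.G i := by
  refine S.lower_injective (a := fun i => ∑ k, S.y k * S.dy k (S.G i)) (b := fun i => 2 * S.G i)
    (fun l => ?_) i
  have h1 : ∑ k, S.y k * S.dy k (∑ m, S.g l m * S.G m) =
      ∑ m, S.g l m * ∑ k, S.y k * S.dy k (S.G m) := by
    simp only [map_sum, D_mul, Finset.mul_sum, mul_add, Finset.sum_add_distrib]
    have : ∑ k, ∑ m, S.y k * (S.G m * S.dy k (S.g l m)) = 0 := by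
      rw [Finset.sum_comm]
      refine Finset.sum_eq_zero fun m _ => ?_
      rw [← mul_zero (S.G m), ← S.euler_g l m, Finset.mul_sum]
      exact Finset.sum_congr rfl fun _ _ => by ring
    rw [this, add_zero, Finset.sum_comm]
    exact Finset.sum_congr rfl fun _ _ => Finset.sum_congr rfl fun _ _ => by ring
  rw [← h1]
  have hl := S.lower_G l
  have h3 : ∀ j, ∑ k, S.y k * S.dy k (S.dx j (S.dy l S.E)) = S.dx j (S.dy l S.E) := by
    intro j
    have := S.euler_dx (d := 1) (S.dy l S.E) (by simpa using S.euler_dyE l) j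
    simpa using this
  have h4 : ∑ k, S.y k * S.dy k (S.dx l S.E) = 2 * S.dx l S.E := by
    simpa using S.euler_dx (d := 2) S.E S.euler_E' l
  have h5 : ∑ k, S.y k * S.dy k (∑ j, S.dx j (S.dy l S.E) * S.y j) =
      2 * ∑ j, S.dx j (S.dy l S.E) * S.y j := by
    simp only [map_sum, D_mul, Finset.mul_sum, mul_add, Finset.sum_add_distrib, S.dy_y,
      mul_ite, mul_one, mul_zero, Finset.sum_ite_eq, Finset.mem_univ, if_true]
    have : ∑ k, ∑ j, S.y k * (S.y j * S.dy k (S.dx j (S.dy l S.E))) =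
        ∑ j, S.y j * S.dx j (S.dy l S.E) := by
      rw [Finset.sum_comm]
      refine Finset.sum_congr rfl fun j _ => ?_
      conv_rhs => rw [← h3 j, Finset.mul_sum]
      exact Finset.sum_congr rfl fun _ _ => by ring
    rw [this, ← Finset.sum_add_distrib]
    exact Finset.sum_congr rfl fun _ _ => by ring
  have h6 : ∑ k, S.y k * S.dy k (∑ m, S.g l m * S.G m) = 2 * ∑ m, S.g l m * S.G m := by
    rw [hl]
    simp only [mul_assoc (half A), D_half_mul, map_sub]
    simp only [mul_left_comm (S.y _) (half A), ← Finset.mul_sum, mul_sub, Finset.sum_sub_distrib,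
      h4, h5]
    ring
  rw [h6, Finset.mul_sum]
  exact Finset.sum_congr rfl fun _ _ => by ring

lemma N_y (i : Fin n) : ∑ j, S.N i j * S.y j = 2 * S.G i := by
  rw [← S.euler_G]
  exact Finset.sum_congr rfl fun _ _ => by rw [N]; ring

lemma hD_y (k j : Fin n) : S.hD k (S.y j) = - S.N j k := by
  simp [S.hD_apply, S.dx_y, S.dy_y]

/-- The spray is horizontal because N^i_j yʲ = 2Gⁱ. This allows curvature along geodesics to be read
off from brackets of horizontal fields. -/
lemma geo_eq_sum_hD (f : A) : S.geo f = ∑ j, S.y j * S.hD j f := by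
  simp only [S.geo_apply, S.hD_apply, mul_sub, Finset.sum_sub_distrib, Finset.mul_sum]
  congr 1
  rw [Finset.sum_comm]
  refine Finset.sum_congr rfl fun m _ => ?_
  rw [← mul_assoc, ← S.N_y, Finset.sum_mul]
  exact Finset.sum_congr rfl fun _ _ => by ring

end FinslerAlgebra

namespace FinslerAlgebra

variable {n : ℕ} {A : Type*} [CommRing A] [Algebra ℝ A] (S : FinslerAlgebra n A)

/-! #### Commutators -/

lemma dy_geo (k : Fin n) (f : A) :
    S.geo (S.dy k f) = S.dy k (S.geo f) - S.hD k f + ∑ m, S.N m k * S.dy m f := by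
  simp only [S.geo_apply, S.hD_apply, map_sub, map_sum, D_mul, S.dy_y, two_mul, map_add,
    Finset.sum_add_distrib, mul_ite, mul_one, mul_zero, Finset.sum_ite_eq, Finset.mem_univ,
    if_true, S.dx_dy _ k, S.dy_dy k]
  have : ∑ m, S.dy m f * S.dy k (S.G m) = ∑ m, S.N m k * S.dy m f :=
    Finset.sum_congr rfl fun m _ => by rw [N]; ring
  rw [this]
  ring

/-- The coordinate fields commute, so the bracket of two horizontal fields is vertical; its
components are the curvature of the nonlinear connection. -/
lemma hD_hD (j k : Fin n) (f : A) :
    S.hD j (S.hD k f) - S.hD k (S.hD j f) = ∑ i, S.Rn i j k * S.dy i f := by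
  have key : ∀ j k : Fin n, S.hD j (S.hD k f) =
      S.dx j (S.dx k f) - ∑ r, S.N r j * S.dy r (S.dx k f) - ∑ r, S.N r k * S.dx j (S.dy r f)
        + ∑ r, ∑ s, S.N r k * S.N s j * S.dy s (S.dy r f) - ∑ r, S.hD j (S.N r k) * S.dy r f := by
    intro j k
    rw [S.hD_apply k, map_sub, map_sum]
    have : ∀ r, S.hD j (S.N r k * S.dy r f) = S.N r k * S.dx j (S.dy r f)
        - ∑ s, S.N r k * S.N s j * S.dy s (S.dy r f) + S.hD j (S.N r k) * S.dy r f := by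
      intro r
      rw [D_mul, S.hD_apply j (S.dy r f), mul_sub, Finset.mul_sum]
      simp only [mul_assoc]
      ring
    simp only [this, Finset.sum_add_distrib, Finset.sum_sub_distrib, S.hD_apply j (S.dx k f)]
    ring
  rw [key j k, key k j]
  simp only [Rn, sub_mul, Finset.sum_sub_distrib]
  -- The second order vertical terms are symmetric in j and k because vertical derivatives commute,
  -- so they drop out of the bracket.
  have h1 : ∑ r, ∑ s, S.N r k * S.N s j * S.dy s (S.dy r f) =
      ∑ r, ∑ s, S.N r j * S.N s k * S.dy s (S.dy r f) := by
    rw [Finset.sum_comm]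
    refine Finset.sum_congr rfl fun r _ => Finset.sum_congr rfl fun s _ => ?_
    rw [S.dy_dy r s]; ring
  rw [h1, S.dx_dx j k]
  simp only [S.dx_dy]
  ring

lemma Rn_antisymm (i j k : Fin n) : S.Rn i j k = - S.Rn i k j := by
  rw [Rn, Rn]; ring

lemma y_Rn (i k : Fin n) : ∑ j, S.y j * S.Rn i j k = S.Riem i k := by
  -- Differentiate N^i_j yʲ = 2Gⁱ along δ_k, using δ_k yʲ = -N^j_k.
  have h1 : ∑ j, S.y j * S.hD k (S.N i j) =
      2 * S.dx k (S.G i) - 2 * (∑ r, S.N r k * S.N i r) + ∑ j, S.N j k * S.N i j := by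
    have := congrArg (S.hD k) (S.N_y i)
    simp only [map_sum, D_mul, S.hD_y, two_mul, map_add, Finset.sum_add_distrib, mul_neg,
      Finset.sum_neg_distrib, S.hD_apply k (S.G i)] at this
    have h2 : ∑ r, S.N r k * S.dy r (S.G i) = ∑ r, S.N i r * S.N r k :=
      Finset.sum_congr rfl fun _ _ => by simp only [N]; ring
    have h3 : ∑ r, S.N r k * S.N i r = ∑ r, S.N i r * S.N r k :=
      Finset.sum_congr rfl fun _ _ => by ring
    rw [h2] at this
    rw [h3]
    linear_combination this
  simp only [Rn, mul_sub, Finset.sum_sub_distrib, h1, ← S.geo_eq_sum_hD]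
  rw [S.geo_apply, Riem]
  have h4 : ∑ j, S.dy j (S.G i) * S.dy k (S.G j) = ∑ j, S.N j k * S.N i j :=
    Finset.sum_congr rfl fun _ _ => by simp only [N]; ring
  rw [h4]
  simp only [N]
  ring

/-- The Riemann curvature, a contraction of `Rn` with y, still determines all of it by vertical
differentiation. Hence a formula for `Riem` alone gives every curvature term of ℜ, and `Riem = 0`
gives `Rn = 0`. -/
lemma three_Rn (i j k : Fin n) :
    3 * S.Rn i j k = S.dy j (S.Riem i k) - S.dy k (S.Riem i j) := by
  have key : ∀ j k : Fin n, S.dy j (S.Riem i k) =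
      2 * S.dx k (S.N i j) - S.dx j (S.N i k)
        - ∑ m, S.y m * S.dx m (S.dy j (S.N i k)) + 2 * ∑ m, S.N m j * S.dy m (S.N i k)
        + 2 * ∑ m, S.G m * S.dy m (S.dy j (S.N i k))
        - ∑ m, S.dy m (S.N i j) * S.N m k - ∑ m, S.N i m * S.dy j (S.N m k) := by
    intro j k
    rw [Riem]
    simp only [map_sub, map_sum, D_mul, S.dy_y, two_mul, map_add,
      Finset.sum_add_distrib, mul_ite, mul_one, mul_zero, Finset.sum_ite_eq, Finset.mem_univ,
      if_true, S.dy_dy j, S.dx_dy]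
    have h1 : ∑ m, S.dy m (S.dy k (S.G i)) * S.dy j (S.G m) = ∑ m, S.N m j * S.dy m (S.N i k) :=
      Finset.sum_congr rfl fun _ _ => by simp only [N]; ring
    have h2 : ∑ m, S.dy k (S.G m) * S.dy m (S.dy j (S.G i)) =
        ∑ m, S.dy m (S.N i j) * S.N m k :=
      Finset.sum_congr rfl fun _ _ => by simp only [N]; ring
    rw [h1, h2]
    simp only [N, S.dy_dy j, S.dx_dy]
    ring
  rw [key j k, key k j]
  simp only [Rn, S.hD_apply]
  have h0 : ∀ m, S.dy j (S.N m k) = S.dy k (S.N m j) := fun m => S.dy_dy _ _ _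
  have h1 : ∀ j k, ∑ m, S.dy m (S.N i j) * S.N m k = ∑ m, S.N m k * S.dy m (S.N i j) :=
    fun j k => Finset.sum_congr rfl fun _ _ => by ring
  simp only [h1, h0]
  ring

/-! #### The metric along the horizontal distribution -/

/-- The nonlinear connection with lowered index. -/
def Nlow (l k : Fin n) : A := ∑ m, S.g l m * S.N m k

lemma hD_p_eq (l k : Fin n) : S.hD l (S.p k) = S.dx l (S.p k) - S.Nlow k l := by
  rw [S.hD_apply, Nlow]
  congr 1
  exact Finset.sum_congr rfl fun m _ => by rw [← g_eq_dy_p, S.g_symm]; ring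

/-- The vertical derivative of the Euler–Lagrange equation, with the commutator of the spray and
∂/∂yᵏ. -/
lemma geo_g_aux (k l : Fin n) :
    S.geo (S.g k l) = 2 * S.Nlow l k + S.dx l (S.p k) - S.dx k (S.p l) := by
  rw [S.g_eq_dy_p, S.dy_geo, S.geo_p, S.hD_p_eq, D_half_mul, ← S.dx_dy]
  have h1 : ∑ m, S.N m k * S.dy m (S.p l) = S.Nlow l k :=
    Finset.sum_congr rfl fun m _ => by rw [← g_eq_dy_p, S.g_symm]; ring
  rw [h1, ← D_half_mul, ← p]
  ring

/-- The left side of `geo_g_aux` is symmetric in its indices, so the skew part of the right side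
must vanish. -/
lemma hD_p_symm (l k : Fin n) : S.hD l (S.p k) = S.hD k (S.p l) := by
  have h1 := S.geo_g_aux k l
  have h2 := S.geo_g_aux l k
  rw [S.g_symm] at h2
  rw [S.hD_p_eq, S.hD_p_eq]
  refine two_cancel ?_
  linear_combination h2 - h1

lemma geo_g (k l : Fin n) : S.geo (S.g k l) = S.Nlow l k + S.Nlow k l := by
  have h1 := S.geo_g_aux k l
  have h2 := S.hD_p_symm l k
  rw [S.hD_p_eq, S.hD_p_eq] at h2
  linear_combination h1 + h2

/-- Horizontal motion preserves F. By `hD_p_symm`, contracting δ_l y_k with yᵏ gives the spray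
derivative of y_l, which Euler–Lagrange evaluates; comparison with δ_l of yᵏy_k = F² finishes. -/
lemma hD_E (l : Fin n) : S.hD l S.E = 0 := by
  have h1 : ∑ k, S.y k * S.hD l (S.p k) = half A * S.dx l S.E := by
    rw [← S.geo_p, S.geo_eq_sum_hD]
    exact Finset.sum_congr rfl fun k _ => by rw [S.hD_p_symm]
  have h2 := congrArg (S.hD l) S.y_p
  simp only [map_sum, D_mul, S.hD_y, Finset.sum_add_distrib, mul_neg, Finset.sum_neg_distrib,
    h1] at h2
  have h3 : S.hD l S.E = S.dx l S.E - 2 * ∑ m, S.p m * S.N m l := by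
    rw [S.hD_apply, Finset.mul_sum]
    congr 1
    refine Finset.sum_congr rfl fun m _ => ?_
    rw [p]
    linear_combination (-S.N m l * S.dy m S.E) * two_mul_half A
  linear_combination (2 : A) * (-h2) - h3 + S.dx l S.E * two_mul_half A

lemma p_Rn (j k : Fin n) : ∑ m, S.p m * S.Rn m j k = 0 := by
  have h := S.hD_hD j k S.E
  simp only [S.hD_E, map_zero, sub_zero] at h
  rw [← mul_zero (half A), h, Finset.mul_sum]
  exact Finset.sum_congr rfl fun m _ => by rw [p]; ring

/-- The curvature of the nonlinear connection with lowered index. -/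
def Rlow (l j k : Fin n) : A := ∑ m, S.g l m * S.Rn m j k

/-- The lowered curvature is the commutator [δ_j, δ_k] applied to y_l. Since δ_j y_k is symmetric,
the six terms of the cyclic sum cancel in pairs. -/
lemma Rlow_cyclic (l j k : Fin n) : S.Rlow l j k + S.Rlow j k l + S.Rlow k l j = 0 := by
  have h : ∀ l j k : Fin n,
      S.Rlow l j k = S.hD j (S.hD k (S.p l)) - S.hD k (S.hD j (S.p l)) := by
    intro l j k
    rw [S.hD_hD, Rlow]
    exact Finset.sum_congr rfl fun m _ => by rw [← g_eq_dy_p, S.g_symm]; ring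
  rw [h, h, h, S.hD_p_symm k l, S.hD_p_symm j l, S.hD_p_symm k j]
  ring

lemma Rlow_antisymm (l j k : Fin n) : S.Rlow l j k = - S.Rlow l k j := by
  rw [Rlow, Rlow, ← Finset.sum_neg_distrib]
  exact Finset.sum_congr rfl fun m _ => by rw [S.Rn_antisymm m j k]; ring

lemma y_Rlow (l k : Fin n) : ∑ j, S.y j * S.Rlow l j k = ∑ m, S.g l m * S.Riem m k := by
  simp only [Rlow, ← S.y_Rn, Finset.mul_sum]
  rw [Finset.sum_comm]
  exact Finset.sum_congr rfl fun m _ => Finset.sum_congr rfl fun j _ => by ring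

lemma y_Rlow_first (j k : Fin n) : ∑ l, S.y l * S.Rlow l j k = 0 := by
  rw [← S.p_Rn j k]
  simp only [Rlow, ← S.y_g, Finset.mul_sum, Finset.sum_mul]
  rw [Finset.sum_comm]
  exact Finset.sum_congr rfl fun m _ => Finset.sum_congr rfl fun j _ => by ring

/-- The Riemann curvature is self-adjoint with respect to the fundamental tensor. -/
lemma Riem_symm (i k : Fin n) :
    ∑ m, S.g i m * S.Riem m k = ∑ m, S.g k m * S.Riem m i := by
  rw [← S.y_Rlow, ← S.y_Rlow]
  have h : ∀ j, S.y j * S.Rlow i j k + S.y j * S.Rlow j k i - S.y j * S.Rlow k j i = 0 := by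
    intro j
    rw [S.Rlow_antisymm k j i]
    linear_combination S.y j * S.Rlow_cyclic i j k
  have h2 := Finset.sum_congr (rfl : Finset.univ = Finset.univ) fun j (_ : j ∈ Finset.univ) => h j
  simp only [Finset.sum_add_distrib, Finset.sum_sub_distrib, S.y_Rlow_first,
    Finset.sum_const_zero] at h2
  linear_combination h2

/-- The flagpole lies in the kernel of the Riemann curvature. -/
lemma Riem_y (i : Fin n) : ∑ k, S.Riem i k * S.y k = 0 := by
  refine two_cancel ?_
  have h : ∑ k, S.Riem i k * S.y k = ∑ k, ∑ j, S.y j * S.y k * S.Rn i j k := by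
    refine Finset.sum_congr rfl fun k _ => ?_
    rw [← S.y_Rn, Finset.sum_mul]
    exact Finset.sum_congr rfl fun _ _ => by ring
  have h' : ∑ k, S.Riem i k * S.y k = - ∑ k, ∑ j, S.y j * S.y k * S.Rn i j k := by
    rw [h]
    conv_lhs => rw [Finset.sum_comm]
    simp only [← Finset.sum_neg_distrib]
    refine Finset.sum_congr rfl fun k _ => Finset.sum_congr rfl fun j _ => ?_
    linear_combination S.y k * S.y j * S.Rn_antisymm i j k
  linear_combination h + h'

/-! #### The horizontal connection -/

lemma Γ_symm (i j k : Fin n) : S.Γ i j k = S.Γ i k j := by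
  rw [Γ, Γ]
  congr 1
  refine Finset.sum_congr rfl fun l _ => ?_
  rw [S.g_symm l k, S.g_symm j l, S.g_symm j k]; ring

lemma y_Γ (i j : Fin n) : ∑ h, S.y h * S.Γ i h j = S.N i j := by
  have key : ∀ l, ∑ h, S.y h * (S.hD h (S.g l j) + S.hD j (S.g h l) - S.hD l (S.g h j)) =
      2 * S.Nlow l j := by
    intro l
    have h1 : ∀ j l, ∑ h, S.y h * S.hD j (S.g h l) = S.hD j (S.p l) + S.Nlow l j := by
      intro j l
      have := congrArg (S.hD j) (S.y_g l)
      simp only [map_sum, D_mul, S.hD_y, Finset.sum_add_distrib, mul_neg,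
        Finset.sum_neg_distrib] at this
      rw [← this, Nlow]
      have h2 : ∑ m, S.g l m * S.N m j = ∑ m, S.g m l * S.N m j :=
        Finset.sum_congr rfl fun m _ => by rw [S.g_symm]
      rw [h2]; ring
    simp only [mul_add, mul_sub, Finset.sum_add_distrib, Finset.sum_sub_distrib,
      ← S.geo_eq_sum_hD, h1, S.geo_g, S.hD_p_symm l j]
    ring
  have h2 : ∑ h, S.y h * S.Γ i h j = half A * ∑ l, S.ginv i l * (2 * S.Nlow l j) := by
    simp only [← key, Γ, Finset.mul_sum]
    rw [Finset.sum_comm]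
    exact Finset.sum_congr rfl fun m _ => Finset.sum_congr rfl fun j _ => by ring
  have h3 := S.ginv_contract i (fun m => S.N m j)
  have h4 : ∑ l, S.ginv i l * (2 * S.Nlow l j) = 2 * S.N i j := by
    rw [← h3, Finset.mul_sum]
    exact Finset.sum_congr rfl fun m _ => by rw [Nlow]; ring
  rw [h2, h4]
  linear_combination S.N i j * two_mul_half A

lemma y_Cup (i m : Fin n) : ∑ h, S.y h * S.Cup i h m = 0 := by
  simp only [Cup, Finset.mul_sum]
  rw [Finset.sum_comm]
  refine Finset.sum_eq_zero fun l _ => ?_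
  rw [← mul_zero (S.ginv i l), ← S.y_C l m, Finset.mul_sum]
  exact Finset.sum_congr rfl fun h _ => by rw [S.C_symm_left]; ring

/-- The Cartan correction dies because y^h C_{hij} = 0, and y^h Γ^i_{hj} = N^i_j reduces the rest to
the curvature of the nonlinear connection. -/
lemma y_hh (i j k : Fin n) : ∑ h, S.y h * S.hh h i j k = S.Rn i j k := by
  have h1 : ∀ j k, ∑ h, S.y h * S.hD k (S.Γ i h j) =
      S.hD k (S.N i j) + ∑ h, S.N h k * S.Γ i h j := by
    intro j k
    have := congrArg (S.hD k) (S.y_Γ i j)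
    simp only [map_sum, D_mul, S.hD_y, Finset.sum_add_distrib, mul_neg,
      Finset.sum_neg_distrib] at this
    have h2 : ∑ h, S.N h k * S.Γ i h j = ∑ h, S.Γ i h j * S.N h k :=
      Finset.sum_congr rfl fun _ _ => by ring
    rw [h2]
    linear_combination this
  have h2 : ∀ j k, ∑ h, S.y h * ∑ m, S.Γ m h j * S.Γ i m k = ∑ m, S.N m j * S.Γ i m k := by
    intro j k
    simp only [Finset.mul_sum]
    rw [Finset.sum_comm]
    refine Finset.sum_congr rfl fun m _ => ?_
    rw [← S.y_Γ, Finset.sum_mul]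
    exact Finset.sum_congr rfl fun _ _ => by ring
  have h3 : ∑ h, S.y h * ∑ m, S.Cup i h m * S.Rn m j k = 0 := by
    simp only [Finset.mul_sum]
    rw [Finset.sum_comm]
    refine Finset.sum_eq_zero fun m _ => ?_
    rw [← zero_mul (S.Rn m j k), ← S.y_Cup i m, Finset.sum_mul]
    exact Finset.sum_congr rfl fun _ _ => by ring
  simp only [hh, Ch, mul_add, mul_sub, Finset.sum_add_distrib, Finset.sum_sub_distrib, h1, h2, h3]
  rw [Rn]
  ring

lemma curv3_eq (i j k : Fin n) : S.curv3 i j k = S.Rlow i j k := by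
  simp only [curv3, Rlow, ← S.y_hh, Finset.mul_sum]
  rw [Finset.sum_comm]
  exact Finset.sum_congr rfl fun m _ => Finset.sum_congr rfl fun j _ => by ring

end FinslerAlgebra

namespace FinslerAlgebra

variable {n : ℕ} {A : Type*} [CommRing A] [Algebra ℝ A] (S : FinslerAlgebra n A)

/-! #### The mean Cartan tensor -/

/-- As C is totally symmetric and equals ½ ∂g/∂y, its trace is the vertical part of d log √det g.
This brings I under the closedness of `θ`. -/
lemma I_eq_θ (i : Fin n) : S.I i = S.θ (S.dy i) := by
  rw [I, θ, Finset.mul_sum]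
  refine Finset.sum_congr rfl fun k _ => ?_
  rw [Finset.mul_sum]
  refine Finset.sum_congr rfl fun l _ => ?_
  rw [S.C_symm_right, S.C_symm_left, S.C_eq]; ring

lemma sum_Cup (m : Fin n) : ∑ r, S.Cup r r m = S.I m := by
  simp only [Cup, I]
  exact Finset.sum_congr rfl fun r _ => Finset.sum_congr rfl fun l _ => by
    rw [S.C_symm_left]

lemma Cup_symm (i j k : Fin n) : S.Cup i j k = S.Cup i k j := by
  simp only [Cup, S.C_symm_right _ j k]

lemma Cup_y (i h : Fin n) : ∑ m, S.Cup i h m * S.y m = 0 := by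
  rw [← S.y_Cup i h]
  exact Finset.sum_congr rfl fun m _ => by rw [S.Cup_symm]; ring

lemma I_y : ∑ m, S.I m * S.y m = 0 := by
  simp only [← S.sum_Cup, Finset.sum_mul]
  rw [Finset.sum_comm]
  exact Finset.sum_eq_zero fun r _ => S.Cup_y r r

lemma Iup_p : ∑ k, S.Iup k * S.p k = 0 := by
  rw [← S.I_y]
  simp only [Iup, Finset.sum_mul]
  rw [Finset.sum_comm]
  refine Finset.sum_congr rfl fun i _ => ?_
  rw [← S.ginv_p, Finset.mul_sum]
  exact Finset.sum_congr rfl fun k _ => by rw [S.ginv_symm]; ring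

lemma Iup_g (i : Fin n) : ∑ k, S.Iup k * S.g i k = S.I i := by
  rw [← S.g_contract i S.I]
  exact Finset.sum_congr rfl fun k _ => by rw [Iup]; ring

/-! #### The form `θ` is closed -/

lemma D_ginv (D : Derivation ℝ A A) (i j : Fin n) :
    D (S.ginv i j) = - ∑ a, ∑ b, S.ginv i a * D (S.g a b) * S.ginv b j := by
  have h : ∀ c, ∑ l, D (S.ginv i l) * S.g l c = - ∑ l, S.ginv i l * D (S.g l c) := by
    intro c
    have := congrArg D (S.ginv_g i c)
    have h0 : D (if i = c then 1 else 0) = 0 := by split_ifs <;> simp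
    simp only [map_sum, D_mul, h0, Finset.sum_add_distrib] at this
    have h1 : ∑ l, S.g l c * D (S.ginv i l) = ∑ l, D (S.ginv i l) * S.g l c :=
      Finset.sum_congr rfl fun _ _ => by ring
    rw [← h1]
    linear_combination this
  have h2 : ∑ c, (∑ l, D (S.ginv i l) * S.g l c) * S.ginv c j = D (S.ginv i j) := by
    simp only [Finset.sum_mul]
    rw [Finset.sum_comm]
    simp only [mul_assoc, ← Finset.mul_sum, S.g_ginv]
    simp
  rw [← h2]
  simp only [h, neg_mul, Finset.sum_neg_distrib, Finset.sum_mul]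
  rw [Finset.sum_comm]

/-- The identity dθ = 0 for θ = d log √det g. The commutator appears through its action on g, so
that each known bracket formula can be inserted with `θ_of_eq_sum`. -/
lemma θ_closed (D D' : Derivation ℝ A A) :
    D (S.θ D') - D' (S.θ D) =
      half A * ∑ k, ∑ l, S.ginv k l * (D (D' (S.g k l)) - D' (D (S.g k l))) := by
  have key : ∀ D D' : Derivation ℝ A A, D (S.θ D') =
      half A * ∑ k, ∑ l, S.ginv k l * D (D' (S.g k l)) -
        half A * ∑ k, ∑ l, ∑ a, ∑ b,
          S.ginv k a * S.ginv b l * (D (S.g a b) * D' (S.g k l)) := by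
    intro D D'
    rw [θ, D_half_mul, ← mul_sub]
    congr 1
    simp only [map_sum, D_mul, Finset.sum_add_distrib, sub_eq_add_neg]
    congr 1
    simp only [← Finset.sum_neg_distrib, S.D_ginv D, mul_neg, Finset.mul_sum]
    exact Finset.sum_congr rfl fun _ _ => Finset.sum_congr rfl fun _ _ =>
      Finset.sum_congr rfl fun _ _ => Finset.sum_congr rfl fun _ _ => by ring
  -- The symmetry of tr(g⁻¹ Dg g⁻¹ D'g) in D and D', by cyclicity of the trace.
  have swap : ∑ k, ∑ l, ∑ a, ∑ b, S.ginv k a * S.ginv b l * (D (S.g a b) * D' (S.g k l)) =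
      ∑ k, ∑ l, ∑ a, ∑ b, S.ginv k a * S.ginv b l * (D' (S.g a b) * D (S.g k l)) := by
    have h1 : ∀ f : Fin n → Fin n → Fin n → Fin n → A,
        ∑ k, ∑ l, ∑ a, ∑ b, f k l a b = ∑ k, ∑ l, ∑ a, ∑ b, f a b k l := by
      intro f
      simp only [← Finset.sum_product' Finset.univ Finset.univ]
      rw [Finset.sum_comm]
    rw [h1]
    exact Finset.sum_congr rfl fun k _ => Finset.sum_congr rfl fun l _ =>
      Finset.sum_congr rfl fun a _ => Finset.sum_congr rfl fun b _ => by
        rw [S.ginv_symm a k, S.ginv_symm l b]; ring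
  rw [key D D', key D' D, swap]
  simp only [mul_sub, Finset.sum_sub_distrib]
  ring

/-- `θ` of a combination of derivations, with the derivations given by their values. -/
lemma θ_of_eq_sum (D : A → A) (c : Fin n → A) (d : Fin n → Derivation ℝ A A)
    (h : ∀ f, D f = ∑ i, c i * d i f) :
    half A * ∑ k, ∑ l, S.ginv k l * D (S.g k l) = ∑ i, c i * S.θ (d i) := by
  simp only [h, θ, Finset.mul_sum]
  have h1 : ∀ k, ∑ l, ∑ i, half A * (S.ginv k l * (c i * d i (S.g k l))) =
      ∑ i, ∑ l, c i * (half A * (S.ginv k l * d i (S.g k l))) := by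
    intro k
    rw [Finset.sum_comm]
    exact Finset.sum_congr rfl fun _ _ => Finset.sum_congr rfl fun _ _ => by ring
  simp only [h1]
  rw [Finset.sum_comm]

lemma θ_hD_hD (j k : Fin n) :
    S.hD j (S.θ (S.hD k)) - S.hD k (S.θ (S.hD j)) = ∑ i, S.Rn i j k * S.I i := by
  rw [S.θ_closed]
  simp only [S.I_eq_θ]
  exact S.θ_of_eq_sum (fun f => S.hD j (S.hD k f) - S.hD k (S.hD j f)) _ _ (S.hD_hD j k)

lemma sum_Γ (j : Fin n) : ∑ r, S.Γ r r j = S.θ (S.hD j) := by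
  simp only [Γ, θ, ← Finset.mul_sum]
  congr 1
  simp only [mul_add, mul_sub, Finset.sum_add_distrib, Finset.sum_sub_distrib]
  have h : ∑ r, ∑ l, S.ginv r l * S.hD r (S.g l j) = ∑ r, ∑ l, S.ginv r l * S.hD l (S.g r j) := by
    rw [Finset.sum_comm]
    exact Finset.sum_congr rfl fun _ _ => Finset.sum_congr rfl fun _ _ => by
      rw [S.ginv_symm]
  rw [h]; ring

/-! #### The Ricci tensor -/

lemma Ch_bianchi (h i j k : Fin n) : S.Ch h i j k + S.Ch j i k h + S.Ch k i h j = 0 := by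
  have h1 : ∀ m, S.Γ m j h = S.Γ m h j := fun m => S.Γ_symm m j h
  have h2 : ∀ m, S.Γ m k h = S.Γ m h k := fun m => S.Γ_symm m k h
  have h3 : ∀ m, S.Γ m k j = S.Γ m j k := fun m => S.Γ_symm m k j
  simp only [Ch, Finset.sum_sub_distrib, h1, h2, h3]
  ring

lemma Ch_antisymm (h i j k : Fin n) : S.Ch h i j k = - S.Ch h i k j := by
  simp only [Ch, Finset.sum_sub_distrib]; ring

/-- The trace of Γ is θ(δ_j) and the quadratic terms cancel in the trace, so only dθ on two
horizontal fields survives. -/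
lemma sum_Ch (j k : Fin n) : ∑ r, S.Ch r r j k = - ∑ m, S.I m * S.Rn m j k := by
  simp only [Ch, Finset.sum_add_distrib, Finset.sum_sub_distrib, ← map_sum, S.sum_Γ]
  have h1 : ∑ r, ∑ m, S.Γ m r j * S.Γ r m k = ∑ r, ∑ m, S.Γ m r k * S.Γ r m j := by
    rw [Finset.sum_comm]
    exact Finset.sum_congr rfl fun _ _ => Finset.sum_congr rfl fun _ _ => by ring
  have h2 := S.θ_hD_hD j k
  have h3 : ∑ m, S.I m * S.Rn m j k = ∑ i, S.Rn i j k * S.I i :=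
    Finset.sum_congr rfl fun _ _ => by ring
  rw [h1, h3, ← h2]; ring

/-- Contract the first Bianchi identity of the torsion-free connection Γ. The last two sums come
from the Cartan term by which `hh` differs from `Ch`. -/
lemma Ric_antisymm (h j : Fin n) : S.Ric h j - S.Ric j h =
    ∑ m, S.I m * S.Rn m h j + ∑ r, ∑ m, S.Cup r h m * S.Rn m j r
      - ∑ r, ∑ m, S.Cup r j m * S.Rn m h r := by
  have h1 := Finset.sum_congr (rfl : Finset.univ = Finset.univ)
    fun r (_ : r ∈ Finset.univ) => S.Ch_bianchi h r j r
  have h2 : ∀ r, S.Ch j r r h = - S.Ch j r h r := fun r => S.Ch_antisymm _ _ _ _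
  simp only [Finset.sum_add_distrib, h2, S.sum_Ch, Finset.sum_const_zero,
    Finset.sum_neg_distrib] at h1
  simp only [Ric, hh, Finset.sum_add_distrib]
  linear_combination h1

/-! #### Scalar flag curvature -/

variable (A) in
/-- The constant `1 / 3`. -/
def third : A := algebraMap ℝ A (1 / 3)

variable (A) in
lemma three_mul_third : 3 * third A = 1 := by
  have : (3 : A) = algebraMap ℝ A 3 := (map_ofNat _ 3).symm
  rw [third, this, ← map_mul]; norm_num

lemma three_cancel {a b : A} (h : 3 * a = 3 * b) : a = b := by
  linear_combination third A * h - (a - b) * three_mul_third A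

/-- The covector `λ_j = ⅓ F² ∂κ/∂yʲ + κ y_j`. -/
def lam (κ : A) (j : Fin n) : A := third A * S.E * S.dy j κ + κ * S.p j

lemma E_mul_Finv : S.E * S.Finv ^ 2 = 1 := by
  rw [E, ← mul_pow, S.F_mul_Finv, one_pow]

lemma dy_E (j : Fin n) : S.dy j S.E = 2 * S.p j := by
  rw [p]; linear_combination (- S.dy j S.E) * two_mul_half A

lemma p_eq_F_mul (i : Fin n) : S.p i = S.F * S.dy i S.F := by
  refine two_cancel ?_
  rw [← dy_E, E, sq, D_mul]; ring

lemma Finv_dy_F (i : Fin n) : S.Finv * S.dy i S.F = S.Finv ^ 2 * S.p i := by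
  rw [p_eq_F_mul]
  linear_combination (-S.Finv * S.dy i S.F) * S.F_mul_Finv

variable {S} {κ : A}
  (hκ : ∀ i k, S.Riem i k = κ * (S.E * (if i = k then 1 else 0) - S.y i * S.p k))

include hκ

/-- Insert the scalar form of the Riemann curvature in `three_Rn`. The derivatives of F² and y_k
combine to 3κ, which explains the ⅓ in `lam`. -/
lemma Rn_of_scalar (i j k : Fin n) : S.Rn i j k =
    S.lam κ j * ((if i = k then 1 else 0) - S.Finv ^ 2 * S.y i * S.p k)
      - S.lam κ k * ((if i = j then 1 else 0) - S.Finv ^ 2 * S.y i * S.p j) := by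
  have key : ∀ j k : Fin n, S.dy j (S.Riem i k) =
      S.dy j κ * (S.E * (if i = k then 1 else 0) - S.y i * S.p k) +
        κ * (2 * S.p j * (if i = k then 1 else 0) - (if i = j then 1 else 0) * S.p k
          - S.y i * S.g j k) := by
    intro j k
    have h0 : S.dy j (if i = k then 1 else 0) = 0 := by split_ifs <;> simp
    have h1 : (if j = i then (1 : A) else 0) = if i = j then 1 else 0 := by simp [eq_comm]
    rw [hκ, D_mul, map_sub, D_mul, D_mul, h0, S.dy_y, ← g_eq_dy_p, S.dy_E, h1]
    ring
  refine three_cancel ?_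
  rw [S.three_Rn, key, key, lam, lam, S.g_symm k j]
  generalize (if i = k then (1 : A) else 0) = a
  generalize (if i = j then (1 : A) else 0) = b
  linear_combination (-(S.E * S.dy j κ * (a - S.Finv ^ 2 * S.y i * S.p k)
    - S.E * S.dy k κ * (b - S.Finv ^ 2 * S.y i * S.p j))) * three_mul_third A
    + (S.dy j κ * S.y i * S.p k - S.dy k κ * S.y i * S.p j) * S.E_mul_Finv

lemma sum_mul_Rn_of_scalar (c : Fin n → A) (hc : ∑ i, c i * S.y i = 0) (j k : Fin n) :
    ∑ i, c i * S.Rn i j k = S.lam κ j * c k - S.lam κ k * c j := by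
  have h : ∀ i, c i * S.Rn i j k =
      S.lam κ j * (c i * if i = k then 1 else 0) - S.lam κ k * (c i * if i = j then 1 else 0)
        - S.Finv ^ 2 * (S.lam κ j * S.p k - S.lam κ k * S.p j) * (c i * S.y i) := by
    intro i; rw [Rn_of_scalar hκ]; ring
  simp only [h, Finset.sum_sub_distrib, ← Finset.mul_sum, hc]
  simp

lemma Rlow_of_scalar (l j k : Fin n) : S.Rlow l j k =
    S.lam κ j * (S.g l k - S.Finv ^ 2 * S.p l * S.p k)
      - S.lam κ k * (S.g l j - S.Finv ^ 2 * S.p l * S.p j) := by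
  have h : ∀ i, S.g l i * S.Rn i j k =
      S.lam κ j * (S.g l i * if i = k then 1 else 0)
        - S.lam κ k * (S.g l i * if i = j then 1 else 0)
        - S.Finv ^ 2 * (S.lam κ j * S.p k - S.lam κ k * S.p j) * (S.g l i * S.y i) := by
    intro i; rw [Rn_of_scalar hκ]; ring
  simp only [Rlow, h, Finset.sum_sub_distrib, ← Finset.mul_sum, S.g_y]
  simp only [mul_ite, mul_one, mul_zero, Finset.sum_ite_eq', Finset.mem_univ, if_true]
  ring

lemma sum_Rn_of_scalar (j : Fin n) : ∑ r, S.Rn r j r =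
    ((n : A) - 2) * S.lam κ j + S.Finv ^ 2 * S.p j * ∑ r, S.y r * S.lam κ r := by
  have h : ∀ r, S.Rn r j r = S.lam κ j - S.lam κ j * S.Finv ^ 2 * (S.y r * S.p r)
      - (S.lam κ r * if r = j then 1 else 0) + S.Finv ^ 2 * S.p j * (S.y r * S.lam κ r) := by
    intro r; rw [Rn_of_scalar hκ, if_pos rfl]; ring
  simp only [h, Finset.sum_sub_distrib, Finset.sum_add_distrib, ← Finset.mul_sum, S.y_p]
  simp only [mul_ite, mul_one, mul_zero, Finset.sum_ite_eq', Finset.mem_univ, if_true,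
    Finset.sum_const, Finset.card_univ, Fintype.card_fin, nsmul_eq_mul]
  linear_combination (-S.lam κ j) * S.E_mul_Finv

/-- Homogeneity of κ is not among the hypotheses. The identity follows instead by computing the
trace of the Riemann curvature in two ways and cancelling n - 1, which needs n ≥ 2. -/
lemma sum_y_lam (hn : 2 ≤ n) : ∑ r, S.y r * S.lam κ r = κ * S.E := by
  have h1 : ∑ j, S.y j * ∑ r, S.Rn r j r = ∑ r, S.Riem r r := by
    simp only [Finset.mul_sum]
    rw [Finset.sum_comm]
    simp only [S.y_Rn]
  have h2 : ∑ r, S.Riem r r = ((n : A) - 1) * (κ * S.E) := by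
    simp only [hκ, mul_sub, Finset.sum_sub_distrib, ← Finset.mul_sum, S.y_p]
    simp only [if_true, Finset.sum_const, Finset.card_univ, Fintype.card_fin, nsmul_eq_mul]
    ring
  have h3 : ∑ j, S.y j * ∑ r, S.Rn r j r = ((n : A) - 1) * ∑ r, S.y r * S.lam κ r := by
    have : ∀ j, S.y j * ∑ r, S.Rn r j r = ((n : A) - 2) * (S.y j * S.lam κ j)
        + S.Finv ^ 2 * (∑ r, S.y r * S.lam κ r) * (S.y j * S.p j) := by
      intro j; rw [sum_Rn_of_scalar hκ]; ring
    simp only [this, Finset.sum_add_distrib, ← Finset.mul_sum, S.y_p]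
    linear_combination (∑ r, S.y r * S.lam κ r) * S.E_mul_Finv
  have hn' : (n : ℝ) - 1 ≠ 0 := by
    have : (2 : ℝ) ≤ n := by exact_mod_cast hn
    linarith
  have h4 : ((n : A) - 1) * algebraMap ℝ A (1 / ((n : ℝ) - 1)) = 1 := by
    have : (n : A) - 1 = algebraMap ℝ A ((n : ℝ) - 1) := by simp
    rw [this, ← map_mul, mul_one_div_cancel hn', map_one]
  rw [h3, h2] at h1
  linear_combination algebraMap ℝ A (1 / ((n : ℝ) - 1)) * h1
    - (∑ r, S.y r * S.lam κ r - κ * S.E) * h4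

/-- The λ ∧ I term from dθ cancels against those produced by the two Cartan terms; the remaining λ_r
C^r_{ij} is symmetric. -/
lemma Ric_symm_of_scalar (i j : Fin n) : S.Ric i j - S.Ric j i = 0 := by
  have h : ∀ h j : Fin n, ∑ r, ∑ m, S.Cup r h m * S.Rn m j r =
      S.lam κ j * S.I h - ∑ r, S.lam κ r * S.Cup r h j := by
    intro h j
    simp only [sum_mul_Rn_of_scalar hκ _ (S.Cup_y _ h), Finset.sum_sub_distrib, ← Finset.mul_sum]
    simp only [S.Cup_symm _ h, S.sum_Cup]
  rw [S.Ric_antisymm, sum_mul_Rn_of_scalar hκ _ S.I_y, h, h]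
  simp only [S.Cup_symm _ i j]
  ring

/-- In scalar flag curvature, the skew part of `ℜ` is `λ ∧ I`. -/
lemma frak_antisymm_of_scalar (hn : 2 ≤ n) (i j : Fin n) :
    S.frak i j - S.frak j i = S.lam κ i * S.I j - S.lam κ j * S.I i := by
  have h1 : ∀ i j : Fin n, ∑ k, S.Iup k * S.curv3 i j k =
      S.lam κ j * S.I i - (∑ k, S.Iup k * S.lam κ k) * (S.g i j - S.Finv ^ 2 * S.p i * S.p j) := by
    intro i j
    have : ∀ k, S.Iup k * S.curv3 i j k = S.lam κ j * (S.Iup k * S.g i k)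
        - S.lam κ j * S.Finv ^ 2 * S.p i * (S.Iup k * S.p k)
        - (S.Iup k * S.lam κ k) * (S.g i j - S.Finv ^ 2 * S.p i * S.p j) := by
      intro k; rw [S.curv3_eq, Rlow_of_scalar hκ]; ring
    simp only [this, Finset.sum_sub_distrib, ← Finset.mul_sum, S.Iup_g, S.Iup_p, ← Finset.sum_mul]
    ring
  have h2 : ∀ i j : Fin n, ∑ k, S.Iup k * S.curv3 k j i =
      S.lam κ j * S.I i - S.lam κ i * S.I j := by
    intro i j
    have : ∀ k, S.Iup k * S.curv3 k j i = S.lam κ j * (S.Iup k * S.g i k)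
        - S.lam κ i * (S.Iup k * S.g j k)
        - S.Finv ^ 2 * (S.lam κ j * S.p i - S.lam κ i * S.p j) * (S.Iup k * S.p k) := by
      intro k; rw [S.curv3_eq, Rlow_of_scalar hκ, S.g_symm i, S.g_symm j]; ring
    simp only [this, Finset.sum_sub_distrib, ← Finset.mul_sum, S.Iup_g, S.Iup_p]
    ring
  have h3 : ∀ j : Fin n, ∑ k, S.Iup k * ∑ m, S.curv3 k m j * S.y m = κ * S.E * S.I j := by
    intro j
    have h4 : ∀ k, ∑ m, S.curv3 k m j * S.y m = κ * (S.E * S.g j k - S.p k * S.p j) := by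
      intro k
      have : ∑ m, S.curv3 k m j * S.y m = ∑ m, S.y m * S.Rlow k m j :=
        Finset.sum_congr rfl fun m _ => by rw [S.curv3_eq]; ring
      rw [this, S.y_Rlow]
      have h5 : ∀ m, S.g k m * S.Riem m j = κ * S.E * (S.g k m * if m = j then 1 else 0)
          - κ * S.p j * (S.g k m * S.y m) := by
        intro m; rw [hκ]; ring
      simp only [h5, Finset.sum_sub_distrib, ← Finset.mul_sum, S.g_y]
      simp only [mul_ite, mul_one, mul_zero, Finset.sum_ite_eq', Finset.mem_univ, if_true,
        S.g_symm k j]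
      ring
    have h6 : ∀ k, S.Iup k * ∑ m, S.curv3 k m j * S.y m =
        κ * S.E * (S.Iup k * S.g j k) - κ * S.p j * (S.Iup k * S.p k) := by
      intro k; rw [h4]; ring
    simp only [h6, Finset.sum_sub_distrib, ← Finset.mul_sum, S.Iup_g, S.Iup_p]
    ring
  have h7 : ∀ j : Fin n, ∑ m, S.Ric m j * S.y m = ((n : A) - 2) * S.lam κ j + κ * S.p j := by
    intro j
    have : ∑ m, S.Ric m j * S.y m = ∑ r, S.Rn r j r := by
      simp only [Ric, Finset.sum_mul, ← S.y_hh]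
      rw [Finset.sum_comm]
      exact Finset.sum_congr rfl fun _ _ => Finset.sum_congr rfl fun _ _ => by ring
    rw [this, sum_Rn_of_scalar hκ, sum_y_lam hκ hn]
    linear_combination κ * S.p j * S.E_mul_Finv
  -- The four terms in the bracket contribute 1, 2, 0 and n - 2 copies of λ_j I_i - λ_i I_j to the
  -- skew part, n + 1 in all. The leftover κ(y_i I_j + y_j I_i) is symmetric; this is the role of
  -- the term with F⁻¹ℓ_i.
  have h8 : algebraMap ℝ A (1 / ((n : ℝ) + 1)) * ((n : A) + 1) = 1 := by
    have : (n : A) + 1 = algebraMap ℝ A ((n : ℝ) + 1) := by simp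
    have hn' : (n : ℝ) + 1 ≠ 0 := by positivity
    rw [this, ← map_mul, one_div_mul_cancel hn', map_one]
  have h9 := Ric_symm_of_scalar hκ i j
  simp only [frak, h1, h2, h3, h7, S.Finv_dy_F, S.g_symm j i]
  linear_combination h9 + (S.lam κ i * S.I j - S.lam κ j * S.I i) * h8
    + algebraMap ℝ A (1 / ((n : ℝ) + 1)) * κ * (S.p j * S.I i - S.p i * S.I j) * S.E_mul_Finv

/-- Contraction of the skew part of `ℜ` with `y` yields `κ F² I`. -/
lemma kappa_mul_I (hn : 2 ≤ n) (j : Fin n) :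
    ∑ i, S.y i * (S.frak i j - S.frak j i) = κ * S.E * S.I j := by
  have h : ∀ i, S.y i * (S.frak i j - S.frak j i) =
      (S.y i * S.lam κ i) * S.I j - S.lam κ j * (S.I i * S.y i) := by
    intro i; rw [frak_antisymm_of_scalar hκ hn]; ring
  simp only [h, Finset.sum_sub_distrib, ← Finset.sum_mul, sum_y_lam hκ hn, ← Finset.mul_sum, S.I_y]
  ring

omit hκ

/-! #### The mean Cartan tensor along geodesics -/

variable (S)

/-- The spray derivative of g is the symmetrised lowered N, and tracing with g⁻¹ gives tr N twice.
-/
lemma θ_geo : S.θ S.geo = ∑ r, S.N r r := by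
  have h : ∑ k, ∑ l, S.ginv k l * S.geo (S.g k l) = 2 * ∑ r, S.N r r := by
    simp only [S.geo_g, mul_add, Finset.sum_add_distrib]
    have h1 : ∑ k, ∑ l, S.ginv k l * S.Nlow l k = ∑ r, S.N r r :=
      Finset.sum_congr rfl fun k _ => S.ginv_contract k fun m => S.N m k
    have h2 : ∑ k, ∑ l, S.ginv k l * S.Nlow k l = ∑ r, S.N r r := by
      rw [← h1, Finset.sum_comm]
      exact Finset.sum_congr rfl fun k _ => Finset.sum_congr rfl fun l _ => by rw [S.ginv_symm]
    rw [h1, h2]; ring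
  rw [θ, h]
  linear_combination (∑ r, S.N r r) * two_mul_half A

/-- Closedness of `θ` on the spray and ∂/∂yᵏ. The mean Landsberg tensor becomes a difference of
first order traces, which is easy to differentiate again. -/
lemma J_eq (k : Fin n) : S.J k = S.dy k (∑ r, S.N r r) - S.θ (S.hD k) := by
  have h1 := S.θ_closed S.geo (S.dy k)
  have h2 : half A * ∑ a, ∑ l, S.ginv a l *
      (S.geo (S.dy k (S.g a l)) - S.dy k (S.geo (S.g a l))) =
      ∑ m, S.N m k * S.I m - S.θ (S.hD k) := by
    simp only [S.I_eq_θ]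
    rw [← S.θ_of_eq_sum (fun f => ∑ m, S.N m k * S.dy m f) _ _ (fun f => rfl), θ, ← mul_sub]
    simp only [← Finset.sum_sub_distrib, ← mul_sub, S.dy_geo]
    congr 1
    exact Finset.sum_congr rfl fun _ _ => Finset.sum_congr rfl fun _ _ => by ring
  rw [h2, S.θ_geo, ← S.I_eq_θ] at h1
  rw [J]
  linear_combination h1

/-- The bracket of the spray with δ_k has vertical part the Riemann curvature; its horizontal part
comes from δ_k yʲ = -N^j_k. -/
lemma geo_hD (k : Fin n) (f : A) : S.geo (S.hD k f) - S.hD k (S.geo f) =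
    ∑ i, S.Riem i k * S.dy i f + ∑ j, S.N j k * S.hD j f := by
  simp only [S.geo_eq_sum_hD, map_sum, D_mul, S.hD_y, Finset.sum_add_distrib]
  have h1 : ∑ i, S.Riem i k * S.dy i f =
      ∑ j, S.y j * (S.hD j (S.hD k f) - S.hD k (S.hD j f)) := by
    simp only [S.hD_hD, ← S.y_Rn, Finset.sum_mul, Finset.mul_sum]
    rw [Finset.sum_comm]
    exact Finset.sum_congr rfl fun _ _ => Finset.sum_congr rfl fun _ _ => by ring
  have h2 : ∑ j, S.N j k * S.hD j f = - ∑ j, S.hD j f * -S.N j k := by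
    rw [← Finset.sum_neg_distrib]
    exact Finset.sum_congr rfl fun _ _ => by ring
  rw [h1, h2]
  simp only [mul_sub, Finset.sum_sub_distrib]
  ring

lemma geo_sum_N : S.geo (∑ r, S.N r r) =
    2 * (∑ r, S.dx r (S.G r)) - (∑ r, ∑ j, S.N r j * S.N j r) - ∑ r, S.Riem r r := by
  have : ∀ r, S.Riem r r = 2 * S.dx r (S.G r) - S.geo (S.N r r) - ∑ j, S.N r j * S.N j r := by
    intro r
    rw [Riem, S.geo_apply]
    simp only [N]
    ring
  simp only [this, map_sum, Finset.sum_sub_distrib, ← Finset.mul_sum]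
  ring

/-- In flat spaces `D_X D_X I = 0` for the geodesic spray `X`. -/
lemma geo_J_of_flat (hR : ∀ i k, S.Riem i k = 0) (k : Fin n) :
    S.geo (S.J k) - ∑ m, S.N m k * S.J m = 0 := by
  have hRn : ∀ i j k, S.Rn i j k = 0 := by
    intro i j k
    refine three_cancel ?_
    rw [S.three_Rn, hR, hR]; simp
  have h1 := S.dy_geo k (∑ r, S.N r r)
  -- Closedness on the spray and δ_k. Together with `J_eq` and `dy_geo` it leaves D_X J_k = ∂_k X(tr
  -- N) - 2 δ_k(tr N), where ∂_k is the vertical derivative, so only `h4` is missing.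
  have h2 := S.θ_closed S.geo (S.hD k)
  have h3 : half A * ∑ a, ∑ l, S.ginv a l *
      (S.geo (S.hD k (S.g a l)) - S.hD k (S.geo (S.g a l))) = ∑ j, S.N j k * S.θ (S.hD j) :=
    S.θ_of_eq_sum (fun f => S.geo (S.hD k f) - S.hD k (S.geo f)) _ _ fun f => by
      rw [S.geo_hD]; simp [hR]
  rw [h3, S.θ_geo] at h2
  have h4 : S.dy k (S.geo (∑ r, S.N r r)) = 2 * S.hD k (∑ r, S.N r r) := by
    -- Flatness lets δ_k and δ_r be exchanged: δ_k N^r_r = δ_r N^r_k.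
    have h5 : S.hD k (∑ r, S.N r r) = ∑ r, S.hD r (S.N r k) := by
      rw [map_sum]
      exact Finset.sum_congr rfl fun r _ => by
        have := hRn r r k
        rw [Rn] at this
        linear_combination this
    have h6 : ∑ r, ∑ j, S.N j r * S.dy k (S.N r j) = ∑ r, ∑ j, S.N r j * S.dy k (S.N j r) := by
      rw [Finset.sum_comm]
    have h7 : ∑ r, ∑ j, S.N r j * S.dy k (S.N j r) = ∑ r, ∑ j, S.N j r * S.dy j (S.N r k) := by
      rw [Finset.sum_comm]
      exact Finset.sum_congr rfl fun r _ => Finset.sum_congr rfl fun j _ => by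
        have : S.dy k (S.N r j) = S.dy j (S.N r k) := S.dy_dy _ _ _
        rw [this]
    have h8 : ∀ r, S.dy k (S.dx r (S.G r)) = S.dx r (S.N r k) := fun r => by
      rw [← S.dx_dy]; rfl
    rw [h5, S.geo_sum_N]
    simp only [hR, two_mul, map_sub, map_add, map_sum, map_zero, D_mul, Finset.sum_add_distrib,
      S.hD_apply, Finset.sum_sub_distrib, Finset.sum_const_zero, h6, h7, h8]
    ring
  simp only [S.J_eq, map_sub, mul_sub, Finset.sum_sub_distrib]
  linear_combination h1 - h2 + h4
end FinslerAlgebra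

/-! ### The algebra of smooth functions on an open set -/

section SmoothAlgebra

variable {V : Type*} [NormedAddCommGroup V] [NormedSpace ℝ V]

/-- The algebra of smooth functions on an open subset of a normed space. -/
def smoothAlgebra (Ω : TopologicalSpace.Opens V) : Subalgebra ℝ (Ω → ℝ) where
  carrier := {f | ∃ F : V → ℝ, ContDiffOn ℝ ∞ F Ω ∧ ∀ z : Ω, F z = f z}
  mul_mem' := by
    rintro f g ⟨F, hF, hf⟩ ⟨G, hG, hg⟩
    exact ⟨fun z => F z * G z, hF.mul hG, fun z => by simp [hf, hg]⟩
  add_mem' := by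
    rintro f g ⟨F, hF, hf⟩ ⟨G, hG, hg⟩
    exact ⟨fun z => F z + G z, hF.add hG, fun z => by simp [hf, hg]⟩
  algebraMap_mem' := fun r => ⟨fun _ => r, contDiffOn_const, fun z => by simp⟩

variable {Ω : TopologicalSpace.Opens V}

namespace smoothAlgebra

/-- Evaluation at a point. -/
def eval (z : Ω) : smoothAlgebra Ω →ₐ[ℝ] ℝ :=
  (Pi.evalAlgHom ℝ (fun _ : Ω => ℝ) z).comp (smoothAlgebra Ω).val

lemma ext_eval {f g : smoothAlgebra Ω} (h : ∀ z, eval z f = eval z g) : f = g :=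
  Subtype.ext (funext h)

/-- Restriction of a function that is smooth on `Ω`. -/
def restrict (F : V → ℝ) (hF : ContDiffOn ℝ ∞ F Ω) : smoothAlgebra Ω :=
  ⟨fun z => F z, F, hF, fun _ => rfl⟩

/-- Extension by zero. -/
def extend (f : smoothAlgebra Ω) : V → ℝ := Function.extend Subtype.val f.1 0

lemma extend_coe (f : smoothAlgebra Ω) (z : Ω) : extend f z = eval z f :=
  Subtype.val_injective.extend_apply _ _ _

lemma contDiffOn_extend (f : smoothAlgebra Ω) : ContDiffOn ℝ ∞ (extend f) Ω := by
  obtain ⟨F, hF, hf⟩ := f.2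
  exact hF.congr fun z hz => by rw [hf ⟨z, hz⟩]; exact extend_coe f ⟨z, hz⟩

lemma contDiffAt_extend (f : smoothAlgebra Ω) (z : Ω) : ContDiffAt ℝ ∞ (extend f) z :=
  (contDiffOn_extend f).contDiffAt (Ω.isOpen.mem_nhds z.2)

/-- As Ω is open, any formula that agrees with f on Ω has the same germ there as the extension by
zero, and may replace it under `fderiv`. -/
lemma eventuallyEq_extend {F : V → ℝ} {f : smoothAlgebra Ω} (h : ∀ z : Ω, F z = eval z f)
    (z : Ω) : F =ᶠ[nhds (z : V)] extend f := by
  filter_upwards [Ω.isOpen.mem_nhds z.2] with w hw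
  rw [h ⟨w, hw⟩]; exact (extend_coe f ⟨w, hw⟩).symm

lemma fderiv_eq {F : V → ℝ} {f : smoothAlgebra Ω} (h : ∀ z : Ω, F z = eval z f) (z : Ω) :
    fderiv ℝ F z = fderiv ℝ (extend f) z :=
  (eventuallyEq_extend h z).fderiv_eq

lemma differentiableAt_extend (f : smoothAlgebra Ω) (z : Ω) :
    DifferentiableAt ℝ (extend f) z :=
  (contDiffAt_extend f z).differentiableAt (by simp)

/-- The directional derivative. -/
def deriv (v : V) : Derivation ℝ (smoothAlgebra Ω) (smoothAlgebra Ω) :=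
  Derivation.mk'
    { toFun := fun f => restrict (fun z => fderiv ℝ (extend f) z v) <| by
        refine ContDiffOn.clm_apply ?_ contDiffOn_const
        exact (contDiffOn_extend f).fderiv_of_isOpen Ω.isOpen (by simp)
      map_add' := fun f g => by
        refine ext_eval fun z => ?_
        change fderiv ℝ (extend (f + g)) z v = fderiv ℝ (extend f) z v + fderiv ℝ (extend g) z v
        rw [← fderiv_eq (F := fun z => extend f z + extend g z) (f := f + g)
          (fun z => by rw [map_add, extend_coe, extend_coe]) z,
          fderiv_fun_add (differentiableAt_extend f z) (differentiableAt_extend g z)]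
        rfl
      map_smul' := fun c f => by
        refine ext_eval fun z => ?_
        change fderiv ℝ (extend (c • f)) z v = c * fderiv ℝ (extend f) z v
        rw [← fderiv_eq (F := fun z => c * extend f z) (f := c • f)
          (fun z => by rw [map_smul, extend_coe, smul_eq_mul]) z,
          fderiv_const_mul (differentiableAt_extend f z)]
        rfl }
    (fun f g => by
      refine ext_eval fun z => ?_
      change fderiv ℝ (extend (f * g)) z v =
        eval z f * fderiv ℝ (extend g) z v + eval z g * fderiv ℝ (extend f) z v
      rw [← fderiv_eq (F := fun z => extend f z * extend g z) (f := f * g)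
        (fun z => by rw [map_mul, extend_coe, extend_coe]) z,
        fderiv_fun_mul (differentiableAt_extend f z) (differentiableAt_extend g z), extend_coe,
        extend_coe]
      rfl)

lemma eval_deriv {F : V → ℝ} {f : smoothAlgebra Ω} (h : ∀ z : Ω, F z = eval z f) (v : V) (z : Ω) :
    eval z (deriv v f) = fderiv ℝ F z v := by
  rw [fderiv_eq h z]; rfl

lemma two_le_infty : (2 : WithTop ℕ∞) ≤ ∞ := WithTop.coe_le_coe.2 le_top

lemma deriv_comm (v w : V) (f : smoothAlgebra Ω) : deriv v (deriv w f) = deriv w (deriv v f) := by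
  refine ext_eval fun z => ?_
  have h : ∀ w, ∀ z : Ω, (fun z => fderiv ℝ (extend f) z w) (z : V) = eval z (deriv w f) :=
    fun _ _ => rfl
  rw [eval_deriv (F := fun z => fderiv ℝ (extend f) z w) (h w),
    eval_deriv (F := fun z => fderiv ℝ (extend f) z v) (h v)]
  have hd : DifferentiableAt ℝ (fderiv ℝ (extend f)) (z : V) :=
    ((contDiffAt_extend f z).fderiv_right (m := 1) two_le_infty).differentiableAt
      one_ne_zero
  have hs : IsSymmSndFDerivAt ℝ (extend f) (z : V) :=
    (contDiffAt_extend f z).isSymmSndFDerivAt (by simpa using two_le_infty)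
  have hc : ∀ a b, fderiv ℝ (fun z => fderiv ℝ (extend f) z a) (z : V) b =
      fderiv ℝ (fderiv ℝ (extend f)) (z : V) b a := by
    intro a b
    rw [fderiv_clm_apply hd (differentiableAt_const a)]
    simp
  rw [hc, hc]
  exact hs v w

lemma isUnit_of_ne_zero (f : smoothAlgebra Ω) (h : ∀ z, eval z f ≠ 0) : IsUnit f := by
  refine IsUnit.of_mul_eq_one (restrict (fun z => (extend f z)⁻¹)
    ((contDiffOn_extend f).inv fun z hz => by
      have := h ⟨z, hz⟩
      rwa [← extend_coe] at this)) (ext_eval fun z => ?_)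
  rw [map_mul]
  change eval z f * (extend f z)⁻¹ = eval z 1
  rw [extend_coe, mul_inv_cancel₀ (h z), map_one]

end smoothAlgebra

end SmoothAlgebra

open smoothAlgebra

/-! ### Coordinate formulas as elements of the algebra -/

variable {n : ℕ} {Ω : TopologicalSpace.Opens (Coord n × Coord n)}

/-- The element `a` of the algebra of smooth functions on `Ω` is given by the formula `f`. -/
def Represents (f : LocalFun n) (a : smoothAlgebra Ω) : Prop :=
  ∀ z : Ω, f z.1.1 z.1.2 = eval z a

namespace Represents

variable {f f' : LocalFun n} {a a' : smoothAlgebra Ω}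

lemma contDiffOn (h : Represents f a) :
    ContDiffOn ℝ ∞ (fun z : Coord n × Coord n => f z.1 z.2) Ω :=
  (contDiffOn_extend a).congr fun z hz => by rw [h ⟨z, hz⟩]; exact (extend_coe a ⟨z, hz⟩).symm

lemma differentiableAt (h : Represents f a) (z : Ω) :
    DifferentiableAt ℝ (fun z : Coord n × Coord n => f z.1 z.2) z :=
  (h.contDiffOn.contDiffAt (Ω.isOpen.mem_nhds z.2)).differentiableAt (by simp)

lemma of_contDiffOn (h : ContDiffOn ℝ ∞ (fun z : Coord n × Coord n => f z.1 z.2) Ω) :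
    Represents f (restrict (Ω := Ω) _ h) := fun _ => rfl

lemma mul (h : Represents f a) (h' : Represents f' a') :
    Represents (fun x y => f x y * f' x y) (a * a') := fun z => by
  simp only [h z, h' z, map_mul]

lemma add (h : Represents f a) (h' : Represents f' a') :
    Represents (fun x y => f x y + f' x y) (a + a') := fun z => by
  simp only [h z, h' z, map_add]

lemma sub (h : Represents f a) (h' : Represents f' a') :
    Represents (fun x y => f x y - f' x y) (a - a') := fun z => by
  simp only [h z, h' z, map_sub]

lemma pow (h : Represents f a) (k : ℕ) :
    Represents (fun x y => f x y ^ k) (a ^ k) := fun z => by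
  simp only [h z, map_pow]

lemma const (c : ℝ) : Represents (fun _ _ => c) (algebraMap ℝ (smoothAlgebra Ω) c) := fun z => by
  rw [AlgHom.commutes]; rfl

lemma sum {ι : Type*} {s : Finset ι} {f : ι → LocalFun n} {a : ι → smoothAlgebra Ω}
    (h : ∀ i, Represents (f i) (a i)) :
    Represents (fun x y => ∑ i ∈ s, f i x y) (∑ i ∈ s, a i) := fun z => by
  rw [map_sum]; exact Finset.sum_congr rfl fun i _ => h i z

/-- The local formulas differentiate in one variable with the other frozen, the algebra
differentiates jointly; the chain rule with the inclusion of a factor reconciles them. -/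
lemma dX (h : Represents f a) (k : Fin n) :
    Represents (dX k f) (smoothAlgebra.deriv (EuclideanSpace.single k 1, 0) a) := fun z => by
  rw [eval_deriv (F := fun z : Coord n × Coord n => f z.1 z.2) h, Finsler.dX]
  have h1 : HasFDerivAt (fun x' : Coord n => (x', z.1.2))
      (ContinuousLinearMap.inl ℝ (Coord n) (Coord n)) z.1.1 :=
    (hasFDerivAt_id _).prodMk (hasFDerivAt_const _ _)
  have h2 := HasFDerivAt.comp (g := fun z : Coord n × Coord n => f z.1 z.2) z.1.1
    (h.differentiableAt z).hasFDerivAt h1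
  have h3 : fderiv ℝ (fun x' => f x' z.1.2) z.1.1 = _ := h2.fderiv
  rw [h3]; simp

lemma dY (h : Represents f a) (k : Fin n) :
    Represents (dY k f) (smoothAlgebra.deriv (0, EuclideanSpace.single k 1) a) := fun z => by
  rw [eval_deriv (F := fun z : Coord n × Coord n => f z.1 z.2) h, Finsler.dY]
  have h1 : HasFDerivAt (fun y' : Coord n => (z.1.1, y'))
      (ContinuousLinearMap.inr ℝ (Coord n) (Coord n)) z.1.2 :=
    (hasFDerivAt_const _ _).prodMk (hasFDerivAt_id _)
  have h2 := HasFDerivAt.comp (g := fun z : Coord n × Coord n => f z.1 z.2) z.1.2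
    (h.differentiableAt z).hasFDerivAt h1
  have h3 : fderiv ℝ (fun y' => f z.1.1 y') z.1.2 = _ := h2.fderiv
  rw [h3]; simp

end Represents

/-- `L` is a smooth, positive, homogeneous function with nondegenerate fundamental tensor on `Ω`. -/
structure IsLocalFinsler (L : LocalFun n) (Ω : TopologicalSpace.Opens (Coord n × Coord n)) :
    Prop where
  contDiffOn : ContDiffOn ℝ ∞ (fun z : Coord n × Coord n => L z.1 z.2) Ω
  pos : ∀ z ∈ Ω, 0 < L z.1 z.2
  euler : ∀ z ∈ Ω, ∑ k, z.2 k * dY k L z.1 z.2 = L z.1 z.2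
  det_ne_zero : ∀ z ∈ Ω, (Matrix.of fun i j => fund L i j z.1 z.2).det ≠ 0

lemma IsLocalFinsler.mono {L : LocalFun n} {Ω Ω' : TopologicalSpace.Opens (Coord n × Coord n)}
    (h : IsLocalFinsler L Ω) (hΩ : Ω' ≤ Ω) : IsLocalFinsler L Ω' :=
  ⟨h.contDiffOn.mono hΩ, fun z hz => h.pos z (hΩ hz), fun z hz => h.euler z (hΩ hz),
    fun z hz => h.det_ne_zero z (hΩ hz)⟩

variable (Ω) in
/-- The coordinate function `yᵏ`. -/
def yCoord (k : Fin n) : smoothAlgebra Ω :=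
  restrict (fun z : Coord n × Coord n => z.2 k) (by fun_prop)

lemma represents_yCoord (k : Fin n) : Represents (fun _ y => y k) (yCoord Ω k) := fun _ => rfl

lemma represents_fund {L : LocalFun n} {F : smoothAlgebra Ω} (h : Represents L F) (i j : Fin n) :
    Represents (fund L i j) (algebraMap ℝ _ (1 / 2) *
      smoothAlgebra.deriv (0, EuclideanSpace.single i 1)
        (smoothAlgebra.deriv (0, EuclideanSpace.single j 1) (F ^ 2))) :=
  (Represents.const _).mul (((h.pow 2).dY j).dY i)

namespace IsLocalFinsler

variable {L : LocalFun n} (h : IsLocalFinsler L Ω)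

/-- The differential algebra of a Finsler function in a chart. -/
def toAlgebra : FinslerAlgebra n (smoothAlgebra Ω) where
  dx k := smoothAlgebra.deriv (EuclideanSpace.single k 1, 0)
  dy k := smoothAlgebra.deriv (0, EuclideanSpace.single k 1)
  y k := yCoord Ω k
  F := restrict _ h.contDiffOn
  Finv := restrict (fun z => (L z.1 z.2)⁻¹) (h.contDiffOn.inv fun z hz => (h.pos z hz).ne')
  dx_dx _ _ _ := deriv_comm _ _ _
  dx_dy _ _ _ := deriv_comm _ _ _
  dy_dy _ _ _ := deriv_comm _ _ _
  dx_y i j := ext_eval fun z => by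
    rw [← (represents_yCoord j).dX i z, map_zero, dX]; simp
  dy_y i j := ext_eval fun z => by
    rw [← (represents_yCoord j).dY i z, dY]
    have : fderiv ℝ (fun y' : Coord n => y' j) z.1.2 = EuclideanSpace.proj j :=
      (EuclideanSpace.proj j : Coord n →L[ℝ] ℝ).fderiv
    rw [this]
    by_cases hij : i = j
    · subst hij; simp
    · simp [hij, Ne.symm hij]
  F_mul_Finv := ext_eval fun z => by
    rw [map_mul, map_one]
    exact mul_inv_cancel₀ (h.pos z z.2).ne'
  euler := ext_eval fun z => by
    rw [map_sum]
    refine Eq.trans (Finset.sum_congr rfl fun k _ => ?_) (h.euler z z.2)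
    rw [map_mul, ← (Represents.of_contDiffOn h.contDiffOn).dY k z]
    rfl
  isUnit_det := isUnit_of_ne_zero _ fun z => by
    have := h.det_ne_zero z z.2
    rw [AlgHom.map_det]
    convert this using 2
    ext i j
    exact (represents_fund (Represents.of_contDiffOn h.contDiffOn) i j z).symm

lemma rep_F : Represents L h.toAlgebra.F := fun _ => rfl

lemma rep_y (k : Fin n) : Represents (fun _ y => y k) (h.toAlgebra.y k) := fun _ => rfl

lemma rep_Finv : Represents (fun x y => (L x y)⁻¹) h.toAlgebra.Finv := fun _ => rfl

variable {h} in
lemma rep_dY {f : LocalFun n} {a : smoothAlgebra Ω} (hf : Represents f a) (k : Fin n) :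
    Represents (dY k f) (h.toAlgebra.dy k a) := hf.dY k

lemma rep_E : Represents (sqFun L) h.toAlgebra.E := h.rep_F.pow 2

lemma rep_g (i j : Fin n) : Represents (fund L i j) (h.toAlgebra.g i j) := represents_fund h.rep_F i j

/-- Evaluation is a ring homomorphism, so the evaluated algebraic inverse is a left inverse of the
evaluated matrix, hence its inverse. -/
lemma rep_ginv (i j : Fin n) : Represents (fundInv L i j) (h.toAlgebra.ginv i j) := fun z => by
  have h1 : (Matrix.of fun a b => fund L a b z.1.1 z.1.2)⁻¹ =
      Matrix.of fun a b => eval z (h.toAlgebra.ginv a b) := by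
    refine Matrix.inv_eq_left_inv ?_
    ext a b
    have := congrArg (eval z) (h.toAlgebra.ginv_g a b)
    rw [map_sum] at this
    rw [Matrix.mul_apply, Matrix.one_apply]
    refine Eq.trans (Finset.sum_congr rfl fun l _ => ?_) (this.trans ?_)
    · rw [map_mul, ← h.rep_g l b z]; rfl
    · split_ifs <;> simp
  rw [fundInv, h1]; rfl

lemma rep_C (i j k : Fin n) : Represents (cartan L i j k) (h.toAlgebra.C i j k) := fun z => by
  have := ((Represents.const (1 / 4)).mul (((h.rep_E.dY k).dY j).dY i)) z
  refine Eq.trans this (congrArg _ ?_)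
  rw [FinslerAlgebra.C, FinslerAlgebra.half, ← map_mul]
  norm_num
  rfl

lemma rep_Cup (i j k : Fin n) : Represents (cartanUp L i j k) (h.toAlgebra.Cup i j k) :=
  .sum fun l => (h.rep_ginv i l).mul (h.rep_C l j k)

lemma rep_I (i : Fin n) : Represents (meanCartan L i) (h.toAlgebra.I i) :=
  .sum fun k => .sum fun l => (h.rep_ginv k l).mul (h.rep_C k l i)

lemma rep_Iup (k : Fin n) : Represents (meanCartanUp L k) (h.toAlgebra.Iup k) :=
  .sum fun i => (h.rep_ginv k i).mul (h.rep_I i)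

lemma rep_G (i : Fin n) : Represents (spray L i) (h.toAlgebra.G i) := fun z => by
  have := ((Represents.const (1 / 4)).mul (.sum (s := Finset.univ) fun l =>
    (h.rep_ginv i l).mul ((Represents.sum (s := Finset.univ) fun k =>
      ((h.rep_E.dY l).dX k).mul (h.rep_y k)).sub (h.rep_E.dX l)))) z
  refine Eq.trans this (congrArg _ ?_)
  rw [FinslerAlgebra.G, FinslerAlgebra.half, ← map_mul]
  norm_num
  rfl

lemma rep_two_mul {f : LocalFun n} {a : smoothAlgebra Ω} (hf : Represents f a) :
    Represents (fun x y => 2 * f x y) (2 * a) := fun z => by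
  simp only [hf z, map_mul, map_ofNat]

lemma rep_Riem (i k : Fin n) : Represents (riemann L i k) (h.toAlgebra.Riem i k) :=
  (((rep_two_mul ((h.rep_G i).dX k)).sub
    (.sum fun j => (h.rep_y j).mul (((h.rep_G i).dY k).dX j))).add
    (rep_two_mul (.sum fun j => (h.rep_G j).mul (((h.rep_G i).dY k).dY j)))).sub
    (.sum fun j => ((h.rep_G i).dY j).mul ((h.rep_G j).dY k))

lemma rep_N (i j : Fin n) : Represents (nonlinConn L i j) (h.toAlgebra.N i j) := (h.rep_G i).dY j

variable {h} in
lemma rep_hD {f : LocalFun n} {a : smoothAlgebra Ω} (hf : Represents f a) (k : Fin n) :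
    Represents (hDeriv L k f) (h.toAlgebra.hD k a) := by
  rw [FinslerAlgebra.hD_apply]
  exact (hf.dX k).sub (.sum fun r => (h.rep_N r k).mul (hf.dY r))

lemma rep_Γ (i j k : Fin n) : Represents (cartanConn L i j k) (h.toAlgebra.Γ i j k) :=
  (Represents.const _).mul (.sum fun l => (h.rep_ginv i l).mul
    (((rep_hD (h.rep_g l k) j).add (rep_hD (h.rep_g j l) k)).sub (rep_hD (h.rep_g j k) l)))

lemma rep_Rn (i j k : Fin n) : Represents (connCurv L i j k) (h.toAlgebra.Rn i j k) :=
  (rep_hD (h.rep_N i j) k).sub (rep_hD (h.rep_N i k) j)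

lemma rep_hh (a i j k : Fin n) : Represents (hhCurv L a i j k) (h.toAlgebra.hh a i j k) :=
  (((rep_hD (h.rep_Γ i a j) k).sub (rep_hD (h.rep_Γ i a k) j)).add
    (.sum fun m => ((h.rep_Γ m a j).mul (h.rep_Γ i m k)).sub
      ((h.rep_Γ m a k).mul (h.rep_Γ i m j)))).add
    (.sum fun m => (h.rep_Cup i a m).mul (h.rep_Rn m j k))

lemma rep_curv3 (i j k : Fin n) : Represents (curv3 L i j k) (h.toAlgebra.curv3 i j k) :=
  .sum fun a => (h.rep_y a).mul (.sum fun q => (h.rep_g i q).mul (h.rep_hh a q j k))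

lemma rep_Ric (i j : Fin n) : Represents (ricci L i j) (h.toAlgebra.Ric i j) :=
  .sum fun r => h.rep_hh i r j r

lemma rep_frak (i j : Fin n) : Represents (frakR L i j) (h.toAlgebra.frak i j) :=
  (h.rep_Ric i j).sub ((Represents.const _).mul
    ((((Represents.sum fun k => (h.rep_Iup k).mul (h.rep_curv3 i j k)).add
      (.sum fun k => (h.rep_Iup k).mul (h.rep_curv3 k j i))).add
      ((h.rep_Finv.mul (h.rep_F.dY i)).mul
        (.sum fun k => (h.rep_Iup k).mul (.sum fun m => (h.rep_curv3 k m j).mul (h.rep_y m))))).add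
      ((h.rep_I i).mul (.sum fun m => (h.rep_Ric m j).mul (h.rep_y m)))))

end IsLocalFinsler

/-! ### From flag curvature to the Riemann tensor -/

lemma eq_zero_of_quadratic_eq_zero {n : ℕ} (M : Fin n → Fin n → ℝ) (hM : ∀ i j, M i j = M j i)
    (h : ∀ u : Fin n → ℝ, ∑ i, ∑ j, M i j * u i * u j = 0) (i j : Fin n) : M i j = 0 := by
  have hd : ∀ i, M i i = 0 := by
    intro i
    have := h (fun a => if a = i then 1 else 0)
    simpa using this
  have := h (fun a => (if a = i then 1 else 0) + (if a = j then 1 else 0))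
  simp only [mul_add, Finset.sum_add_distrib, mul_ite, mul_one, mul_zero,
    Finset.sum_ite_eq', Finset.mem_univ, if_true, hd] at this
  have := hM i j
  linarith

variable {n : ℕ} {Ω : TopologicalSpace.Opens (Coord n × Coord n)}

lemma fundForm_eq_sum (L : LocalFun n) (x y u v : Coord n) :
    fundForm L x y u v = ∑ i, u i * ∑ j, fund L i j x y * v j := by
  simp only [fundForm, Finset.mul_sum]
  exact Finset.sum_congr rfl fun _ _ => Finset.sum_congr rfl fun _ _ => by ring

namespace IsLocalFinsler

variable {L : LocalFun n} (h : IsLocalFinsler L Ω)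

include h

lemma eval_E (z : Ω) : eval z h.toAlgebra.E = L z.1.1 z.1.2 ^ 2 := (h.rep_E z).symm

lemma eval_E_ne_zero (z : Ω) : eval z h.toAlgebra.E ≠ 0 := by
  rw [h.eval_E]; exact pow_ne_zero _ (h.pos z z.2).ne'

lemma sum_fund_mul_y (z : Ω) (i : Fin n) :
    ∑ j, fund L i j z.1.1 z.1.2 * z.1.2 j = eval z (h.toAlgebra.p i) := by
  rw [← FinslerAlgebra.g_y, map_sum]
  exact Finset.sum_congr rfl fun j _ => by rw [map_mul, ← h.rep_g i j z]; rfl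

lemma fundForm_y_right (z : Ω) (u : Coord n) :
    fundForm L z.1.1 z.1.2 u z.1.2 = ∑ i, u i * eval z (h.toAlgebra.p i) := by
  rw [fundForm_eq_sum]
  simp only [h.sum_fund_mul_y z]

lemma fund_symm (z : Ω) (i j : Fin n) : fund L i j z.1.1 z.1.2 = fund L j i z.1.1 z.1.2 := by
  rw [h.rep_g i j z, h.rep_g j i z, FinslerAlgebra.g_symm]

lemma fundForm_symm (z : Ω) (u v : Coord n) :
    fundForm L z.1.1 z.1.2 u v = fundForm L z.1.1 z.1.2 v u := by
  rw [fundForm, fundForm, Finset.sum_comm]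
  refine Finset.sum_congr rfl fun i _ => Finset.sum_congr rfl fun j _ => ?_
  rw [h.fund_symm z i j]; ring

lemma fundForm_y_y (z : Ω) : fundForm L z.1.1 z.1.2 z.1.2 z.1.2 = eval z h.toAlgebra.E := by
  rw [h.fundForm_y_right, ← FinslerAlgebra.y_p, map_sum]
  exact Finset.sum_congr rfl fun j _ => by rw [map_mul]; rfl

lemma fundForm_riemannVec (z : Ω) (u : Coord n) :
    fundForm L z.1.1 z.1.2 u (riemannVec L z.1.1 z.1.2 u) =
      ∑ i, ∑ k, eval z (∑ m, h.toAlgebra.g i m * h.toAlgebra.Riem m k) * u i * u k := by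
  rw [fundForm_eq_sum]
  refine Finset.sum_congr rfl fun i _ => ?_
  simp only [riemannVec, Finset.mul_sum, Finset.sum_mul, map_sum, map_mul]
  rw [Finset.sum_comm]
  refine Finset.sum_congr rfl fun k _ => Finset.sum_congr rfl fun m _ => ?_
  rw [← h.rep_g i m z, ← h.rep_Riem m k z]; ring

lemma flag_denominator (z : Ω) (u : Coord n) :
    fundForm L z.1.1 z.1.2 z.1.2 z.1.2 * fundForm L z.1.1 z.1.2 u u
      - fundForm L z.1.1 z.1.2 z.1.2 u ^ 2 =
    ∑ i, ∑ k, eval z (h.toAlgebra.E * h.toAlgebra.g i k - h.toAlgebra.p i * h.toAlgebra.p k)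
      * u i * u k := by
  rw [h.fundForm_symm z z.1.2 u, h.fundForm_y_y, h.fundForm_y_right, sq, Finset.sum_mul_sum,
    fundForm, Finset.mul_sum, ← Finset.sum_sub_distrib]
  refine Finset.sum_congr rfl fun i _ => ?_
  rw [Finset.mul_sum, ← Finset.sum_sub_distrib]
  refine Finset.sum_congr rfl fun k _ => ?_
  rw [map_sub, map_mul, map_mul, ← h.rep_g i k z]; ring

variable (hy : ∀ z ∈ Ω, z.2 ≠ 0)
  (hD : ∀ z ∈ Ω, ∀ u, LinearIndependent ℝ ![z.2, u] →
    fundForm L z.1 z.2 z.2 z.2 * fundForm L z.1 z.2 u u - fundForm L z.1 z.2 z.2 u ^ 2 ≠ 0)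
  {K : LocalFun n}
  (hK : ∀ z ∈ Ω, ∀ u, LinearIndependent ℝ ![z.2, u] → flagCurvature L z.1 z.2 u = K z.1 z.2)

include hy hD hK

/-- The flag condition equates the quadratic forms of R and of K(F²g_ik - y_i y_k) on vectors
independent of y. On multiples of y both vanish. Self-adjointness of R permits polarisation, and g⁻¹
raises the index. -/
lemma riemann_of_flagCurvature (z : Ω) (i k : Fin n) :
    eval z (h.toAlgebra.Riem i k) = K z.1.1 z.1.2 *
      eval z (h.toAlgebra.E * (if i = k then 1 else 0) - h.toAlgebra.y i * h.toAlgebra.p k) := by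
  have hlow : ∀ i k, eval z (∑ m, h.toAlgebra.g i m * h.toAlgebra.Riem m k) = K z.1.1 z.1.2 *
      eval z (h.toAlgebra.E * h.toAlgebra.g i k - h.toAlgebra.p i * h.toAlgebra.p k) := by
    intro i k
    rw [← sub_eq_zero]
    refine eq_zero_of_quadratic_eq_zero (fun i k =>
      eval z (∑ m, h.toAlgebra.g i m * h.toAlgebra.Riem m k) - K z.1.1 z.1.2 *
      eval z (h.toAlgebra.E * h.toAlgebra.g i k - h.toAlgebra.p i * h.toAlgebra.p k))
      (fun i k => ?_) (fun u => ?_) i k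
    · rw [FinslerAlgebra.Riem_symm, h.toAlgebra.g_symm i k, mul_comm (h.toAlgebra.p i)]
    · set v : Coord n := WithLp.toLp 2 u with hv
      have huv : ∀ i, u i = v i := fun i => rfl
      simp only [sub_mul, Finset.sum_sub_distrib, mul_assoc, ← Finset.mul_sum, huv]
      simp only [← mul_assoc]
      rw [← h.fundForm_riemannVec, ← h.flag_denominator]
      by_cases hu : LinearIndependent ℝ ![z.1.2, v]
      · rw [← hK z z.2 v hu, flagCurvature, div_mul_cancel₀ _ (hD z z.2 v hu), sub_self]
      · rw [LinearIndependent.pair_iff' (hy z z.2)] at hu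
        push Not at hu
        obtain ⟨c, hc⟩ := hu
        have hR : riemannVec L z.1.1 z.1.2 v = 0 := by
          ext i
          rw [← hc]
          have := congrArg (eval z) (h.toAlgebra.Riem_y i)
          rw [map_sum, map_zero] at this
          change ∑ k, riemann L i k z.1.1 z.1.2 * (c * z.1.2 k) = 0
          rw [← mul_zero c, ← this, Finset.mul_sum]
          refine Finset.sum_congr rfl fun k _ => ?_
          rw [map_mul, h.rep_Riem i k z]
          change _ = c * (_ * z.1.2 k)
          ring
        have hd : ∀ a b : Coord n, fundForm L z.1.1 z.1.2 a (c • b) =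
            c * fundForm L z.1.1 z.1.2 a b := by
          intro a b
          simp only [fundForm, Finset.mul_sum, PiLp.smul_apply, smul_eq_mul]
          exact Finset.sum_congr rfl fun _ _ => Finset.sum_congr rfl fun _ _ => by ring
        have h0 : ∀ a : Coord n, fundForm L z.1.1 z.1.2 a 0 = 0 := fun a => by
          simp [fundForm]
        rw [hR, ← hc, h0, hd, hd, h.fundForm_symm z (c • z.1.2), hd]
        ring
  have h1 := congrArg (eval z) (h.toAlgebra.ginv_contract i fun m => h.toAlgebra.Riem m k)
  have h2 : ∑ l, eval z (h.toAlgebra.ginv i l) * eval z (h.toAlgebra.g l k) =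
      if i = k then 1 else 0 := by
    have := congrArg (eval z) (h.toAlgebra.ginv_g i k)
    rw [map_sum] at this
    simp only [map_mul] at this
    rw [this]; split_ifs <;> simp
  have h3 : ∑ l, eval z (h.toAlgebra.ginv i l) * eval z (h.toAlgebra.p l) =
      eval z (h.toAlgebra.y i) := by
    rw [← FinslerAlgebra.ginv_p, map_sum]
    simp only [map_mul]
  have h4 : eval z (if i = k then 1 else 0) = if i = k then (1 : ℝ) else 0 := by
    split_ifs <;> simp
  rw [← h1, map_sum]
  simp only [map_mul, hlow, map_sub]
  rw [h4, ← h2, ← h3, Finset.mul_sum, Finset.sum_mul, ← Finset.sum_sub_distrib, Finset.mul_sum]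
  exact Finset.sum_congr rfl fun _ _ => by ring

/-- K is given as an arbitrary function, yet its vertical derivatives are needed. It is smooth
because it equals tr R / ((n - 1)F²). -/
lemma exists_scalar (hn : 2 ≤ n) : ∃ κ : smoothAlgebra Ω, Represents K κ ∧
    ∀ i k, h.toAlgebra.Riem i k =
      κ * (h.toAlgebra.E * (if i = k then 1 else 0) - h.toAlgebra.y i * h.toAlgebra.p k) := by
  have hn' : (n : ℝ) - 1 ≠ 0 := by
    have : (2 : ℝ) ≤ n := by exact_mod_cast hn
    linarith
  have hrep : Represents K (algebraMap ℝ _ (1 / ((n : ℝ) - 1)) * h.toAlgebra.Finv ^ 2 *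
      ∑ r, h.toAlgebra.Riem r r) := by
    intro z
    have h1 : ∑ r, eval z (h.toAlgebra.Riem r r) =
        K z.1.1 z.1.2 * (((n : ℝ) - 1) * eval z h.toAlgebra.E) := by
      simp only [h.riemann_of_flagCurvature hy hD hK z, if_true, ← Finset.mul_sum, ← map_sum,
        Finset.sum_sub_distrib, FinslerAlgebra.y_p]
      simp only [Finset.sum_const, Finset.card_univ, Fintype.card_fin, nsmul_eq_mul, map_sub,
        map_mul, map_natCast, map_one]
      ring
    have h2 := congrArg (eval z) h.toAlgebra.E_mul_Finv
    rw [map_mul, map_one] at h2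
    rw [map_mul, map_mul, map_sum, h1, AlgHom.commutes]
    change _ = 1 / ((n : ℝ) - 1) * _ * _
    field_simp
    linear_combination (-K z.1.1 z.1.2) * h2
  refine ⟨_, hrep, fun i k => ext_eval fun z => ?_⟩
  rw [h.riemann_of_flagCurvature hy hD hK z, map_mul, hrep z]

lemma riemann_eq_zero_of_K_eq_zero (z : Ω) (hz : K z.1.1 z.1.2 = 0) (i k : Fin n) :
    riemann L i k z.1.1 z.1.2 = 0 := by
  rw [h.rep_Riem i k z, h.riemann_of_flagCurvature hy hD hK z, hz, zero_mul]

lemma frakR_symm_of_K_eq_zero (hn : 2 ≤ n) (h0 : ∀ z : Ω, K z.1.1 z.1.2 = 0) (z : Ω)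
    (i j : Fin n) : frakR L i j z.1.1 z.1.2 = frakR L j i z.1.1 z.1.2 := by
  obtain ⟨κ, hκ, hR⟩ := h.exists_scalar hy hD hK hn
  have hκ0 : κ = 0 := ext_eval fun z => by rw [← hκ z, h0, map_zero]
  have := FinslerAlgebra.frak_antisymm_of_scalar hR hn i j
  rw [hκ0] at this
  simp only [FinslerAlgebra.lam, map_zero, mul_zero, zero_mul, add_zero, sub_self] at this
  rw [h.rep_frak i j z, h.rep_frak j i z, sub_eq_zero.1 this]

/-- Symmetry is needed only at the one point, since contraction with y involves no further
derivative of ℜ. -/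
lemma K_mul_meanCartan (hn : 2 ≤ n) (z : Ω)
    (hz : ∀ i j, frakR L i j z.1.1 z.1.2 = frakR L j i z.1.1 z.1.2) (j : Fin n) :
    K z.1.1 z.1.2 * meanCartan L j z.1.1 z.1.2 = 0 := by
  obtain ⟨κ, hκ, hR⟩ := h.exists_scalar hy hD hK hn
  have := congrArg (eval z) (FinslerAlgebra.kappa_mul_I hR hn j)
  rw [map_sum, Finset.sum_eq_zero, map_mul, map_mul, ← hκ z, ← h.rep_I j z] at this
  · have hE := h.eval_E_ne_zero z
    rcases mul_eq_zero.1 this.symm with h1 | h1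
    · rcases mul_eq_zero.1 h1 with h2 | h2
      · rw [h2, zero_mul]
      · exact absurd h2 hE
    · rw [h1, mul_zero]
  · intro i _
    rw [map_mul, map_sub, ← h.rep_frak i j z, ← h.rep_frak j i z, hz i j, sub_self, mul_zero]

end IsLocalFinsler

/-! ### The mean Cartan tensor along geodesics -/

/-- The derivative along the geodesic spray, `yᵏ ∂f/∂xᵏ - 2 Gᵐ ∂f/∂yᵐ`. -/
def geoDeriv (L : LocalFun n) (f : LocalFun n) : LocalFun n :=
  fun x y => ∑ k, y k * dX k f x y - 2 * ∑ m, spray L m x y * dY m f x y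

/-- The covariant derivative along the geodesic spray of a covector field `f`. -/
def geoCovDeriv (L : LocalFun n) (f : Fin n → LocalFun n) (k : Fin n) : LocalFun n :=
  fun x y => geoDeriv L (f k) x y - ∑ m, nonlinConn L m k x y * f m x y

/-- The mean Landsberg tensor. -/
def meanLandsberg (L : LocalFun n) : Fin n → LocalFun n := geoCovDeriv L (meanCartan L)

namespace IsLocalFinsler

variable {L : LocalFun n} (h : IsLocalFinsler L Ω)

lemma rep_geoCovDeriv {f : Fin n → LocalFun n} {a : Fin n → smoothAlgebra Ω}
    (hf : ∀ k, Represents (f k) (a k)) (k : Fin n) :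
    Represents (geoCovDeriv L f k)
      (h.toAlgebra.geo (a k) - ∑ m, h.toAlgebra.N m k * a m) := by
  rw [FinslerAlgebra.geo_apply]
  exact ((Represents.sum fun k' => (h.rep_y k').mul ((hf k).dX k')).sub
    (rep_two_mul (.sum fun m => (h.rep_G m).mul ((hf k).dY m)))).sub
    (.sum fun m => (h.rep_N m k).mul (hf m))

lemma rep_meanLandsberg (k : Fin n) : Represents (meanLandsberg L k) (h.toAlgebra.J k) :=
  h.rep_geoCovDeriv h.rep_I k

include h in
lemma geoCovDeriv_meanLandsberg_of_flat
    (hR : ∀ z : Ω, ∀ i k, riemann L i k z.1.1 z.1.2 = 0) (z : Ω) (k : Fin n) :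
    geoCovDeriv L (meanLandsberg L) k z.1.1 z.1.2 = 0 := by
  rw [h.rep_geoCovDeriv h.rep_meanLandsberg k z, h.toAlgebra.geo_J_of_flat, map_zero]
  exact fun i k => ext_eval fun z => by rw [← h.rep_Riem i k z, hR, map_zero]

include h in
lemma meanLandsberg_of_meanCartan_eq_zero
    (hI : ∀ z : Ω, ∀ k, meanCartan L k z.1.1 z.1.2 = 0) (z : Ω) (k : Fin n) :
    meanLandsberg L k z.1.1 z.1.2 = 0 ∧
      geoCovDeriv L (meanLandsberg L) k z.1.1 z.1.2 = 0 := by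
  have hI0 : ∀ k, h.toAlgebra.I k = 0 := fun k => ext_eval fun z => by
    rw [← h.rep_I k z, hI, map_zero]
  have hJ0 : ∀ k, h.toAlgebra.J k = 0 := fun k => by simp [FinslerAlgebra.J, hI0]
  refine ⟨by rw [h.rep_meanLandsberg k z, hJ0, map_zero], ?_⟩
  rw [h.rep_geoCovDeriv h.rep_meanLandsberg k z]
  simp [hJ0]

end IsLocalFinsler

/-! ### Randers metrics -/

/-- The fibrewise data of a Randers metric `α + β`, `α² = a_{ij} yⁱ yʲ`, `β = b_i yⁱ`. -/
structure RandersAlgebra (n : ℕ) (A : Type*) [CommRing A] [Algebra ℝ A] where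
  dy : Fin n → Derivation ℝ A A
  y : Fin n → A
  a : Fin n → Fin n → A
  b : Fin n → A
  α : A
  αinv : A
  dy_y : ∀ i j, dy i (y j) = if i = j then 1 else 0
  dy_a : ∀ k i j, dy k (a i j) = 0
  dy_b : ∀ k i, dy k (b i) = 0
  a_symm : ∀ i j, a i j = a j i
  α_mul_αinv : α * αinv = 1
  α_sq : α ^ 2 = ∑ i, ∑ j, a i j * y i * y j

namespace RandersAlgebra

open FinslerAlgebra

variable {n : ℕ} {A : Type*} [CommRing A] [Algebra ℝ A] (R : RandersAlgebra n A)

/-- The `1`-form `β`. -/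
def β : A := ∑ i, R.b i * R.y i
/-- The Randers metric. -/
def F : A := R.α + R.β
/-- The covector `a_{kj} yʲ`. -/
def m (k : Fin n) : A := ∑ j, R.a k j * R.y j
/-- The angular metric of `α`. -/
def ang (j k : Fin n) : A := R.a j k - R.αinv ^ 2 * R.m j * R.m k
/-- The covector `b_k - (β/α) ∂α/∂yᵏ`. -/
def D (k : Fin n) : A := R.b k - R.β * R.αinv ^ 2 * R.m k

lemma y_m : ∑ k, R.y k * R.m k = R.α ^ 2 := by
  rw [R.α_sq]
  refine Finset.sum_congr rfl fun i _ => ?_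
  rw [m, Finset.mul_sum]
  exact Finset.sum_congr rfl fun j _ => by ring

lemma y_D : ∑ k, R.y k * R.D k = 0 := by
  have : ∀ k, R.y k * R.D k = R.b k * R.y k - R.β * R.αinv ^ 2 * (R.y k * R.m k) := by
    intro k; rw [D]; ring
  simp only [this, Finset.sum_sub_distrib, ← Finset.mul_sum, R.y_m]
  rw [← β]
  linear_combination (-R.β * (R.α * R.αinv + 1)) * R.α_mul_αinv

lemma dy_m (j k : Fin n) : R.dy j (R.m k) = R.a j k := by
  simp [m, R.dy_a, R.dy_y, R.a_symm k j]

lemma dy_β (j : Fin n) : R.dy j R.β = R.b j := by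
  simp [β, R.dy_b, R.dy_y]

lemma dy_α (j : Fin n) : R.dy j R.α = R.αinv * R.m j := by
  have h1 : R.dy j (R.α ^ 2) = 2 * R.m j := by
    rw [R.α_sq]
    have : ∑ i, ∑ l, R.a i l * R.y i * R.y l = ∑ i, R.y i * R.m i := by
      rw [R.y_m, R.α_sq]
    rw [this]
    simp only [map_sum, D_mul, R.dy_m, R.dy_y, Finset.sum_add_distrib, mul_ite, mul_one, mul_zero,
      Finset.sum_ite_eq, Finset.mem_univ, if_true]
    have : ∑ i, R.y i * R.a j i = R.m j := Finset.sum_congr rfl fun i _ => by ring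
    rw [this]; ring
  rw [sq, D_mul] at h1
  refine two_cancel ?_
  linear_combination R.αinv * h1 - 2 * R.dy j R.α * R.α_mul_αinv

lemma dy_αinv (j : Fin n) : R.dy j R.αinv = -(R.αinv ^ 3 * R.m j) := by
  have h := congrArg (R.dy j) R.α_mul_αinv
  rw [D_mul, R.dy_α, Derivation.map_one_eq_zero] at h
  linear_combination R.αinv * h - R.dy j R.αinv * R.α_mul_αinv

lemma dy_F (k : Fin n) : R.dy k R.F = R.αinv * R.m k + R.b k := by
  rw [F, map_add, R.dy_α, R.dy_β]

lemma dy_dy_F (j k : Fin n) : R.dy j (R.dy k R.F) = R.αinv * R.ang j k := by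
  rw [R.dy_F, map_add, D_mul, R.dy_b, R.dy_αinv, R.dy_m, ang]; ring

lemma euler_F : ∑ k, R.y k * R.dy k R.F = R.F := by
  have : ∀ k, R.y k * R.dy k R.F = R.αinv * (R.y k * R.m k) + R.b k * R.y k := by
    intro k; rw [R.dy_F]; ring
  simp only [this, Finset.sum_add_distrib, ← Finset.mul_sum, R.y_m]
  rw [← β, F]
  linear_combination R.α * R.α_mul_αinv

lemma g_eq (j k : Fin n) : half A * R.dy j (R.dy k (R.F ^ 2)) =
    R.F * R.αinv * R.ang j k + R.dy j R.F * R.dy k R.F := by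
  have h1 : R.dy k (R.F ^ 2) = 2 * (R.F * R.dy k R.F) := by rw [sq, D_mul]; ring
  rw [h1, two_mul, map_add, D_mul, R.dy_dy_F]
  linear_combination
    (R.F * R.αinv * R.ang j k + R.dy j R.F * R.dy k R.F) * two_mul_half A

lemma dy_ang (i j k : Fin n) : R.dy i (R.ang j k) =
    -(R.αinv ^ 2 * (R.ang i j * R.m k + R.ang i k * R.m j)) := by
  rw [ang, map_sub, R.dy_a, D_mul, D_mul, sq, D_mul, R.dy_αinv, R.dy_m, R.dy_m, ang, ang]
  ring

lemma D_eq (k : Fin n) : R.D k = R.dy k R.F - R.F * R.αinv ^ 2 * R.m k := by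
  rw [R.dy_F, D, F]
  linear_combination R.αinv * R.m k * R.α_mul_αinv

/-- This is the C-reducibility of Randers metrics: C is the symmetrised product of an angular metric
with one covector, so a single trace determines it. -/
lemma dy_g (i j k : Fin n) : R.dy i (half A * R.dy j (R.dy k (R.F ^ 2))) =
    R.αinv * (R.ang j k * R.D i + R.ang i j * R.D k + R.ang i k * R.D j) := by
  rw [R.g_eq, map_add, D_mul, D_mul, D_mul, R.dy_ang, R.dy_dy_F, R.dy_dy_F, R.dy_αinv, R.D_eq,
    R.D_eq, R.D_eq]
  ring

variable {R} {S : FinslerAlgebra n A} (hdy : ∀ k, S.dy k = R.dy k) (hy : ∀ k, S.y k = R.y k)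
  (hF : S.F = R.F)

include hdy hy hF

/-- The mean Cartan tensor of a Randers metric is `(n + 1) / (2 F)` times `b - (β/α) dα`. -/
lemma mean_cartan_eq (i : Fin n) : 2 * R.F * S.I i = ((n : A) + 1) * R.D i := by
  have hg : ∀ j k, S.g j k = half A * R.dy j (R.dy k (R.F ^ 2)) := by
    intro j k; rw [FinslerAlgebra.g, E, hdy, hdy, hF]
  -- The angular metric of F is g_jk - ℓ_j ℓ_k = (F/α) times that of α. Written with g, the tensor C
  -- can be traced with g⁻¹ directly.
  have hC : ∀ j k, 2 * R.F * S.C j k i = (S.g j k - S.dy j S.F * S.dy k S.F) * R.D i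
      + (S.g i j - S.dy i S.F * S.dy j S.F) * R.D k
      + (S.g i k - S.dy i S.F * S.dy k S.F) * R.D j := by
    intro j k
    have h1 : ∀ j k, S.g j k - S.dy j S.F * S.dy k S.F = R.F * R.αinv * R.ang j k := by
      intro j k
      rw [hg, R.g_eq, hdy, hdy, hF]; ring
    rw [h1, h1, h1, S.C_symm_right, S.C_symm_left, S.C_eq, hg, hdy, R.dy_g]
    linear_combination R.F * R.αinv * (R.ang j k * R.D i + R.ang i j * R.D k + R.ang i k * R.D j)
      * two_mul_half A
  have hF' : S.F = ∑ k, S.dy k S.F * S.y k := by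
    conv_lhs => rw [← S.euler]
    exact Finset.sum_congr rfl fun k _ => by ring
  have hginvF : ∀ k, ∑ l, S.ginv k l * S.dy l S.F = S.Finv * S.y k := by
    intro k
    rw [← S.ginv_p, Finset.mul_sum]
    refine Finset.sum_congr rfl fun l _ => ?_
    rw [S.p_eq_F_mul]
    linear_combination (-S.ginv k l * S.dy l S.F) * S.F_mul_Finv
  have hDy : ∑ k, S.y k * R.D k = 0 := by simp only [hy, R.y_D]
  -- The angular metric has trace n - 1, and each of the two mixed contractions returns D_i because
  -- yᵏD_k = 0. The total is the factor n + 1.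
  have e1 : ∑ k, ∑ l, S.ginv k l * (S.g k l - S.dy k S.F * S.dy l S.F) = (n : A) - 1 := by
    have h1 : ∀ k, ∑ l, S.ginv k l * S.g k l = 1 := by
      intro k
      have := S.ginv_g k k
      rw [if_pos rfl] at this
      rw [← this]
      exact Finset.sum_congr rfl fun l _ => by rw [S.g_symm]
    have h2 : ∀ k, ∑ l, S.ginv k l * (S.dy k S.F * S.dy l S.F) =
        S.Finv * (S.dy k S.F * S.y k) := by
      intro k
      rw [mul_left_comm, ← hginvF, Finset.mul_sum]
      exact Finset.sum_congr rfl fun l _ => by ring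
    simp only [mul_sub, Finset.sum_sub_distrib, h1, h2, ← Finset.mul_sum, ← hF']
    simp only [Finset.sum_const, Finset.card_univ, Fintype.card_fin, nsmul_eq_mul]
    linear_combination (-1 : A) * S.F_mul_Finv
  have e2 : ∑ k, ∑ l, S.ginv k l * ((S.g i k - S.dy i S.F * S.dy k S.F) * R.D l) = R.D i := by
    rw [Finset.sum_comm]
    have h1 : ∀ l, ∑ k, S.ginv k l * ((S.g i k - S.dy i S.F * S.dy k S.F) * R.D l) =
        (∑ k, S.g i k * S.ginv k l) * R.D l - S.dy i S.F * S.Finv * (S.y l * R.D l) := by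
      intro l
      have : S.Finv * S.y l = ∑ k, S.ginv k l * S.dy k S.F := by
        rw [← hginvF]
        exact Finset.sum_congr rfl fun k _ => by rw [S.ginv_symm]
      have h2 : S.dy i S.F * S.Finv * (S.y l * R.D l) =
          (∑ k, S.ginv k l * S.dy k S.F) * (S.dy i S.F * R.D l) := by rw [← this]; ring
      rw [h2, Finset.sum_mul, Finset.sum_mul, ← Finset.sum_sub_distrib]
      exact Finset.sum_congr rfl fun k _ => by ring
    simp only [h1, Finset.sum_sub_distrib, ← Finset.mul_sum, hDy, S.g_ginv]
    simp
  have e3 : ∑ k, ∑ l, S.ginv k l * ((S.g i l - S.dy i S.F * S.dy l S.F) * R.D k) = R.D i := by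
    refine Eq.trans ?_ e2
    rw [Finset.sum_comm]
    exact Finset.sum_congr rfl fun k _ => Finset.sum_congr rfl fun l _ => by
      rw [S.ginv_symm]
  have e4 : 2 * R.F * S.I i = ∑ k, ∑ l, (S.ginv k l * (S.g k l - S.dy k S.F * S.dy l S.F) * R.D i
      + S.ginv k l * ((S.g i k - S.dy i S.F * S.dy k S.F) * R.D l)
      + S.ginv k l * ((S.g i l - S.dy i S.F * S.dy l S.F) * R.D k)) := by
    rw [FinslerAlgebra.I, Finset.mul_sum]
    refine Finset.sum_congr rfl fun k _ => ?_
    rw [Finset.mul_sum]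
    refine Finset.sum_congr rfl fun l _ => ?_
    rw [mul_left_comm, hC]; ring
  rw [e4]
  simp only [Finset.sum_add_distrib, e2, e3, ← Finset.sum_mul, e1]
  ring

end RandersAlgebra

/-! ### Positive definite quadratic forms -/

/-- The quadratic form `a_{ij} uⁱ uʲ`. -/
def quad {n : ℕ} (a : Fin n → Fin n → ℝ) (u : Coord n) : ℝ := ∑ i, ∑ j, a i j * u i * u j

/-- The covector `a_{ij} yʲ`. -/
def lower {n : ℕ} (a : Fin n → Fin n → ℝ) (y : Coord n) (i : Fin n) : ℝ := ∑ j, a i j * y j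

section QuadraticForm

variable {n : ℕ} {a : Fin n → Fin n → ℝ}

lemma quad_eq_lower (u : Coord n) : quad a u = ∑ i, lower a u i * u i := by
  simp only [quad, lower, Finset.sum_mul]
  exact Finset.sum_congr rfl fun _ _ => Finset.sum_congr rfl fun _ _ => by ring

lemma lower_sub_smul (c s : ℝ) (u y : Coord n) (i : Fin n) :
    lower a (c • u - s • y) i = c * lower a u i - s * lower a y i := by
  simp only [lower, PiLp.sub_apply, PiLp.smul_apply, smul_eq_mul, mul_sub,
    Finset.sum_sub_distrib, Finset.mul_sum]
  congr 1 <;> exact Finset.sum_congr rfl fun _ _ => by ring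

lemma lower_comm (ha : ∀ i j, a i j = a j i) (u y : Coord n) :
    ∑ i, lower a u i * y i = ∑ i, lower a y i * u i := by
  simp only [lower, Finset.sum_mul]
  rw [Finset.sum_comm]
  exact Finset.sum_congr rfl fun i _ => Finset.sum_congr rfl fun j _ => by rw [ha i j]; ring

lemma quad_sub_smul (ha : ∀ i j, a i j = a j i) (c s : ℝ) (u y : Coord n) :
    quad a (c • u - s • y) =
      c ^ 2 * quad a u - 2 * c * s * (∑ i, lower a y i * u i) + s ^ 2 * quad a y := by
  have h : ∀ i, lower a (c • u - s • y) i * (c • u - s • y) i =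
      c ^ 2 * (lower a u i * u i) - c * s * (lower a u i * y i) - c * s * (lower a y i * u i)
        + s ^ 2 * (lower a y i * y i) := by
    intro i
    rw [lower_sub_smul]
    simp only [PiLp.sub_apply, PiLp.smul_apply, smul_eq_mul]
    ring
  rw [quad_eq_lower]
  simp only [h, Finset.sum_add_distrib, Finset.sum_sub_distrib, ← Finset.mul_sum, lower_comm ha u y]
  rw [← quad_eq_lower, ← quad_eq_lower]
  ring

lemma quad_zero : quad a 0 = 0 := by simp [quad]

/-- Cauchy–Schwarz. The form takes the value q(y)(q(y)q(u) - ⟨y,u⟩²) at q(y)u - ⟨y,u⟩y. -/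
lemma sq_lower_le (ha : ∀ i j, a i j = a j i) (hpos : ∀ u : Coord n, u ≠ 0 → 0 < quad a u)
    {y : Coord n} (hy : y ≠ 0) (u : Coord n) :
    (∑ i, lower a y i * u i) ^ 2 ≤ quad a y * quad a u := by
  have h := quad_sub_smul ha (quad a y) (∑ i, lower a y i * u i) u y
  have h0 : 0 ≤ quad a (quad a y • u - (∑ i, lower a y i * u i) • y) := by
    by_cases hz : quad a y • u - (∑ i, lower a y i * u i) • y = 0
    · rw [hz, quad_zero]
    · exact (hpos _ hz).le
  have hq := hpos y hy
  by_contra hc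
  push Not at hc
  nlinarith [mul_pos hq (sub_pos.2 hc)]

lemma sq_lower_lt (ha : ∀ i j, a i j = a j i) (hpos : ∀ u : Coord n, u ≠ 0 → 0 < quad a u)
    {y u : Coord n} (hyu : LinearIndependent ℝ ![y, u]) :
    (∑ i, lower a y i * u i) ^ 2 < quad a y * quad a u := by
  have hy : y ≠ 0 := hyu.ne_zero 0
  have h := quad_sub_smul ha (quad a y) (∑ i, lower a y i * u i) u y
  have hq := hpos y hy
  have h0 : 0 < quad a (quad a y • u - (∑ i, lower a y i * u i) • y) := by
    refine hpos _ fun hz => hq.ne' ?_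
    rw [LinearIndependent.pair_iff] at hyu
    exact (hyu (-∑ i, lower a y i * u i) (quad a y) (by rw [← hz]; module)).2
  by_contra hc
  push Not at hc
  nlinarith [mul_nonneg hq.le (sub_nonneg.2 hc)]

end QuadraticForm

/-! ### Randers metrics over an open set of coordinate space -/

/-- `L = √(a_{ij} yⁱ yʲ) + b_i yⁱ` is a smooth Randers metric over `U`. -/
structure IsLocalRanders {n : ℕ} (a : Coord n → Fin n → Fin n → ℝ) (b : Coord n → Fin n → ℝ)
    (L : LocalFun n) (U : TopologicalSpace.Opens (Coord n)) : Prop where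
  contDiffOn_a : ∀ i j, ContDiffOn ℝ ∞ (fun x => a x i j) U
  contDiffOn_b : ∀ i, ContDiffOn ℝ ∞ (fun x => b x i) U
  symm : ∀ x ∈ U, ∀ i j, a x i j = a x j i
  quad_pos : ∀ x ∈ U, ∀ y : Coord n, y ≠ 0 → 0 < quad (a x) y
  abs_lt : ∀ x ∈ U, ∀ y : Coord n, y ≠ 0 → |∑ i, b x i * y i| < √(quad (a x) y)
  eq : ∀ x ∈ U, ∀ y : Coord n, L x y = √(quad (a x) y) + ∑ i, b x i * y i

/-- The slit tangent bundle over an open set of coordinate space. -/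
def slit {n : ℕ} (U : TopologicalSpace.Opens (Coord n)) :
    TopologicalSpace.Opens (Coord n × Coord n) :=
  ⟨{z | z.1 ∈ U ∧ z.2 ≠ 0}, (U.isOpen.preimage continuous_fst).inter
    (isOpen_compl_singleton.preimage continuous_snd)⟩

lemma slit_mono {n : ℕ} {U U' : TopologicalSpace.Opens (Coord n)} (h : U ≤ U') :
    slit U ≤ slit U' := fun _ hz => ⟨h hz.1, hz.2⟩

namespace IsLocalRanders

variable {n : ℕ} {a : Coord n → Fin n → Fin n → ℝ} {b : Coord n → Fin n → ℝ} {L : LocalFun n}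
  {U : TopologicalSpace.Opens (Coord n)}

variable (h : IsLocalRanders a b L U)

include h

lemma contDiffOn_a' (i j : Fin n) :
    ContDiffOn ℝ ∞ (fun z : Coord n × Coord n => a z.1 i j) (slit U) :=
  (h.contDiffOn_a i j).comp contDiffOn_fst fun _ hz => hz.1

lemma contDiffOn_b' (i : Fin n) :
    ContDiffOn ℝ ∞ (fun z : Coord n × Coord n => b z.1 i) (slit U) :=
  (h.contDiffOn_b i).comp contDiffOn_fst fun _ hz => hz.1

lemma contDiffOn_α :
    ContDiffOn ℝ ∞ (fun z : Coord n × Coord n => √(quad (a z.1) z.2)) (slit U) := by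
  refine ContDiffOn.sqrt ?_ fun z hz => (h.quad_pos z.1 hz.1 z.2 hz.2).ne'
  refine ContDiffOn.sum fun i _ => ContDiffOn.sum fun j _ => ?_
  exact ((h.contDiffOn_a' i j).mul (by fun_prop)).mul (by fun_prop)

/-- The fibrewise differential algebra of a local Randers metric. -/
def toAlgebra : RandersAlgebra n (smoothAlgebra (slit U)) where
  dy k := smoothAlgebra.deriv (0, EuclideanSpace.single k 1)
  y k := yCoord (slit U) k
  a i j := restrict _ (h.contDiffOn_a' i j)
  b i := restrict _ (h.contDiffOn_b' i)
  α := restrict _ h.contDiffOn_α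
  αinv := restrict (fun z => (√(quad (a z.1) z.2))⁻¹)
    (h.contDiffOn_α.inv fun z hz => (Real.sqrt_pos.2 (h.quad_pos z.1 hz.1 z.2 hz.2)).ne')
  dy_y i j := ext_eval fun z => by
    rw [← (represents_yCoord j).dY i z, dY]
    have : fderiv ℝ (fun y' : Coord n => y' j) z.1.2 = EuclideanSpace.proj j :=
      (EuclideanSpace.proj j : Coord n →L[ℝ] ℝ).fderiv
    rw [this]
    by_cases hij : i = j
    · subst hij; simp
    · simp [hij, Ne.symm hij]
  dy_a k i j := ext_eval fun z => by
    rw [← (Represents.of_contDiffOn (f := fun x _ => a x i j) (h.contDiffOn_a' i j)).dY k z,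
      dY, map_zero]
    simp
  dy_b k i := ext_eval fun z => by
    rw [← (Represents.of_contDiffOn (f := fun x _ => b x i) (h.contDiffOn_b' i)).dY k z,
      dY, map_zero]
    simp
  a_symm i j := ext_eval fun z => h.symm z.1.1 z.2.1 i j
  α_mul_αinv := ext_eval fun z => by
    rw [map_mul, map_one]
    exact mul_inv_cancel₀ (Real.sqrt_pos.2 (h.quad_pos _ z.2.1 _ z.2.2)).ne'
  α_sq := ext_eval fun z => by
    simp only [map_pow, map_sum, map_mul]
    exact Real.sq_sqrt (h.quad_pos _ z.2.1 _ z.2.2).le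

lemma represents_F : Represents L h.toAlgebra.F := fun z => by
  rw [h.eq z.1.1 z.2.1, RandersAlgebra.F, RandersAlgebra.β, map_add, map_sum]
  simp only [map_mul]
  rfl

lemma L_pos (z : slit U) : 0 < L z.1.1 z.1.2 := by
  rw [h.eq z.1.1 z.2.1]
  have := (_root_.abs_lt.1 (h.abs_lt z.1.1 z.2.1 z.1.2 z.2.2)).1
  linarith

lemma eval_αinv_sq (z : slit U) :
    eval z (h.toAlgebra.αinv) ^ 2 = (quad (a z.1.1) z.1.2)⁻¹ := by
  change (√(quad (a z.1.1) z.1.2))⁻¹ ^ 2 = _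
  rw [inv_pow, Real.sq_sqrt (h.quad_pos _ z.2.1 _ z.2.2).le]

lemma eval_αinv_pos (z : slit U) : 0 < eval z (h.toAlgebra.αinv) :=
  inv_pos.2 (Real.sqrt_pos.2 (h.quad_pos _ z.2.1 _ z.2.2))

lemma eval_m (z : slit U) (k : Fin n) :
    eval z (h.toAlgebra.m k) = lower (a z.1.1) z.1.2 k := by
  rw [RandersAlgebra.m, map_sum]
  exact Finset.sum_congr rfl fun j _ => by rw [map_mul]; rfl

lemma quad_fund (z : slit U) (u : Coord n) :
    quad (fun i j => fund L i j z.1.1 z.1.2) u =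
      L z.1.1 z.1.2 * eval z h.toAlgebra.αinv * (quad (a z.1.1) u -
        (quad (a z.1.1) z.1.2)⁻¹ * (∑ i, lower (a z.1.1) z.1.2 i * u i) ^ 2)
      + (∑ i, dY i L z.1.1 z.1.2 * u i) ^ 2 := by
  have hg : ∀ i j, fund L i j z.1.1 z.1.2 =
      L z.1.1 z.1.2 * eval z h.toAlgebra.αinv * (a z.1.1 i j - (quad (a z.1.1) z.1.2)⁻¹ *
        lower (a z.1.1) z.1.2 i * lower (a z.1.1) z.1.2 j)
        + dY i L z.1.1 z.1.2 * dY j L z.1.1 z.1.2 := by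
    intro i j
    rw [represents_fund h.represents_F i j z, h.represents_F.dY i z, h.represents_F.dY j z,
      h.represents_F z, ← h.eval_αinv_sq, ← h.eval_m, ← h.eval_m]
    have := congrArg (eval z) (h.toAlgebra.g_eq i j)
    simp only [RandersAlgebra.ang, map_add, map_mul, map_sub, map_pow] at this
    rw [map_mul]
    exact this
  have e1 : ∀ f : Fin n → ℝ, (∑ i, f i * u i) ^ 2 = ∑ i, ∑ j, f i * f j * u i * u j := by
    intro f
    rw [sq, Finset.sum_mul_sum]
    exact Finset.sum_congr rfl fun _ _ => Finset.sum_congr rfl fun _ _ => by ring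
  rw [e1, e1, quad, quad, Finset.mul_sum, ← Finset.sum_sub_distrib, Finset.mul_sum,
    ← Finset.sum_add_distrib]
  refine Finset.sum_congr rfl fun i _ => ?_
  rw [Finset.mul_sum, ← Finset.sum_sub_distrib, Finset.mul_sum, ← Finset.sum_add_distrib]
  refine Finset.sum_congr rfl fun j _ => ?_
  rw [hg]; ring

lemma euler (z : slit U) : ∑ k, z.1.2 k * dY k L z.1.1 z.1.2 = L z.1.1 z.1.2 := by
  have := congrArg (eval z) h.toAlgebra.euler_F
  rw [map_sum, ← h.represents_F z] at this
  rw [← this]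
  refine Finset.sum_congr rfl fun k _ => ?_
  rw [map_mul, h.represents_F.dY k z]
  rfl

lemma angular_nonneg (z : slit U) (u : Coord n) : 0 ≤ quad (a z.1.1) u -
    (quad (a z.1.1) z.1.2)⁻¹ * (∑ i, lower (a z.1.1) z.1.2 i * u i) ^ 2 := by
  have h1 := sq_lower_le (h.symm _ z.2.1) (h.quad_pos _ z.2.1) z.2.2 u
  have h2 := h.quad_pos _ z.2.1 _ z.2.2
  rw [sub_nonneg, inv_mul_le_iff₀ h2]
  exact h1

lemma angular_pos (z : slit U) {u : Coord n} (hu : LinearIndependent ℝ ![z.1.2, u]) :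
    0 < quad (a z.1.1) u -
      (quad (a z.1.1) z.1.2)⁻¹ * (∑ i, lower (a z.1.1) z.1.2 i * u i) ^ 2 := by
  have h1 := sq_lower_lt (h.symm _ z.2.1) (h.quad_pos _ z.2.1) hu
  have h2 := h.quad_pos _ z.2.1 _ z.2.2
  rw [sub_pos, inv_mul_lt_iff₀ h2]
  exact h1

/-- The form g_y is a positive multiple of the angular form plus (dF)². The first is positive off
the line of y, and the second is positive on that line by Euler's relation. -/
lemma quad_fund_pos (z : slit U) {u : Coord n} (hu : u ≠ 0) :
    0 < quad (fun i j => fund L i j z.1.1 z.1.2) u := by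
  rw [h.quad_fund]
  have hc := mul_pos (h.L_pos z) (h.eval_αinv_pos z)
  by_cases hi : LinearIndependent ℝ ![z.1.2, u]
  · have := mul_pos hc (h.angular_pos z hi)
    positivity
  · have h1 := mul_nonneg hc.le (h.angular_nonneg z u)
    rw [LinearIndependent.pair_iff' z.2.2] at hi
    push Not at hi
    obtain ⟨c, hc⟩ := hi
    have hc0 : c ≠ 0 := by rintro rfl; exact hu (by rw [← hc, zero_smul])
    have h2 : ∑ i, dY i L z.1.1 z.1.2 * u i = c * L z.1.1 z.1.2 := by
      rw [← h.euler z, Finset.mul_sum]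
      refine Finset.sum_congr rfl fun i _ => ?_
      rw [← hc, PiLp.smul_apply, smul_eq_mul]; ring
    have hcL : c * L z.1.1 z.1.2 ≠ 0 := mul_ne_zero hc0 (h.L_pos z).ne'
    have h3 : 0 < (c * L z.1.1 z.1.2) ^ 2 := by positivity
    rw [h2]
    linarith

lemma isLocalFinsler : IsLocalFinsler L (slit U) where
  contDiffOn := h.represents_F.contDiffOn
  pos z hz := h.L_pos ⟨z, hz⟩
  euler z hz := h.euler ⟨z, hz⟩
  det_ne_zero z hz hdet := by
    obtain ⟨v, hv, hv'⟩ := Matrix.exists_mulVec_eq_zero_iff.2 hdet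
    have hv0 : (WithLp.toLp 2 v : Coord n) ≠ 0 := fun h0 => hv (by
      have := congrArg (WithLp.ofLp) h0
      simpa using this)
    refine (h.quad_fund_pos ⟨z, hz⟩ hv0).ne' ?_
    rw [quad_eq_lower]
    refine Finset.sum_eq_zero fun i _ => ?_
    have : lower (fun i j => fund L i j z.1 z.2) (WithLp.toLp 2 v) i = 0 := congrFun hv' i
    rw [this, zero_mul]

/-- The (dF)² parts cancel and leave F³/α times the angular form, which is positive on independent
vectors. -/
lemma flag_denominator_ne_zero (z : Coord n × Coord n) (hz : z ∈ slit U) (u : Coord n)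
    (hu : LinearIndependent ℝ ![z.2, u]) :
    fundForm L z.1 z.2 z.2 z.2 * fundForm L z.1 z.2 u u - fundForm L z.1 z.2 z.2 u ^ 2 ≠ 0 := by
  have hF := h.isLocalFinsler
  have e1 := hF.fundForm_y_y ⟨z, hz⟩
  rw [hF.eval_E] at e1
  have e2 : fundForm L z.1 z.2 z.2 u = L z.1 z.2 * ∑ i, dY i L z.1 z.2 * u i := by
    have h1 := hF.fundForm_y_right ⟨z, hz⟩ u
    rw [hF.fundForm_symm ⟨z, hz⟩] at h1
    rw [h1, Finset.mul_sum]
    refine Finset.sum_congr rfl fun i _ => ?_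
    rw [FinslerAlgebra.p_eq_F_mul, map_mul, ← hF.rep_F ⟨z, hz⟩,
      ← IsLocalFinsler.rep_dY hF.rep_F i ⟨z, hz⟩]
    ring
  have e3 : fundForm L z.1 z.2 u u = quad (fun i j => fund L i j z.1 z.2) u := rfl
  have e4 := h.quad_fund ⟨z, hz⟩ u
  have hpos := h.angular_pos ⟨z, hz⟩ hu
  have hL := h.L_pos ⟨z, hz⟩
  have hc := h.eval_αinv_pos ⟨z, hz⟩
  simp only at e1 e4 hL hpos
  rw [e1, e2, e3, e4]
  refine ne_of_gt ?_
  have := mul_pos (mul_pos (pow_pos hL 3) hc) hpos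
  linarith

lemma meanCartan_eq (z : slit U) (k : Fin n) :
    2 * L z.1.1 z.1.2 * meanCartan L k z.1.1 z.1.2 = ((n : ℝ) + 1) * (b z.1.1 k -
      (∑ i, b z.1.1 i * z.1.2 i) * (quad (a z.1.1) z.1.2)⁻¹ * lower (a z.1.1) z.1.2 k) := by
  have hF := h.isLocalFinsler
  have h1 := RandersAlgebra.mean_cartan_eq (R := h.toAlgebra) (S := hF.toAlgebra)
    (fun _ => rfl) (fun _ => rfl) (ext_eval fun z => by
      rw [← hF.rep_F z, h.represents_F z]) k
  have h2 := congrArg (eval z) h1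
  simp only [map_mul, map_ofNat, map_add, map_natCast, map_one, ← h.represents_F z,
    ← hF.rep_I k z] at h2
  rw [h2, RandersAlgebra.D, map_sub, map_mul, map_mul, map_pow, h.eval_αinv_sq, h.eval_m,
    RandersAlgebra.β, map_sum]
  simp only [map_mul]
  rfl

lemma meanCartan_eq_zero (z : slit U) (hb : ∀ k, b z.1.1 k = 0) (k : Fin n) :
    meanCartan L k z.1.1 z.1.2 = 0 := by
  have := h.meanCartan_eq z k
  simp only [hb, zero_mul, Finset.sum_const_zero, sub_zero, mul_zero] at this
  exact (mul_eq_zero.1 this).resolve_left (mul_ne_zero two_ne_zero (h.L_pos z).ne')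

/-- If the mean Cartan tensor vanishes at two independent vectors, then `β` vanishes. -/
lemma b_eq_zero {x y y' : Coord n} (hx : x ∈ U) (hyy : LinearIndependent ℝ ![y, y'])
    (hI : ∀ k, meanCartan L k x y = 0) (hI' : ∀ k, meanCartan L k x y' = 0) (k : Fin n) :
    b x k = 0 := by
  have hn : (n : ℝ) + 1 ≠ 0 := by positivity
  have key : ∀ y : Coord n, y ≠ 0 → (∀ k, meanCartan L k x y = 0) →
      ∃ c : ℝ, ∀ k, b x k = c * lower (a x) y k := by
    intro y hy hI
    refine ⟨(∑ i, b x i * y i) * (quad (a x) y)⁻¹, fun k => ?_⟩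
    have := h.meanCartan_eq ⟨(x, y), hx, hy⟩ k
    rw [hI, mul_zero] at this
    exact sub_eq_zero.1 ((mul_eq_zero.1 this.symm).resolve_left hn)
  obtain ⟨c, hc⟩ := key y (hyy.ne_zero 0) hI
  obtain ⟨c', hc'⟩ := key y' (hyy.ne_zero 1) hI'
  -- Both c y and c' y' are dual to b, so they agree as a is nondegenerate; independence then gives
  -- c = 0.
  have h0 : c • y - c' • y' = 0 := by
    by_contra hne
    refine (h.quad_pos x hx _ hne).ne' ?_
    rw [quad_eq_lower]
    refine Finset.sum_eq_zero fun i _ => ?_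
    rw [lower_sub_smul, ← hc, ← hc', sub_self, zero_mul]
  rw [LinearIndependent.pair_iff] at hyy
  have := (hyy c (-c') (by rw [← h0]; module)).1
  rw [hc, this, zero_mul]

end IsLocalRanders

open Metric Set Filter Topology

/-! ### Local flows and linear differential equations -/

/-- A `C¹` vector field has a continuous local flow with values in a given neighbourhood. -/
lemma exists_local_flow {V : Type*} [NormedAddCommGroup V] [NormedSpace ℝ V] [CompleteSpace V]
    {f : V → V} {z₀ : V} (hf : ContDiffAt ℝ 1 f z₀) {O : Set V} (hO : O ∈ 𝓝 z₀) :
    ∃ δ > 0, ∃ φ : V × ℝ → V,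
      (∀ z ∈ ball z₀ δ, φ (z, 0) = z ∧ ∀ t ∈ Ioo (-δ) δ,
        HasDerivAt (fun s => φ (z, s)) (f (φ (z, t))) t ∧ φ (z, t) ∈ O) ∧
      ContinuousOn φ (ball z₀ δ ×ˢ Ioo (-δ) δ) := by
  obtain ⟨ε, hε, a, r, _, _, hr, hpl⟩ := IsPicardLindelof.of_contDiffAt_one hf
  obtain ⟨φ, h1, h2⟩ := (hpl 0).exists_forall_mem_closedBall_eq_hasDerivWithinAt_continuousOn
  simp only [zero_sub, zero_add] at h1 h2
  have hr' : (0 : ℝ) < r := hr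
  have hmem : closedBall z₀ (r : ℝ) ×ˢ Icc (-ε) ε ∈ 𝓝 (z₀, (0 : ℝ)) :=
    prod_mem_nhds (closedBall_mem_nhds _ hr') (Icc_mem_nhds (by linarith) hε)
  have hc := h2.continuousAt hmem
  -- Joint continuity at time zero keeps the flow inside O once times and initial points are both
  -- restricted.
  have hO' : φ ⁻¹' O ∈ 𝓝 (z₀, (0 : ℝ)) := hc.preimage_mem_nhds (by
    rw [(h1 z₀ (mem_closedBall_self hr'.le)).1]; exact hO)
  obtain ⟨δ₀, hδ₀, hsub⟩ := Metric.mem_nhds_iff.1 hO'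
  have hsub' : ∀ z t, z ∈ ball z₀ (min δ₀ (min r ε)) → t ∈ Ioo (-min δ₀ (min r ε)) (min δ₀ (min r ε)) →
      φ (z, t) ∈ O := by
    intro z t hz ht
    refine hsub ?_
    rw [← ball_prod_same, mem_prod]
    refine ⟨ball_subset_ball (min_le_left _ _) hz, ?_⟩
    rw [Real.ball_eq_Ioo]
    have := min_le_left δ₀ (min (r : ℝ) ε)
    constructor <;> simp only [zero_sub, zero_add] <;> linarith [ht.1, ht.2]
  have hδr : min δ₀ (min (r : ℝ) ε) ≤ r := (min_le_right _ _).trans (min_le_left _ _)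
  have hδε : min δ₀ (min (r : ℝ) ε) ≤ ε := (min_le_right _ _).trans (min_le_right _ _)
  have hball : ball z₀ (min δ₀ (min r ε)) ⊆ closedBall z₀ (r : ℝ) :=
    ball_subset_closedBall.trans (closedBall_subset_closedBall hδr)
  refine ⟨min δ₀ (min r ε), lt_min hδ₀ (lt_min hr' hε), φ, fun z hz => ⟨?_, fun t ht => ⟨?_, ?_⟩⟩,
    h2.mono (prod_mono hball fun t ht => ⟨by linarith [ht.1], by linarith [ht.2]⟩)⟩
  · exact (h1 z (hball hz)).1
  · refine ((h1 z (hball hz)).2 t ⟨by linarith [ht.1], by linarith [ht.2]⟩).hasDerivAt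
      (Icc_mem_nhds (by linarith [ht.1]) (by linarith [ht.2]))
  · exact hsub' z t hz ht

/-- Uniqueness for the linear equation `w_k' = N^m_k w_m`. -/
lemma eq_zero_of_linear_ode {n : ℕ} {s t : ℝ} {N : Fin n → Fin n → ℝ → ℝ}
    (hN : ∀ m k, ContinuousOn (N m k) (Icc s t)) {w : Fin n → ℝ → ℝ}
    (hw : ∀ k, ∀ r ∈ Icc s t, HasDerivAt (w k) (∑ m, N m k r * w m r) r)
    (h0 : ∀ k, w k s = 0) : ∀ r ∈ Icc s t, ∀ k, w k r = 0 := by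
  have hb : ∃ C : ℝ, 0 ≤ C ∧ ∀ m k, ∀ r ∈ Icc s t, |N m k r| ≤ C := by
    have : ∀ m k, ∃ C, ∀ r ∈ Icc s t, |N m k r| ≤ C := fun m k =>
      isCompact_Icc.exists_bound_of_continuousOn (hN m k)
    choose C hC using this
    refine ⟨∑ m, ∑ k, |C m k|, by positivity, fun m k r hr => (hC m k r hr).trans ?_⟩
    calc C m k ≤ |C m k| := le_abs_self _
      _ ≤ ∑ k, |C m k| := Finset.single_le_sum (f := fun k => |C m k|)
          (fun _ _ => abs_nonneg _) (Finset.mem_univ k)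
      _ ≤ _ := Finset.single_le_sum (f := fun m => ∑ k, |C m k|)
          (fun _ _ => by positivity) (Finset.mem_univ m)
  obtain ⟨C, hC0, hC⟩ := hb
  have hw' : ∀ r ∈ Icc s t, HasDerivAt (fun r k => w k r) (fun k => ∑ m, N m k r * w m r) r :=
    fun r hr => hasDerivAt_pi.2 fun k => hw k r hr
  -- Grönwall in the sup norm: each component of the derivative is a sum of n terms bounded by C‖w‖,
  -- hence the constant nC.
  have key := eq_zero_of_abs_deriv_le_mul_abs_self_of_eq_zero_right
    (f := fun r k => w k r) (K := n * C) (a := s) (b := t)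
    (fun r hr => (hw' r hr).continuousAt.continuousWithinAt)
    (fun r hr => (hw' r (Ico_subset_Icc_self hr)).hasDerivWithinAt) (funext h0) (by
      intro r hr
      rw [pi_norm_le_iff_of_nonneg (by positivity)]
      intro k
      calc ‖∑ m, N m k r * w m r‖ ≤ ∑ m : Fin n, C * ‖fun k => w k r‖ := by
            refine norm_sum_le_of_le _ fun m _ => ?_
            rw [norm_mul]
            exact mul_le_mul (hC m k r (Ico_subset_Icc_self hr))
              (norm_le_pi_norm (fun k => w k r) m) (norm_nonneg _) hC0
        _ = n * C * ‖fun k => w k r‖ := by simp; ring)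
  exact fun r hr k => congrFun (key r hr) k

/-! ### Geodesics -/

variable {n : ℕ} {Ω : TopologicalSpace.Opens (Coord n × Coord n)} {L : LocalFun n}

/-- The geodesic vector field. -/
def geoField (L : LocalFun n) (z : Coord n × Coord n) : Coord n × Coord n :=
  (z.2, WithLp.toLp 2 fun m => -2 * spray L m z.1 z.2)

lemma IsLocalFinsler.contDiffAt_geoField (h : IsLocalFinsler L Ω) {z : Coord n × Coord n}
    (hz : z ∈ Ω) : ContDiffAt ℝ 1 (geoField L) z := by
  have : ContDiffAt ℝ ∞ (geoField L) z := by
    refine contDiffAt_snd.prodMk ?_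
    rw [contDiffAt_euclidean]
    intro i
    exact contDiffAt_const.mul ((h.rep_G i).contDiffOn.contDiffAt (Ω.isOpen.mem_nhds hz))
  exact this.of_le (by exact WithTop.coe_le_coe.2 le_top)

/-- The chain rule: `geoDeriv` is the directional derivative along `geoField`, expanded in the
coordinate basis. -/
lemma Represents.hasDerivAt_geodesic {f : LocalFun n} {a : smoothAlgebra Ω}
    (hf : Represents f a) {γ : ℝ → Coord n × Coord n} {t : ℝ} (ht : γ t ∈ Ω)
    (hγ : HasDerivAt γ (geoField L (γ t)) t) :
    HasDerivAt (fun s => f (γ s).1 (γ s).2) (geoDeriv L f (γ t).1 (γ t).2) t := by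
  have h1 := (hf.differentiableAt ⟨γ t, ht⟩).hasFDerivAt.comp_hasDerivAt t hγ
  refine h1.congr_deriv ?_
  set D := fderiv ℝ (fun z : Coord n × Coord n => f z.1 z.2) (γ t) with hD
  have hX : ∀ k, Finsler.dX k f (γ t).1 (γ t).2 = D (EuclideanSpace.single k 1, 0) := fun k => by
    rw [hf.dX k ⟨γ t, ht⟩, eval_deriv (F := fun z : Coord n × Coord n => f z.1 z.2) hf]
  have hY : ∀ k, Finsler.dY k f (γ t).1 (γ t).2 = D (0, EuclideanSpace.single k 1) := fun k => by
    rw [hf.dY k ⟨γ t, ht⟩, eval_deriv (F := fun z : Coord n × Coord n => f z.1 z.2) hf]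
  have hsum : ∀ u : Coord n, u = ∑ k, u k • EuclideanSpace.single k (1 : ℝ) := fun u => by
    ext i; simp [Finset.sum_apply, Pi.single_apply]
  have hdec : ∀ u v : Coord n, D (u, v) = ∑ k, u k * D (EuclideanSpace.single k 1, 0)
      + ∑ k, v k * D (0, EuclideanSpace.single k 1) := by
    intro u v
    have h2 : D (u, 0) = ∑ k, u k * D (EuclideanSpace.single k 1, 0) := by
      have := congrArg (fun u => D (ContinuousLinearMap.inl ℝ _ _ u)) (hsum u)
      simpa only [map_sum, map_smul, smul_eq_mul, ContinuousLinearMap.inl_apply] using this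
    have h3 : D (0, v) = ∑ k, v k * D (0, EuclideanSpace.single k 1) := by
      have := congrArg (fun u => D (ContinuousLinearMap.inr ℝ _ _ u)) (hsum v)
      simpa only [map_sum, map_smul, smul_eq_mul, ContinuousLinearMap.inr_apply] using this
    rw [← h2, ← h3, ← map_add]; simp
  change D (geoField L (γ t)) = _
  rw [geoField, hdec, geoDeriv]
  simp only [hX, hY, Finset.mul_sum, sub_eq_add_neg, ← Finset.sum_neg_distrib]
  congr 1
  exact Finset.sum_congr rfl fun _ _ => by ring

/-- If the mean Cartan tensor satisfies `D_X D_X I = 0`, then its Cauchy data vanish along a geodesic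
if they vanish at one point. -/
lemma IsLocalFinsler.meanCartan_eq_zero_along_geodesic (h : IsLocalFinsler L Ω)
    (hJ : ∀ z : Ω, ∀ k, geoCovDeriv L (meanLandsberg L) k z.1.1 z.1.2 = 0)
    {γ : ℝ → Coord n × Coord n} {s t : ℝ} (hst : s ≤ t) (hΩ : ∀ r ∈ Icc s t, γ r ∈ Ω)
    (hγ : ∀ r ∈ Icc s t, HasDerivAt γ (geoField L (γ r)) r)
    (hI0 : ∀ k, meanCartan L k (γ s).1 (γ s).2 = 0)
    (hJ0 : ∀ k, meanLandsberg L k (γ s).1 (γ s).2 = 0) (k : Fin n) :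
    meanCartan L k (γ t).1 (γ t).2 = 0 := by
  have hN : ∀ m k, ContinuousOn (fun r => nonlinConn L m k (γ r).1 (γ r).2) (Icc s t) :=
    fun m k => (h.rep_N m k).contDiffOn.continuousOn.comp
      (fun r hr => (hγ r hr).continuousAt.continuousWithinAt) hΩ
  -- The second order equation is a triangular system: J solves a homogeneous linear equation, so it
  -- vanishes, and then I solves the same equation.
  have h1 := eq_zero_of_linear_ode (w := fun k r => meanLandsberg L k (γ r).1 (γ r).2) hN
    (fun k r hr => by
      refine ((h.rep_meanLandsberg k).hasDerivAt_geodesic (hΩ r hr) (hγ r hr)).congr_deriv ?_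
      exact sub_eq_zero.1 (hJ ⟨γ r, hΩ r hr⟩ k)) hJ0
  have h2 := eq_zero_of_linear_ode (w := fun k r => meanCartan L k (γ r).1 (γ r).2) hN
    (fun k r hr => by
      refine ((h.rep_I k).hasDerivAt_geodesic (hΩ r hr) (hγ r hr)).congr_deriv ?_
      exact sub_eq_zero.1 (h1 r hr k)) hI0
  exact h2 t ⟨hst, le_rfl⟩ k

lemma exists_independent {n : ℕ} (hn : 2 ≤ n) {y : Coord n} (hy : y ≠ 0) :
    ∃ u : Coord n, LinearIndependent ℝ ![y, u] := by
  by_contra hc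
  push Not at hc
  have hle : Module.finrank ℝ (Coord n) ≤ 1 := by
    refine finrank_le_one y fun u => ?_
    have := hc u
    rw [LinearIndependent.pair_iff' hy] at this
    push Not at this
    exact this
  rw [finrank_euclideanSpace_fin] at hle
  omega

lemma linearIndependent_add_smul {V : Type*} [AddCommGroup V] [Module ℝ V] {y u : V}
    (h : LinearIndependent ℝ ![y, u]) {s : ℝ} (hs : s ≠ 0) :
    LinearIndependent ℝ ![y, y + s • u] := by
  rw [LinearIndependent.pair_iff] at h ⊢
  intro c d hcd
  have := h (c + d) (d * s) (by rw [← hcd]; module)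
  have hd : d = 0 := (mul_eq_zero.1 this.2).resolve_right hs
  refine ⟨?_, hd⟩
  have := this.1
  rw [hd] at this
  simpa using this

/-! ### Flatness where β ≠ 0 and unique continuation -/

namespace IsLocalRanders

variable {n : ℕ} {a : Coord n → Fin n → Fin n → ℝ} {b : Coord n → Fin n → ℝ} {L : LocalFun n}
  {U : TopologicalSpace.Opens (Coord n)} (h : IsLocalRanders a b L U)

include h

lemma continuousAt_riemann {x y : Coord n} (hx : x ∈ U) (hy : y ≠ 0) (i k : Fin n) :
    ContinuousAt (fun z : Coord n × Coord n => riemann L i k z.1 z.2) (x, y) :=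
  (h.isLocalFinsler.rep_Riem i k).contDiffOn.continuousOn.continuousAt
    ((slit U).isOpen.mem_nhds ⟨hx, hy⟩)

/-- The curvature vanishes over the points where `β ≠ 0` if `K I = 0`. -/
lemma riemann_eq_zero_of_b_ne_zero (hn : 2 ≤ n) {K : LocalFun n}
    (hK : ∀ z ∈ slit U, ∀ u, LinearIndependent ℝ ![z.2, u] →
      flagCurvature L z.1 z.2 u = K z.1 z.2)
    (hs : ∀ z ∈ slit U, ∀ i j, frakR L i j z.1 z.2 = frakR L j i z.1 z.2)
    {x : Coord n} (hx : x ∈ U) (hb : b x ≠ 0) {y : Coord n} (hy : y ≠ 0) (i k : Fin n) :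
    riemann L i k x y = 0 := by
  have hF := h.isLocalFinsler
  have key : ∀ y : Coord n, y ≠ 0 → (∃ j, meanCartan L j x y ≠ 0) → riemann L i k x y = 0 := by
    rintro y hy ⟨j, hj⟩
    have hz : (x, y) ∈ slit U := ⟨hx, hy⟩
    refine hF.riemann_eq_zero_of_K_eq_zero (fun z hz => hz.2) h.flag_denominator_ne_zero hK
      ⟨(x, y), hz⟩ ?_ i k
    exact (mul_eq_zero.1 (hF.K_mul_meanCartan (fun z hz => hz.2) h.flag_denominator_ne_zero hK hn
      ⟨(x, y), hz⟩ (hs _ hz) j)).resolve_right hj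
  by_cases hI : ∃ j, meanCartan L j x y ≠ 0
  · exact key y hy hI
  push Not at hI
  -- The exceptional direction, where I = 0, is approached by y + s u. There I ≠ 0, as two
  -- independent zeros of I would force β = 0 at x.
  obtain ⟨u, hu⟩ := exists_independent hn hy
  have hzero : ∀ s : ℝ, s ≠ 0 → riemann L i k x (y + s • u) = 0 := by
    intro s hs0
    have hli := linearIndependent_add_smul hu hs0
    refine key _ (hli.ne_zero 1) ?_
    by_contra hc
    push Not at hc
    exact hb (funext (h.b_eq_zero hx hli hI hc))
  have hc : Tendsto (fun s : ℝ => riemann L i k x (y + s • u)) (𝓝[≠] 0) (𝓝 (riemann L i k x y)) := by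
    have h1 : ContinuousAt (fun s : ℝ => (x, y + s • u)) 0 := by fun_prop
    have h2 : ContinuousAt (fun s : ℝ => riemann L i k x (y + s • u)) 0 :=
      ContinuousAt.comp (f := fun s : ℝ => (x, y + s • u))
        (g := fun z : Coord n × Coord n => riemann L i k z.1 z.2)
        (by simpa using h.continuousAt_riemann hx hy i k) h1
    have h3 := h2.tendsto.mono_left (nhdsWithin_le_nhds (s := {0}ᶜ))
    simpa using h3
  refine tendsto_nhds_unique hc (tendsto_const_nhds.congr' ?_)
  filter_upwards [self_mem_nhdsWithin] with s hs0
  exact (hzero s hs0).symm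

lemma continuousOn_b : ContinuousOn b U :=
  continuousOn_pi.2 fun i => (h.contDiffOn_b i).continuousOn

/-- The set where `β ≠ 0`. -/
def support : TopologicalSpace.Opens (Coord n) :=
  ⟨U ∩ b ⁻¹' {0}ᶜ, h.continuousOn_b.isOpen_inter_preimage U.isOpen isOpen_compl_singleton⟩

omit h in
/-- The interior of the set where `β = 0`. -/
def zeroInterior (b : Coord n → Fin n → ℝ) (U : TopologicalSpace.Opens (Coord n)) :
    TopologicalSpace.Opens (Coord n) :=
  ⟨interior {x | x ∈ U ∧ b x = 0}, isOpen_interior⟩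

omit h in
lemma mem_of_mem_zeroInterior {x : Coord n} (hx : x ∈ zeroInterior b U) : x ∈ U ∧ b x = 0 :=
  interior_subset (s := {x | x ∈ U ∧ b x = 0}) hx

lemma frequently_support {x : Coord n} (hx : x ∈ U) (hx' : x ∉ zeroInterior b U) :
    ∃ᶠ q in 𝓝 x, q ∈ h.support := by
  intro hev
  refine hx' (mem_interior_iff_mem_nhds.2 ?_)
  filter_upwards [hev, U.isOpen.mem_nhds hx] with q hq hqU
  refine ⟨hqU, ?_⟩
  by_contra hb
  exact hq ⟨hqU, hb⟩

variable (hR : ∀ x ∈ U, b x ≠ 0 → ∀ y : Coord n, y ≠ 0 → ∀ i k, riemann L i k x y = 0)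

include hR

/-- Over {β ≠ 0} the curvature vanishes, and over the interior of {β = 0} the tensor I does. These
two open sets are dense together, and the left side is continuous. -/
lemma geoCovDeriv_meanLandsberg_eq_zero (z : slit U) (k : Fin n) :
    geoCovDeriv L (meanLandsberg L) k z.1.1 z.1.2 = 0 := by
  obtain ⟨⟨x, y⟩, hx, hy⟩ := z
  have hF := h.isLocalFinsler
  have hW : ∀ x ∈ zeroInterior b U, geoCovDeriv L (meanLandsberg L) k x y = 0 := by
    intro x hx
    have hU : zeroInterior b U ≤ U := fun x hx => (mem_of_mem_zeroInterior hx).1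
    exact ((hF.mono (slit_mono hU)).meanLandsberg_of_meanCartan_eq_zero
      (fun z k => h.meanCartan_eq_zero ⟨z.1, slit_mono hU z.2⟩
        (fun k => congrFun (mem_of_mem_zeroInterior z.2.1).2 k) k) ⟨(x, y), hx, hy⟩ k).2
  have hV : ∀ x ∈ h.support, geoCovDeriv L (meanLandsberg L) k x y = 0 := by
    intro x hx
    have hU : h.support ≤ U := fun x hx => hx.1
    exact (hF.mono (slit_mono hU)).geoCovDeriv_meanLandsberg_of_flat
      (fun z i k => hR z.1.1 z.2.1.1 z.2.1.2 z.1.2 z.2.2 i k) ⟨(x, y), hx, hy⟩ k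
  by_cases hxW : x ∈ zeroInterior b U
  · exact hW x hxW
  have hc : ContinuousAt (fun x' => geoCovDeriv L (meanLandsberg L) k x' y) x := by
    have h1 : ContinuousAt (fun z : Coord n × Coord n =>
        geoCovDeriv L (meanLandsberg L) k z.1 z.2) (x, y) :=
      (hF.rep_geoCovDeriv hF.rep_meanLandsberg k).contDiffOn.continuousOn.continuousAt
        ((slit U).isOpen.mem_nhds ⟨hx, hy⟩)
    exact ContinuousAt.comp (f := fun x' : Coord n => (x', y))
      (g := fun z : Coord n × Coord n => geoCovDeriv L (meanLandsberg L) k z.1 z.2) h1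
      (by fun_prop)
  exact isClosed_singleton.mem_of_frequently_of_tendsto
    ((h.frequently_support hx hxW).mono hV) hc

/-- If a geodesic starts at a point near which `β = 0`, then `I = 0` along the geodesic. -/
lemma meanCartan_eq_zero_of_geodesic {γ : ℝ → Coord n × Coord n} {s t : ℝ} (hst : s ≤ t)
    (hΩ : ∀ r ∈ Icc s t, γ r ∈ slit U)
    (hγ : ∀ r ∈ Icc s t, HasDerivAt γ (geoField L (γ r)) r)
    (hs : (γ s).1 ∈ zeroInterior b U) (k : Fin n) :
    meanCartan L k (γ t).1 (γ t).2 = 0 := by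
  have hF := h.isLocalFinsler
  have hU : zeroInterior b U ≤ U := fun x hx => (mem_of_mem_zeroInterior hx).1
  have hI : ∀ z : slit (zeroInterior b U), ∀ k, meanCartan L k z.1.1 z.1.2 = 0 := fun z k =>
    h.meanCartan_eq_zero ⟨z.1, slit_mono hU z.2⟩
      (fun k => congrFun (mem_of_mem_zeroInterior z.2.1).2 k) k
  have hmem : γ s ∈ slit (zeroInterior b U) := ⟨hs, (hΩ s ⟨le_rfl, hst⟩).2⟩
  exact hF.meanCartan_eq_zero_along_geodesic (h.geoCovDeriv_meanLandsberg_eq_zero hR) hst hΩ hγ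
    (hI ⟨_, hmem⟩) (fun k => ((hF.mono (slit_mono hU)).meanLandsberg_of_meanCartan_eq_zero hI
      ⟨_, hmem⟩ k).1) k

/-- Unique continuation: a Randers metric whose curvature vanishes where `β ≠ 0` cannot change from
`β = 0` to `β ≠ 0`. -/
lemma mem_zeroInterior_of_mem_closure (hn : 2 ≤ n) {p : Coord n} (hp : p ∈ U)
    (hpc : p ∈ closure (zeroInterior b U : Set (Coord n))) : p ∈ zeroInterior b U := by
  by_contra hpW
  set W := zeroInterior b U with hWdef
  obtain ⟨r, hr, hrU⟩ := Metric.isOpen_iff.1 U.isOpen p hp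
  -- The radius r/2 keeps the nearest point q₀ of the complement in U: q₀ is no farther from x₀ than
  -- p is, so it lies within r of p.
  obtain ⟨x₀, hx₀W, hx₀⟩ := Metric.mem_closure_iff.1 hpc (r / 2) (by linarith)
  obtain ⟨q₀, hq₀W, hq₀⟩ := W.isOpen.isClosed_compl.exists_infDist_eq_dist ⟨p, hpW⟩ x₀
  have hq₀p : dist x₀ q₀ ≤ dist x₀ p := by
    rw [← hq₀]; exact infDist_le_dist_of_mem hpW
  have hq₀U : q₀ ∈ U := hrU (by
    rw [mem_ball]
    have := dist_triangle q₀ x₀ p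
    rw [dist_comm q₀ x₀] at this
    rw [dist_comm p x₀] at hx₀
    linarith)
  -- W contains a ball touching its complement at q₀, so q₀ - x₀ is an outward normal; no regularity
  -- of the boundary of W is needed.
  have hballW : ball x₀ (dist x₀ q₀) ⊆ W := by
    intro x hx
    by_contra hxW
    have := infDist_le_dist_of_mem (x := x₀) (show x ∈ (W : Set (Coord n))ᶜ from hxW)
    rw [mem_ball, dist_comm] at hx
    linarith
  have hne : q₀ - x₀ ≠ 0 := by
    intro h0
    rw [sub_eq_zero] at h0
    exact hq₀W (h0 ▸ hx₀W)
  have hF := h.isLocalFinsler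
  have hz₀ : (q₀, q₀ - x₀) ∈ slit U := ⟨hq₀U, hne⟩
  obtain ⟨δ, hδ, φ, hφ, hφc⟩ := exists_local_flow (hF.contDiffAt_geoField hz₀)
    ((slit U).isOpen.mem_nhds hz₀)
  -- the geodesic through `(q₀, q₀ - x₀)` comes from `W`
  obtain ⟨τ, hτ0, hτδ, hτW⟩ : ∃ τ, 0 < τ ∧ τ < δ ∧ (φ ((q₀, q₀ - x₀), -τ)).1 ∈ W := by
    have h0 := hφ _ (mem_ball_self hδ)
    have hd := (h0.2 0 ⟨by linarith, hδ⟩).1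
    rw [h0.1] at hd
    have hd1 : HasDerivAt (fun s => (φ ((q₀, q₀ - x₀), s)).1) (q₀ - x₀) 0 :=
      (ContinuousLinearMap.fst ℝ (Coord n) (Coord n)).hasFDerivAt.comp_hasDerivAt (0 : ℝ) hd
    have hd2 := hasDerivAt_iff_isLittleO.1 hd1
    simp only [h0.1, sub_zero] at hd2
    have hρ : 0 < ‖q₀ - x₀‖ := norm_pos_iff.2 hne
    -- With an error of at most half the speed, moving back by time τ ≤ 1 shortens the distance to
    -- x₀ by at least τ‖q₀ - x₀‖/2, hence enters the ball.
    have hev := hd2.def (c := ‖q₀ - x₀‖ / 2) (by linarith)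
    obtain ⟨ε, hε, hball⟩ := Metric.mem_nhds_iff.1 hev
    have hmin : 0 < min (min ε δ) 1 := lt_min (lt_min hε hδ) one_pos
    have hτε : min (min ε δ) 1 / 2 < ε :=
      (half_lt_self hmin).trans_le ((min_le_left _ _).trans (min_le_left _ _))
    have hτδ : min (min ε δ) 1 / 2 < δ :=
      (half_lt_self hmin).trans_le ((min_le_left _ _).trans (min_le_right _ _))
    have hτ1 : min (min ε δ) 1 / 2 < 1 := (half_lt_self hmin).trans_le (min_le_right _ _)
    set τ := min (min ε δ) 1 / 2 with hτ
    have hτ0 : 0 < τ := half_pos hmin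
    refine ⟨τ, hτ0, hτδ, hballW ?_⟩
    have hm := hball (show -τ ∈ ball (0 : ℝ) ε by
      rw [mem_ball, dist_zero_right, norm_neg, Real.norm_of_nonneg hτ0.le]; exact hτε)
    simp only [mem_ofPred_eq, norm_neg, Real.norm_of_nonneg hτ0.le] at hm
    rw [mem_ball, dist_eq_norm, dist_comm, dist_eq_norm]
    have e : (φ ((q₀, q₀ - x₀), -τ)).1 - x₀ =
        ((φ ((q₀, q₀ - x₀), -τ)).1 - q₀ - -τ • (q₀ - x₀)) + (1 - τ) • (q₀ - x₀) := by module
    rw [e]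
    calc _ ≤ ‖q₀ - x₀‖ / 2 * τ + (1 - τ) * ‖q₀ - x₀‖ := by
          refine (norm_add_le _ _).trans (add_le_add hm ?_)
          rw [norm_smul, Real.norm_of_nonneg (by linarith)]
      _ < ‖q₀ - x₀‖ := by nlinarith [mul_pos hρ hτ0]
  -- so do nearby geodesics
  have hopen : ∀ᶠ z in 𝓝 (q₀, q₀ - x₀), (φ (z, -τ)).1 ∈ W := by
    have hm : (-τ) ∈ Ioo (-δ) δ := ⟨by linarith, by linarith⟩
    have h1 : ContinuousAt φ ((q₀, q₀ - x₀), -τ) :=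
      hφc.continuousAt (prod_mem_nhds (ball_mem_nhds _ hδ) (isOpen_Ioo.mem_nhds hm))
    have h2 : ContinuousAt (fun z => (φ (z, -τ)).1) (q₀, q₀ - x₀) :=
      ContinuousAt.comp (g := Prod.fst) continuousAt_fst
        (ContinuousAt.comp (f := fun z => (z, -τ)) h1 (by fun_prop))
    exact h2.eventually (W.isOpen.mem_nhds hτW)
  have hI : ∀ᶠ z in 𝓝 (q₀, q₀ - x₀), ∀ k, meanCartan L k z.1 z.2 = 0 := by
    filter_upwards [hopen, ball_mem_nhds _ hδ] with z hzW hz k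
    have h0 := hφ z hz
    have hsub : ∀ r ∈ Icc (-τ) 0, r ∈ Ioo (-δ) δ := fun r hr => ⟨by linarith [hr.1],
      by linarith [hr.2]⟩
    have := h.meanCartan_eq_zero_of_geodesic hR (γ := fun s => φ (z, s)) (s := -τ) (t := 0)
      (by linarith) (fun r hr => (h0.2 r (hsub r hr)).2) (fun r hr => (h0.2 r (hsub r hr)).1) hzW k
    simpa only [h0.1] using this
  rw [nhds_prod_eq] at hI
  obtain ⟨P, hP, Q, hQ, hPQ⟩ := eventually_prod_iff.1 hI
  -- I vanishes on a neighbourhood in position and velocity. So one base point with β ≠ 0 carries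
  -- two independent vectors where I = 0, which is absurd.
  obtain ⟨q, hqs, hqP⟩ := ((h.frequently_support hq₀U hq₀W).and_eventually hP).exists
  obtain ⟨u, hu⟩ := exists_independent hn hne
  have hsQ : ∀ᶠ s : ℝ in 𝓝[≠] 0, Q (q₀ - x₀ + s • u) := by
    have h1 : ContinuousAt (fun s : ℝ => q₀ - x₀ + s • u) 0 := by fun_prop
    have h2 : Tendsto (fun s : ℝ => q₀ - x₀ + s • u) (𝓝[≠] 0) (𝓝 (q₀ - x₀)) := by
      have := h1.tendsto.mono_left (nhdsWithin_le_nhds (s := {0}ᶜ))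
      simpa using this
    exact h2.eventually hQ
  obtain ⟨s, hs, hs0⟩ := (hsQ.and self_mem_nhdsWithin).exists
  refine hqs.2 (funext (h.b_eq_zero hqs.1 (linearIndependent_add_smul hu hs0) ?_ ?_))
  · exact hPQ hqP hQ.self_of_nhds
  · exact hPQ hqP hs

/-- If `β` does not vanish on any open set, then the curvature vanishes everywhere. -/
lemma riemann_eq_zero_of_dense (hd : ∀ x ∈ U, x ∉ zeroInterior b U) {x : Coord n} (hx : x ∈ U)
    {y : Coord n} (hy : y ≠ 0) (i k : Fin n) : riemann L i k x y = 0 := by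
  have hc : ContinuousAt (fun x' => riemann L i k x' y) x :=
    ContinuousAt.comp (f := fun x' : Coord n => (x', y))
      (g := fun z : Coord n × Coord n => riemann L i k z.1 z.2) (h.continuousAt_riemann hx hy i k)
      (by fun_prop)
  exact isClosed_singleton.mem_of_frequently_of_tendsto
    ((h.frequently_support hx (hd x hx)).mono fun q hq => hR q hq.1 hq.2 y hy i k) hc

end IsLocalRanders

/-! ### Randers metrics in charts -/

section Charts

variable {n : ℕ} {M : Type*} [TopologicalSpace M] [ChartedSpace (Coord n) M]
  [IsManifold (𝓡 n) ∞ M] {e : OpenPartialHomeomorph M (Coord n)}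

omit [IsManifold (𝓡 n) ∞ M] in
lemma mdifferentiable_of_mem_maximalAtlas (he : e ∈ IsManifold.maximalAtlas (𝓡 n) ∞ M) :
    e.MDifferentiable (𝓡 n) (𝓡 n) :=
  ⟨(contMDiffOn_of_mem_maximalAtlas he).mdifferentiableOn (by simp),
    (contMDiffOn_symm_of_mem_maximalAtlas he).mdifferentiableOn (by simp)⟩

omit [IsManifold (𝓡 n) ∞ M] in
lemma bijective_mfderiv_symm (he : e ∈ IsManifold.maximalAtlas (𝓡 n) ∞ M) {x : Coord n}
    (hx : x ∈ e.target) : Function.Bijective (mfderiv (𝓡 n) (𝓡 n) e.symm x) :=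
  (mdifferentiable_of_mem_maximalAtlas he).symm.mfderiv_bijective hx

/-- A coordinate vector field of a chart is smooth. -/
lemma contMDiffOn_mfderiv_symm (he : e ∈ IsManifold.maximalAtlas (𝓡 n) ∞ M) (v : Coord n) :
    ContMDiffOn (𝓡 n) (𝓡 n).tangent ∞
      (fun x => (Bundle.TotalSpace.mk' (Coord n) (e.symm x) (mfderiv (𝓡 n) (𝓡 n) e.symm x v) :
        TangentBundle (𝓡 n) M)) e.target := by
  have h1 := (contMDiffOn_symm_of_mem_maximalAtlas he).contMDiffOn_tangentMapWithin (m := ∞)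
    (by simp) e.open_target.uniqueMDiffOn
  have h2 : ContMDiffOn (𝓡 n) (𝓡 n).tangent ∞
      (fun x : Coord n => (Bundle.TotalSpace.mk' (Coord n) x v : TangentBundle (𝓡 n) (Coord n)))
      e.target := by
    intro x hx
    exact contMDiffWithinAt_vectorSpace_iff_contDiffWithinAt.2 contDiffWithinAt_const
  refine (h1.comp h2 fun x hx => hx).congr fun x hx => ?_
  simp only [Function.comp, tangentMapWithin]
  rw [mfderivWithin_of_isOpen e.open_target hx]

variable (a : RiemMetric n M) (b : OneForm n M)

variable (e) in
/-- The components `a_{ij}` of a Riemannian metric in a chart. -/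
def metricCoeff (x : Coord n) (i j : Fin n) : ℝ :=
  a.inner (e.symm x) (mfderiv (𝓡 n) (𝓡 n) e.symm x (EuclideanSpace.single i 1))
    (mfderiv (𝓡 n) (𝓡 n) e.symm x (EuclideanSpace.single j 1))

variable (e) in
/-- The components `b_i` of a `1`-form in a chart. -/
def formCoeff (x : Coord n) (i : Fin n) : ℝ :=
  b (e.symm x) (mfderiv (𝓡 n) (𝓡 n) e.symm x (EuclideanSpace.single i 1))

lemma contDiffOn_metricCoeff (he : e ∈ IsManifold.maximalAtlas (𝓡 n) ∞ M) (i j : Fin n) :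
    ContDiffOn ℝ ∞ (fun x => metricCoeff e a x i j) e.target := by
  rw [← contMDiffOn_iff_contDiffOn]
  intro x hx
  have : ContMDiffWithinAt (𝓡 n) ((𝓡 n).prod 𝓘(ℝ)) ∞
      (fun x => Bundle.TotalSpace.mk' ℝ (E := Bundle.Trivial M ℝ) (e.symm x) (metricCoeff e a x i j))
      e.target x := by
    apply ContMDiffWithinAt.clm_bundle_apply₂ (F₁ := Coord n) (F₂ := Coord n)
    · exact ContMDiffAt.comp_contMDiffWithinAt x a.contMDiff.contMDiffAt
        (contMDiffOn_symm_of_mem_maximalAtlas he x hx)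
    · exact contMDiffOn_mfderiv_symm he _ x hx
    · exact contMDiffOn_mfderiv_symm he _ x hx
  simp only [Bundle.contMDiffWithinAt_totalSpace] at this
  exact this.2

lemma contDiffOn_formCoeff (he : e ∈ IsManifold.maximalAtlas (𝓡 n) ∞ M) (i : Fin n) :
    ContDiffOn ℝ ∞ (fun x => formCoeff e b x i) e.target := by
  rw [← contMDiffOn_iff_contDiffOn]
  intro x hx
  have : ContMDiffWithinAt (𝓡 n) ((𝓡 n).prod 𝓘(ℝ)) ∞
      (fun x => Bundle.TotalSpace.mk' ℝ (E := Bundle.Trivial M ℝ) (e.symm x) (formCoeff e b x i))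
      e.target x := by
    apply ContMDiffWithinAt.clm_bundle_apply (F₁ := Coord n)
    · exact ContMDiffAt.comp_contMDiffWithinAt x b.contMDiff.contMDiffAt
        (contMDiffOn_symm_of_mem_maximalAtlas he x hx)
    · exact contMDiffOn_mfderiv_symm he _ x hx
  simp only [Bundle.contMDiffWithinAt_totalSpace] at this
  exact this.2

omit [IsManifold (𝓡 n) ∞ M] in
lemma mfderiv_symm_eq_sum (x y : Coord n) : mfderiv (𝓡 n) (𝓡 n) e.symm x y =
    ∑ i, y i • mfderiv (𝓡 n) (𝓡 n) e.symm x (EuclideanSpace.single i (1 : ℝ)) := by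
  have hsum : y = ∑ k, y k • EuclideanSpace.single k (1 : ℝ) := by
    ext i; simp [Finset.sum_apply, Pi.single_apply]
  have h := congrArg (mfderiv (𝓡 n) (𝓡 n) e.symm x) hsum
  refine h.trans ?_
  exact (map_sum _ _ _).trans (Finset.sum_congr rfl fun k _ => map_smul _ _ _)

lemma quad_metricCoeff (x y : Coord n) : quad (metricCoeff e a x) y =
    a.inner (e.symm x) (mfderiv (𝓡 n) (𝓡 n) e.symm x y) (mfderiv (𝓡 n) (𝓡 n) e.symm x y) := by
  rw [mfderiv_symm_eq_sum, quad]
  simp only [map_sum, sum_apply, map_smul, smul_apply,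
    smul_eq_mul, Finset.mul_sum]
  rw [Finset.sum_comm]
  refine Finset.sum_congr rfl fun i _ => Finset.sum_congr rfl fun j _ => ?_
  rw [metricCoeff]; ring

lemma sum_formCoeff (x y : Coord n) : ∑ i, formCoeff e b x i * y i =
    b (e.symm x) (mfderiv (𝓡 n) (𝓡 n) e.symm x y) := by
  rw [mfderiv_symm_eq_sum]
  simp only [map_sum, map_smul, smul_eq_mul]
  exact Finset.sum_congr rfl fun i _ => by rw [formCoeff, mul_comm]

variable {a b}

lemma isLocalRanders_inChart (hab : IsRanders a b)
    (he : e ∈ IsManifold.maximalAtlas (𝓡 n) ∞ M) :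
    IsLocalRanders (metricCoeff e a) (formCoeff e b) (inChart (randers a b) e)
      ⟨e.target, e.open_target⟩ where
  contDiffOn_a := contDiffOn_metricCoeff a he
  contDiffOn_b := contDiffOn_formCoeff b he
  symm x _ i j := a.symm _ _ _
  quad_pos x hx y hy := by
    rw [quad_metricCoeff]
    refine a.pos _ _ fun h0 => hy ((bijective_mfderiv_symm he hx).1 ?_)
    exact h0.trans (map_zero _).symm
  abs_lt x hx y hy := by
    rw [quad_metricCoeff, sum_formCoeff]
    refine hab ⟨e.symm x, mfderiv (𝓡 n) (𝓡 n) e.symm x y⟩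
      fun h0 => hy ((bijective_mfderiv_symm he hx).1 ?_)
    exact h0.trans (map_zero _).symm
  eq x _ y := by
    rw [quad_metricCoeff, sum_formCoeff]
    rfl

lemma formCoeff_eq_zero_iff (he : e ∈ IsManifold.maximalAtlas (𝓡 n) ∞ M) {x : Coord n}
    (hx : x ∈ e.target) : formCoeff e b x = 0 ↔ b (e.symm x) = 0 := by
  constructor
  · intro h0
    ext w
    obtain ⟨y, rfl⟩ := (bijective_mfderiv_symm he hx).2 w
    refine (sum_formCoeff b x y).symm.trans ?_
    simp [h0]
  · intro h0
    ext i
    rw [formCoeff, h0]; rfl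

/-- Charts are local homeomorphisms and their differentials are bijective, so the local sets glue to
one subset of M, to which connectedness applies. -/
lemma mem_zeroInterior_iff (he : e ∈ IsManifold.maximalAtlas (𝓡 n) ∞ M) {x : Coord n}
    (hx : x ∈ e.target) :
    x ∈ IsLocalRanders.zeroInterior (formCoeff e b) ⟨e.target, e.open_target⟩ ↔
      e.symm x ∈ interior {m | b m = 0} := by
  have h1 : x ∈ IsLocalRanders.zeroInterior (formCoeff e b) ⟨e.target, e.open_target⟩ ↔
      ∀ᶠ x' in 𝓝 x, x' ∈ e.target ∧ formCoeff e b x' = 0 := mem_interior_iff_mem_nhds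
  have h2 : e.symm x ∈ interior {m | b m = 0} ↔ ∀ᶠ m in 𝓝 (e.symm x), b m = 0 :=
    mem_interior_iff_mem_nhds
  rw [h1, h2, ← e.symm.map_nhds_eq hx, eventually_map]
  constructor
  · intro h
    filter_upwards [h] with x' hx'
    exact (formCoeff_eq_zero_iff he hx'.1).1 hx'.2
  · intro h
    filter_upwards [h, e.open_target.mem_nhds hx] with x' hx' hxt
    exact ⟨hxt, (formCoeff_eq_zero_iff he hxt).2 hx'⟩

end Charts

end

end Finsler

/-! ### The theorem on the manifold -/

theorem theorem1p3 {n : ℕ} (hn : 2 ≤ n) {M : Type*} [TopologicalSpace M]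
    [ChartedSpace (EuclideanSpace ℝ (Fin n)) M] [IsManifold (𝓡 n) ∞ M]
    [ConnectedSpace M]
    (a : Finsler.RiemMetric n M) (b : Finsler.OneForm n M) (hab : Finsler.IsRanders a b)
    (hnR : ¬ Finsler.IsRiemannian (Finsler.randers a b))
    (K : TangentBundle (𝓡 n) M → ℝ)
    (hK : Finsler.IsOfScalarFlagCurvature (Finsler.randers a b) K) :
    (∀ v : TangentBundle (𝓡 n) M, v.snd ≠ 0 → K v = 0) ↔
      Finsler.FrakRSymmetric (Finsler.randers a b) := by
  open Finsler Filter Topology in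
  have hloc := fun e he => isLocalRanders_inChart (e := e) hab he
  constructor
  · intro h0 e he x hx y hy i j
    refine (hloc e he).isLocalFinsler.frakR_symm_of_K_eq_zero (fun z hz => hz.2)
      (hloc e he).flag_denominator_ne_zero (K := inChart K e)
      (fun z hz u hu => hK e he z.1 hz.1 z.2 u hu) hn (fun z => h0 _ fun hz => ?_)
      ⟨(x, y), hx, hy⟩ i j
    exact z.2.2 ((bijective_mfderiv_symm he z.2.1).1 (hz.trans (map_zero _).symm))
  · intro hs
    have hR : ∀ e ∈ IsManifold.maximalAtlas (𝓡 n) ∞ M, ∀ x ∈ e.target, formCoeff e b x ≠ 0 →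
        ∀ y : Coord n, y ≠ 0 → ∀ i k, riemann (inChart (randers a b) e) i k x y = 0 :=
      fun e he x hx hb y hy i k => (hloc e he).riemann_eq_zero_of_b_ne_zero hn
        (K := inChart K e) (fun z hz u hu => hK e he z.1 hz.1 z.2 u hu)
        (fun z hz i j => hs e he z.1 hz.1 z.2 hz.2 i j) hx hb hy i k
    -- Closedness is checked in a chart at each point of the closure, by the unique continuation
    -- result.
    have hclosed : IsClosed (interior {m | b m = 0}) := by
      refine isClosed_of_closure_subset fun p hp => ?_
      have he := IsManifold.chart_mem_maximalAtlas (I := 𝓡 n) (n := ∞) p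
      set e := chartAt (EuclideanSpace ℝ (Fin n)) p
      have hps : p ∈ e.source := mem_chart_source _ p
      have hpt : e p ∈ e.target := e.map_source hps
      have hpe : e.symm (e p) = p := e.left_inv hps
      rw [← hpe]
      rw [← mem_zeroInterior_iff he hpt]
      refine (hloc e he).mem_zeroInterior_of_mem_closure (hR e he) hn hpt ?_
      rw [mem_closure_iff_frequently, ← hpe, ← e.symm.map_nhds_eq hpt, frequently_map] at hp
      rw [mem_closure_iff_frequently]
      refine (hp.and_eventually (e.open_target.mem_nhds hpt)).mono fun x hx => ?_
      exact (mem_zeroInterior_iff he hx.2).2 hx.1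
    have hempty : interior {m | b m = 0} = ∅ := by
      rcases isClopen_iff.1 ⟨hclosed, isOpen_interior⟩ with h | h
      · exact h
      -- If the interior is all of M, then β = 0 and F = α, which is excluded.
      · refine absurd ⟨a, fun v => ?_⟩ hnR
        have hb : b v.proj = 0 := interior_subset (s := {m | b m = 0}) (by rw [h]; trivial)
        rw [randers, hb]
        simp
    have key : ∀ e ∈ IsManifold.maximalAtlas (𝓡 n) ∞ M, ∀ x ∈ e.target, ∀ m, e.symm x = m →
        ∀ w : TangentSpace (𝓡 n) m, w ≠ 0 → K ⟨m, w⟩ = 0 := by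
      rintro e he x hx _ rfl w hw
      obtain ⟨y, rfl⟩ := (bijective_mfderiv_symm he hx).2 w
      have hy : y ≠ 0 := by rintro rfl; exact hw (map_zero _)
      -- Any flag with pole y computes K, and such a flag exists as n ≥ 2; its numerator vanishes
      -- with the Riemann curvature.
      obtain ⟨u, hu⟩ := exists_independent hn hy
      refine (hK e he x hx y u hu).symm.trans ?_
      have hvec : riemannVec (inChart (randers a b) e) x y u = 0 := by
        ext i
        change ∑ k, riemann (inChart (randers a b) e) i k x y * u k = 0
        refine Finset.sum_eq_zero fun k _ => ?_
        rw [(hloc e he).riemann_eq_zero_of_dense (hR e he) (fun x hx hx' => ?_) hx hy, zero_mul]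
        have := (mem_zeroInterior_iff he hx).1 hx'
        rw [hempty] at this
        exact this
      simp [flagCurvature, hvec, fundForm]
    rintro ⟨m, w⟩ hw
    have he := IsManifold.chart_mem_maximalAtlas (I := 𝓡 n) (n := ∞) m
    exact key _ he _ ((chartAt _ m).map_source (mem_chart_source _ m)) m
      ((chartAt _ m).left_inv (mem_chart_source _ m)) w hw
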